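/- Let $R\subset\mathfrak a^*$ be a finite crystallographic (possibly non-reduced) root system spanning $\mathfrak a^*$, where $\mathfrak a$ is a Euclidean space, with Weyl group $W$, positive roots $R^+$, simple roots $\Pi$, and a $W$-invariant multiplicity function $k:R\to\mathbb R_{\ge0}$. Let $Q^\vee\subset\mathfrak a$ be the lattice generated by the coroots $\alpha^\vee$, $P=\{\lambda\in\mathfrak a^*: \langle\lambda,\alpha^\vee\rangle\in\mathbb Z\ \forall\alpha\in R\}$ the weight lattice, $P^+$ the dominant weights, and $T=i\mathfrak a/2\pi iQ^\vee$ the compact torus with a Haar measure $dt$; $W$ acts on $\mathbb C[P]$ by $we^\lambda=e^{w\lambda}$. Let $I\subset\Pi$, let $W_I=\langle s_\alpha:\alpha\in I\rangle$, let $R_I^+$ be the set of $\alpha\in R^+$ with $s_\alpha\in W_I$, let $W^I=\{v\in W: v(R_I^+)\subset R^+\}$ and $P_I^+=\{\lambda\in P:\langle\lambda,\alpha^\vee\rangle\ge0\ \forall\alpha\in R_I^+\}$. Put $\delta_k=\prod_{\alpha\in R}|e^{\alpha/2}-e^{-\alpha/2}|^{k_\alpha}$ and $$(\phi,\psi)_k=\int_T\overline{\phi(t)}\,\psi(t)\,\delta_k(t)\,dt\quad(\phi,\psi\in\mathbb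 C[P]),$$ $$(\Phi,\Psi)_{I,k}=\int_T\mathrm{tr}\big(\overline{\Phi(t)}\Psi(t)\big)\delta_k(t)\,dt\quad(\Phi,\Psi\in\mathbb C[P]\otimes\mathbb C[W/W_I]),$$ where $\mathbb C[W/W_I]$ is the algebra of functions on $W/W_I$ and $\mathrm{tr}$ is the sum of the components; both integrals converge. For $\lambda\in P$ let $\lambda_+$ be the unique element of $W\lambda\cap P^+$ and $\overline v(\lambda)\in W$ the shortest element with $\overline v(\lambda)\lambda_+=\lambda$. Write $\mu\le\lambda$ if $\lambda_+-\mu_+\in\sum_{\alpha\in\Pi}\mathbb Z_{\ge0}\,\alpha$ and, in case $\lambda_+=\mu_+$, also $\overline v(\mu)\le\overline v(\lambda)$ in the Bruhat order of $W$; let $\mu<_I\lambda$ mean that $\mu,\lambda\in P_I^+$, $\mu\le\lambda$, $\mu\ne\lambda$. Put $m_I(\lambda)=\sum_{\mu\in W_I\lambda}e^\mu$. Let $W$ act diagonally on $\mathbb C[P]\otimes\mathbb C[W/W_I]$, $w(\phi\otimes\delta_{uW_I})=w\phi\otimes\delta_{wuW_I}$. Then: 1. The map $\Gamma:\mathbb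 C[P]^{W_I}\to(\mathbb C[P]\otimes\mathbb C[W/W_I])^W$, $\Gamma(\phi)=\sum_{u\in W^I}u(\phi\otimes\delta_{eW_I})$, is an isomorphism of $\mathbb C[P]^W$-modules, and $(\Gamma(\phi),\Gamma(\psi))_{I,k}=|W^I|\,(\phi,\psi)_k$ for all $\phi,\psi\in\mathbb C[P]^{W_I}$. 2. For each $\lambda\in P_I^+$ there is a unique $p_I(\lambda,k)$ of the form $m_I(\lambda)+\sum_{\mu<_I\lambda}c_\mu m_I(\mu)$, $c_\mu\in\mathbb C$, with $(p_I(\lambda,k),m_I(\mu))_k=0$ for all $\mu<_I\lambda$; it lies in $\mathbb C[P]^{W_I}$. 3. The family $P_I(\lambda,k)=\Gamma(p_I(\lambda,k))$, $\lambda\in P_I^+$, is a basis of the complex vector space $(\mathbb C[P]\otimes\mathbb C[W/W_I])^W$, and it is orthogonal: $(P_I(\lambda,k),P_I(\mu,k))_{I,k}=0$ for $\lambda\ne\mu$ in $P_I^+$, and $(P_I(\lambda,k),P_I(\lambda,k))_{I,k}>0$. -/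

import Mathlib

/-!
Conventions. `R : RootPairing ι ℝ M N` with `[R.IsRootSystem] [R.IsCrystallographic]` and `ι` finite
is a (crystallographic, possibly non-reduced) root system `{R.root i}` in `M = 𝔞*`, with coroots
`R.coroot i` in `N = 𝔞`; `R.coroot' i lam` is the number `⟨lam, α_i^∨⟩`, `R.root' i x` is `α_i(x)`,
and `R.weylGroup` is the Weyl group.
-/

noncomputable section

open scoped TensorProduct ComplexConjugate

namespace VVJacobi

section Lattices

variable {ι M N : Type*} [AddCommGroup M] [Module ℝ M] [AddCommGroup N] [Module ℝ N]

/-- The weight lattice `P`: all `lam` in `𝔞*` with `⟨lam, α^∨⟩ ∈ ℤ` for all roots `α`. -/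
def weightLattice (R : RootPairing ι ℝ M N) : AddSubgroup M where
  carrier := {lam | ∀ i, ∃ n : ℤ, R.coroot' i lam = n}
  zero_mem' := fun _ => ⟨0, by simp⟩
  add_mem' := by
    intro a b ha hb i
    obtain ⟨m, hm⟩ := ha i
    obtain ⟨n, hn⟩ := hb i
    exact ⟨m + n, by rw [map_add, hm, hn]; push_cast; rfl⟩
  neg_mem' := by
    intro a ha i
    obtain ⟨m, hm⟩ := ha i
    exact ⟨-m, by rw [map_neg, hm]; push_cast; rfl⟩

/-- The coroot lattice `Q^∨`. -/
def corootLattice (R : RootPairing ι ℝ M N) : AddSubgroup N :=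
  AddSubgroup.closure (Set.range R.coroot)

/-- The group algebra `ℂ[P]`; the basis element `e^lam` is `AddMonoidAlgebra.single lam 1`. -/
abbrev Laurent (R : RootPairing ι ℝ M N) : Type _ := AddMonoidAlgebra ℂ (weightLattice R)

theorem root_mem_weightLattice (R : RootPairing ι ℝ M N) [R.IsCrystallographic] (i : ι) :
    R.root i ∈ weightLattice R := by
  intro j
  obtain ⟨n, hn⟩ := R.exists_value (S := ℤ) i j
  exact ⟨n, hn.symm⟩

/-- A root, as an element of the weight lattice. -/
def rootWeight (R : RootPairing ι ℝ M N) [R.IsCrystallographic] (i : ι) : weightLattice R :=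
  ⟨R.root i, root_mem_weightLattice R i⟩

theorem smul_mem_weightLattice (R : RootPairing ι ℝ M N) [R.IsCrystallographic]
    (w : R.weylGroup) {lam : M} (h : lam ∈ weightLattice R) : w • lam ∈ weightLattice R := by
  obtain ⟨g, hg⟩ := w
  change g • lam ∈ weightLattice R
  induction hg using RootPairing.weylGroup.induction generalizing lam with
  | mem i =>
    rw [RootPairing.Equiv.reflection_smul, RootPairing.reflection_apply]
    obtain ⟨n, hn⟩ := h i
    have h2 : R.coroot' i lam • R.root i = n • R.root i := by
      rw [hn, Int.cast_smul_eq_zsmul]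
    rw [h2]
    exact sub_mem h (zsmul_mem (root_mem_weightLattice R i) n)
  | one => simpa using h
  | mul x y hx hy ihx ihy =>
    rw [mul_smul]
    exact ihx (ihy h)

/-- The action of the Weyl group on the weight lattice. -/
instance (R : RootPairing ι ℝ M N) [R.IsCrystallographic] :
    DistribMulAction R.weylGroup (weightLattice R) where
  smul w lam := ⟨w • (lam : M), smul_mem_weightLattice R w lam.2⟩
  one_smul lam := Subtype.ext (one_smul R.weylGroup (lam : M))
  mul_smul w u lam := Subtype.ext (mul_smul w u (lam : M))
  smul_zero w := Subtype.ext (smul_zero (A := M) w)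
  smul_add w lam mu := Subtype.ext (smul_add w (lam : M) (mu : M))

theorem coe_smul_weight (R : RootPairing ι ℝ M N) [R.IsCrystallographic] (w : R.weylGroup)
    (lam : weightLattice R) : ((w • lam : weightLattice R) : M) = w • (lam : M) := rfl

/-- The Weyl group of a finite root system is finite. -/
instance (R : RootPairing ι ℝ M N) [Finite ι] [R.IsRootSystem] : Finite R.weylGroup := by
  refine Finite.of_injective (fun w => R.weylGroupToPerm w) ?_
  intro w u h
  apply Subtype.ext
  apply RootPairing.Equiv.weightHom_injective R
  apply LinearEquiv.toLinearMap_injective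
  refine LinearMap.ext_on_range (v := R.root) RootPairing.IsRootSystem.span_root_eq_top ?_
  intro i
  have hw := R.weylGroup_apply_root w i
  have hu := R.weylGroup_apply_root u i
  have h' : R.weylGroupToPerm w i = R.weylGroupToPerm u i := congrArg (fun f => f i) h
  rw [h', ← hu] at hw
  exact hw

/-- `w e^lam = e^(w lam)`. -/
def weylAct (R : RootPairing ι ℝ M N) [R.IsCrystallographic] (w : R.weylGroup) :
    Laurent R →ₐ[ℂ] Laurent R :=
  AddMonoidAlgebra.mapDomainAlgHom ℂ ℂ (DistribSMul.toAddMonoidHom (weightLattice R) w)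

/-- The invariants `ℂ[P]^H` of a subgroup `H` of `W`, as an algebra. -/
def laurentInvariants (R : RootPairing ι ℝ M N) [R.IsCrystallographic] (H : Subgroup R.weylGroup) :
    Subalgebra ℂ (Laurent R) where
  carrier := {phi | ∀ w ∈ H, weylAct R w phi = phi}
  mul_mem' := by
    intro a b ha hb w hw
    rw [map_mul, ha w hw, hb w hw]
  add_mem' := by
    intro a b ha hb w hw
    rw [map_add, ha w hw, hb w hw]
  algebraMap_mem' := by
    intro c w _
    exact AlgHom.commutes _ c

end Lattices

/-! ### Positive roots, parabolic subgroups, Bruhat order -/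

section Combinatorics

variable {ι M N : Type*} [AddCommGroup M] [Module ℝ M] [AddCommGroup N] [Module ℝ N]

/-- A set of simple roots `Π`: linearly independent roots such that each root is a combination of
simple roots with coefficients in `ℕ` or in `-ℕ`. Equivalently, a choice of positive roots. -/
structure SimpleSystem (R : RootPairing ι ℝ M N) where
  support : Set ι
  linearIndepOn : LinearIndepOn ℝ R.root support
  pos_or_neg : ∀ i, R.root i ∈ AddSubmonoid.closure (R.root '' support) ∨
    -R.root i ∈ AddSubmonoid.closure (R.root '' support)

variable {R : RootPairing ι ℝ M N} (D : SimpleSystem R)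

/-- The positive roots `R⁺`. -/
def posRoots : Set ι := {i | R.root i ∈ AddSubmonoid.closure (R.root '' D.support)}

/-- The reflection `s_α` in `W`. -/
abbrev sRefl (R : RootPairing ι ℝ M N) (i : ι) : R.weylGroup := RootPairing.weylGroup.ofIdx R i

/-- The length of `w`: the least number of factors in a product of simple reflections equal
to `w`. -/
def weylLength (w : R.weylGroup) : ℕ :=
  sInf {n | ∃ l : List ι, (∀ i ∈ l, i ∈ D.support) ∧ l.length = n ∧ (l.map (sRefl R)).prod = w}

/-- The Bruhat order on `W`: the reflexive and transitive closure of the relation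
`u < u s_α` if `ℓ(u) < ℓ(u s_α)`, for arbitrary roots `α`. -/
def BruhatLE : R.weylGroup → R.weylGroup → Prop :=
  Relation.ReflTransGen fun u w => ∃ i, w = u * sRefl R i ∧ weylLength D u < weylLength D w

/-- The dominant weights `P⁺`. -/
def dominant : Set (weightLattice R) := {lam | ∀ i ∈ posRoots D, 0 ≤ R.coroot' i (lam : M)}

/-- The dominance order: `lam ≼ mu` iff `mu - lam` is in `Q⁺`, the `ℕ`-span of the simple roots. -/
def RootLE (lam mu : weightLattice R) : Prop :=
  (mu : M) - (lam : M) ∈ AddSubmonoid.closure (R.root '' D.support)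

/-- The parabolic subgroup `W_I` generated by the reflections `s_α`, `α ∈ I`. -/
def parabolic (R : RootPairing ι ℝ M N) (I : Set ι) : Subgroup R.weylGroup :=
  Subgroup.closure (sRefl R '' I)

/-- `R_I⁺ = R_I ∩ R⁺`, where `R_I` is the set of roots `α` with `s_α ∈ W_I`. -/
def posRootsI (I : Set ι) : Set ι := {i | sRefl R i ∈ parabolic R I ∧ i ∈ posRoots D}

/-- `W^I = {v ∈ W | v(R_I⁺) ⊆ R⁺}`. -/
def minReps (I : Set ι) : Set R.weylGroup :=
  {v | ∀ i ∈ posRootsI D I, R.weylGroupToPerm v i ∈ posRoots D}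

/-- `P_I⁺ = {lam ∈ P | ⟨lam, α^∨⟩ ≥ 0 for all α ∈ R_I⁺}`. -/
def domWeights (I : Set ι) : Set (weightLattice R) :=
  {lam | ∀ i ∈ posRootsI D I, 0 ≤ R.coroot' i (lam : M)}

variable [R.IsCrystallographic]

/-- `v` is the shortest element of `W` with `v mu = lam`. -/
def IsShortest (mu lam : weightLattice R) (v : R.weylGroup) : Prop :=
  v • mu = lam ∧ ∀ w : R.weylGroup, w • mu = lam → weylLength D v ≤ weylLength D w

/-- Heckman's partial order on `P`. Here `lam₊`, `mu₊` are the dominant weights in the `W`-orbits of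
`lam`, `mu`, and `v`, `u` are the shortest elements of `W` with `v lam₊ = lam`, `u mu₊ = mu`.
Then `lam ≤ mu` iff `lam₊ ≼ mu₊` and, if `lam₊ = mu₊`, also `v ≤ u` in the Bruhat order. (The
elements `lam₊`, `mu₊`, `v`, `u` exist and are unique.) -/
def WeightLE (lam mu : weightLattice R) : Prop :=
  ∃ lam' ∈ dominant D, ∃ mu' ∈ dominant D, ∃ v u : R.weylGroup,
    IsShortest D lam' lam v ∧ IsShortest D mu' mu u ∧
      RootLE D lam' mu' ∧ (lam' = mu' → BruhatLE D v u)

/-- The labels `mu <_I lam`, i.e. `mu ∈ P_I⁺`, `mu ≤ lam` and `mu ≠ lam`. -/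
def lowerWeights (I : Set ι) (lam : weightLattice R) : Set (weightLattice R) :=
  {mu | mu ∈ domWeights D I ∧ WeightLE D mu lam ∧ mu ≠ lam}

/-- The orbit sum `m_I(lam) = ∑_{mu ∈ W_I lam} e^mu`. -/
def orbitSum (R : RootPairing ι ℝ M N) [R.IsCrystallographic] (I : Set ι)
    (lam : weightLattice R) : Laurent R :=
  ∑ᶠ mu ∈ MulAction.orbit (parabolic R I) lam, AddMonoidAlgebra.single mu (1 : ℂ)

end Combinatorics

/-! ### The compact torus and the scalar inner product -/

section Torus

variable {ι M N : Type*} [AddCommGroup M] [Module ℝ M] [NormedAddCommGroup N] [NormedSpace ℝ N]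

/-- The compact torus `T = i𝔞 / 2πi Q^∨`, written as `𝔞 / Q^∨`: the class of `x : 𝔞` is the point
`exp(2πi x)`. -/
def Torus (R : RootPairing ι ℝ M N) : Type _ := N ⧸ corootLattice R

instance (R : RootPairing ι ℝ M N) : AddCommGroup (Torus R) :=
  inferInstanceAs (AddCommGroup (N ⧸ corootLattice R))

instance (R : RootPairing ι ℝ M N) : TopologicalSpace (Torus R) :=
  inferInstanceAs (TopologicalSpace (N ⧸ corootLattice R))

instance (R : RootPairing ι ℝ M N) : IsTopologicalAddGroup (Torus R) :=
  inferInstanceAs (IsTopologicalAddGroup (N ⧸ corootLattice R))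

instance (R : RootPairing ι ℝ M N) : MeasurableSpace (Torus R) := borel _

instance (R : RootPairing ι ℝ M N) : BorelSpace (Torus R) := ⟨rfl⟩

/-- The projection `𝔞 → T`. -/
def Torus.mk (R : RootPairing ι ℝ M N) : N →+ Torus R := QuotientAddGroup.mk' (corootLattice R)

/-- For a weight `lam`, the homomorphism `T → ℝ/ℤ` induced by `lam : 𝔞 → ℝ`. -/
def weightChar (R : RootPairing ι ℝ M N) (lam : weightLattice R) : Torus R →+ AddCircle (1 : ℝ) :=
  QuotientAddGroup.lift (corootLattice R)
    ((QuotientAddGroup.mk' (AddSubgroup.zmultiples (1 : ℝ))).comp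
      (R.toLinearMap (lam : M)).toAddMonoidHom) (by
    unfold corootLattice
    rw [AddSubgroup.closure_le]
    rintro _ ⟨i, rfl⟩
    obtain ⟨n, hn⟩ := lam.2 i
    rw [SetLike.mem_coe, AddMonoidHom.mem_ker]
    have h1 : R.toLinearMap (lam : M) (R.coroot i) = n := hn
    change ((R.toLinearMap (lam : M) (R.coroot i) : ℝ) : AddCircle (1 : ℝ)) = 0
    rw [h1, AddCircle.coe_eq_zero_iff]
    exact ⟨n, by simp⟩)

/-- The value of `e^lam` at `t`: if `t` is the class of `x`, this is `exp(2πi lam(x))`. -/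
def expWeight (R : RootPairing ι ℝ M N) (t : Torus R) (lam : weightLattice R) : ℂ :=
  (AddCircle.toCircle (weightChar R lam t) : ℂ)

theorem expWeight_mk (R : RootPairing ι ℝ M N) (x : N) (lam : weightLattice R) :
    expWeight R (Torus.mk R x) lam =
      Complex.exp (2 * Real.pi * Complex.I * (R.toLinearMap (lam : M) x : ℝ)) := by
  have h : weightChar R lam (Torus.mk R x) =
    ((R.toLinearMap (lam : M) x : ℝ) : AddCircle (1 : ℝ)) := rfl
  rw [expWeight, h, AddCircle.toCircle_apply_mk, Circle.coe_exp]
  congr 1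
  push_cast
  ring

theorem Torus.mk_surjective (R : RootPairing ι ℝ M N) : Function.Surjective (Torus.mk R) :=
  QuotientAddGroup.mk'_surjective _

/-- Evaluation of Laurent polynomials at `t`. -/
def evalAt (R : RootPairing ι ℝ M N) (t : Torus R) : Laurent R →ₐ[ℂ] ℂ :=
  AddMonoidAlgebra.lift ℂ ℂ (weightLattice R)
    { toFun := fun lam => expWeight R t lam.toAdd
      map_one' := by
        obtain ⟨x, rfl⟩ := Torus.mk_surjective R t
        simp [expWeight_mk]
      map_mul' := by
        intro a b
        obtain ⟨x, rfl⟩ := Torus.mk_surjective R t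
        simp [expWeight_mk, mul_add, Complex.exp_add] }

theorem evalAt_single (R : RootPairing ι ℝ M N) (t : Torus R) (lam : weightLattice R) (c : ℂ) :
    evalAt R t (AddMonoidAlgebra.single lam c) = c * expWeight R t lam := by
  simp [evalAt]

variable [Fintype ι]

/-- The weight function `δ_k = ∏_{α ∈ R} |e^{α/2} - e^{-α/2}|^{k_α}`, where
`|e^{α/2} - e^{-α/2}| = |e^α - 1|` on `T`. -/
def weightFun (R : RootPairing ι ℝ M N) [R.IsCrystallographic] (k : ι → ℝ) (t : Torus R) : ℝ :=
  ∏ i, ‖expWeight R t (rootWeight R i) - 1‖ ^ k i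

theorem weightFun_mk (R : RootPairing ι ℝ M N) [R.IsCrystallographic] (k : ι → ℝ) (x : N) :
    weightFun R k (Torus.mk R x) =
      ∏ i, ‖Complex.exp (Real.pi * Complex.I * (R.root' i x : ℝ)) -
        Complex.exp (-(Real.pi * Complex.I * (R.root' i x : ℝ)))‖ ^ k i := by
  refine Finset.prod_congr rfl fun i _ => ?_
  congr 1
  rw [expWeight_mk]
  have h : ∀ r : ℝ, Complex.exp (2 * Real.pi * Complex.I * r) - 1 =
      Complex.exp (Real.pi * Complex.I * r) * (Complex.exp (Real.pi * Complex.I * r) -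
        Complex.exp (-(Real.pi * Complex.I * r))) := by
    intro r
    rw [mul_sub, ← Complex.exp_add, ← Complex.exp_add, add_neg_cancel, Complex.exp_zero]
    congr 2
    ring
  have h2 : ∀ r : ℝ, ‖Complex.exp (Real.pi * Complex.I * r)‖ = 1 := by
    intro r
    rw [show (Real.pi * Complex.I * r : ℂ) = ((Real.pi * r : ℝ) : ℂ) * Complex.I by
      push_cast; ring]
    exact Complex.norm_exp_ofReal_mul_I _
  change ‖Complex.exp (2 * Real.pi * Complex.I * (R.toLinearMap (R.root i) x : ℝ)) - 1‖ = _
  rw [h, norm_mul, h2, one_mul]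

variable (R : RootPairing ι ℝ M N) [R.IsCrystallographic] (k : ι → ℝ)
  (dt : MeasureTheory.Measure (Torus R))

/-- The integrand of `(φ, ψ)_k`. -/
def integrand (phi psi : Laurent R) (t : Torus R) : ℂ :=
  conj (evalAt R t phi) * evalAt R t psi * (weightFun R k t : ℂ)

/-- `(φ, ψ)_k = ∫_T conj(φ(t)) ψ(t) δ_k(t) dt`. -/
def innerK (phi psi : Laurent R) : ℂ := ∫ t, integrand R k phi psi t ∂dt

end Torus

/-! ### Jacobi polynomials -/

section Jacobi

variable {ι M N : Type*} [AddCommGroup M] [Module ℝ M] [NormedAddCommGroup N] [NormedSpace ℝ N]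
  [Fintype ι] {R : RootPairing ι ℝ M N} [R.IsCrystallographic] (D : SimpleSystem R) (I : Set ι)
  (k : ι → ℝ) (dt : MeasureTheory.Measure (Torus R))

/-- The defining properties of `p_I(lam, k)`: `p = m_I(lam) + ∑_{mu <_I lam} c_mu m_I(mu)` for some
complex numbers `c_mu`, and `(p, m_I(mu))_k = 0` for all `mu <_I lam`. -/
def IsJacobi (lam : weightLattice R) (p : Laurent R) : Prop :=
  p - orbitSum R I lam ∈ Submodule.span ℂ (orbitSum R I '' lowerWeights D I lam) ∧
    ∀ mu ∈ lowerWeights D I lam, innerK R k dt p (orbitSum R I mu) = 0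

/-- The Jacobi polynomial `p_I(lam, k)`. -/
def jacobi (lam : weightLattice R) : Laurent R := Classical.epsilon (IsJacobi D I k dt lam)

end Jacobi

/-! ### Vector-valued Laurent polynomials -/

section VectorValued

variable {ι M N : Type*} [AddCommGroup M] [Module ℝ M]

section Algebraic

variable [AddCommGroup N] [Module ℝ N] (R : RootPairing ι ℝ M N) (I : Set ι)

/-- `ℂ[W/W_I]`, the functions on `W/W_I`. -/
abbrev CosetFun : Type _ := (R.weylGroup ⧸ parabolic R I) → ℂ

/-- `ℂ[P] ⊗ ℂ[W/W_I]`. It is a `ℂ[P]`-module through the first factor. -/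
abbrev VV : Type _ := Laurent R ⊗[ℂ] CosetFun R I

/-- The action of `W` on `ℂ[W/W_I]`: `(w f)(x) = f(w⁻¹ x)`, that is `w δ_{uW_I} = δ_{wuW_I}`. -/
def cosetAct (w : R.weylGroup) : CosetFun R I →ₗ[ℂ] CosetFun R I :=
  LinearMap.funLeft ℂ ℂ fun x => w⁻¹ • x

/-- The characteristic function `δ_{eW_I}`. -/
def deltaOne : CosetFun R I :=
  Set.indicator {(QuotientGroup.mk 1 : R.weylGroup ⧸ parabolic R I)} fun _ => 1

variable [R.IsCrystallographic]

/-- The diagonal action of `W` on `ℂ[P] ⊗ ℂ[W/W_I]`. -/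
def vvAct (w : R.weylGroup) : VV R I →ₗ[ℂ] VV R I :=
  TensorProduct.map (weylAct R w).toLinearMap (cosetAct R I w)

theorem vvAct_smul (w : R.weylGroup) (chi : Laurent R) (Phi : VV R I) :
    vvAct R I w (chi • Phi) = weylAct R w chi • vvAct R I w Phi := by
  induction Phi using TensorProduct.induction_on with
  | zero => simp
  | tmul phi f => simp [vvAct, TensorProduct.smul_tmul']
  | add x y hx hy => rw [smul_add, map_add, hx, hy, map_add, smul_add]

/-- `ℂ[P]^{W_I}`, as a module over `ℂ[P]^W`. -/
def scalarInvariants : Submodule (laurentInvariants R ⊤) (Laurent R) where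
  carrier := {phi | ∀ w ∈ parabolic R I, weylAct R w phi = phi}
  zero_mem' := fun w _ => map_zero _
  add_mem' := by
    intro a b ha hb w hw
    rw [map_add, ha w hw, hb w hw]
  smul_mem' := by
    intro c a ha w hw
    change weylAct R w ((c : Laurent R) * a) = (c : Laurent R) * a
    rw [map_mul, ha w hw, c.2 w trivial]

/-- `(ℂ[P] ⊗ ℂ[W/W_I])^W`, as a module over `ℂ[P]^W`. -/
def vvInvariants : Submodule (laurentInvariants R ⊤) (VV R I) where
  carrier := {Phi | ∀ w : R.weylGroup, vvAct R I w Phi = Phi}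
  zero_mem' := fun w => map_zero _
  add_mem' := by
    intro a b ha hb w
    rw [map_add, ha w, hb w]
  smul_mem' := by
    intro c a ha w
    change vvAct R I w ((c : Laurent R) • a) = (c : Laurent R) • a
    rw [vvAct_smul, ha w, c.2 w trivial]

variable {R}

/-- `Γ(φ) = ∑_{u ∈ W^I} u (φ ⊗ δ_{eW_I})`. -/
def Gam (D : SimpleSystem R) (phi : Laurent R) : VV R I :=
  ∑ᶠ u ∈ minReps D I, vvAct R I u (phi ⊗ₜ[ℂ] deltaOne R I)

/-- The functional `tr(f) = ∑_{v ∈ W^I} f(vW_I)`, the sum of the components. -/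
def compSum (D : SimpleSystem R) (f : CosetFun R I) : ℂ :=
  ∑ᶠ v ∈ minReps D I, f (QuotientGroup.mk v)

end Algebraic

section Analytic

variable [NormedAddCommGroup N] [NormedSpace ℝ N]

/-- The value at `t` of a `ℂ[W/W_I]`-valued Laurent polynomial: `(φ ⊗ f)(t) = φ(t) f`. -/
def vvEvalAt (R : RootPairing ι ℝ M N) (I : Set ι) (t : Torus R) :
    VV R I →ₗ[ℂ] CosetFun R I :=
  TensorProduct.lift ((LinearMap.lsmul ℂ (CosetFun R I)).comp (evalAt R t).toLinearMap)

variable [Fintype ι] {R : RootPairing ι ℝ M N} [R.IsCrystallographic] (D : SimpleSystem R)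
  (I : Set ι) (k : ι → ℝ) (dt : MeasureTheory.Measure (Torus R))

/-- The integrand of `(Φ, Ψ)_{I,k}`. -/
def vvIntegrand (Phi Psi : VV R I) (t : Torus R) : ℂ :=
  compSum I D (conj (vvEvalAt R I t Phi) * vvEvalAt R I t Psi) * (weightFun R k t : ℂ)

/-- `(Φ, Ψ)_{I,k} = ∫_T tr(conj(Φ(t)) Ψ(t)) |δ_k(t)| dt`. -/
def vvInner (Phi Psi : VV R I) : ℂ := ∫ t, vvIntegrand D I k Phi Psi t ∂dt

/-- The vector-valued Jacobi polynomial `P_I(lam, k) = Γ(p_I(lam, k))`. -/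
def vvJacobi (lam : weightLattice R) : VV R I := Gam I D (jacobi D I k dt lam)

end Analytic

end VectorValued

end VVJacobi

end

open VVJacobi

noncomputable section

open scoped TensorProduct ComplexConjugate

namespace VVJacobi

set_option linter.unusedSectionVars false

/-! ### Root system combinatorics -/

section RootCombinatorics

variable {ι M N : Type*} [AddCommGroup M] [Module ℝ M] [AddCommGroup N] [Module ℝ N]
  {R : RootPairing ι ℝ M N}

/-! For `I = ∅` the orbit sums are the monomials `e^λ`, and the polynomials of the theorem become
the nonsymmetric polynomials `E_λ` (`nonsymJacobi`). The proof settles this case with Cherednik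
operators and obtains every other `I` by symmetrization.

The Cherednik operators `T_f`, for `f` a linear form on `𝔞*`, have three properties. They are
triangular on the `e^λ` for Heckman's order, with diagonal entry `f` of `spectralWeight`
(`cherednik_triangular`). They are symmetric for `(·,·)_k` (`innerK_cherednik`). They satisfy a
cross relation `s_a T_f = T_{f∘s_a} s_a + const` for simple `a` (`weylAct_cherednik`). Since `k ≥
0`, spectral weights separate weights (`eq_of_spectral_eq`). Hence the `E_λ` are joint eigenvectors,
they are pairwise orthogonal, and `s_a E_λ` lies in the span of `E_λ` and `E_{s_a λ}`.

Consequently the span of the `E_μ` with `μ ∈ W_I λ` is `W_I`-stable. For `I`-dominant `λ`, which is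
the least element of its `W_I`-orbit, the `W_I`-symmetrization of `E_λ` is a multiple of `p_I(λ)`
(`jacobi_eq_parabolicSum`). Thus `p_I(λ)` is `W_I`-invariant, and for distinct labels these
polynomials lie in spans over disjoint orbits, so they are orthogonal. They span the invariants
because the orbit sums do and the change of family is unitriangular.

The analytic point is the symmetry of the `W`-equivariant operators of Heckman. It comes from
integrating the derivative of `conj φ · ψ · δ_k` over `T`. As `δ_k` need not be differentiable at
its zeros, it is replaced by `∏ (|e^α - 1|² + ε)^{k_α/2}`. The singular terms are symmetrized under
`s_α`, and then `ε → 0` by dominated convergence.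

Finally, for invariant `φ` the component of `Γ(φ)` at `wW_I` is `wφ`, so `Γ` is inverted by taking
the component at `eW_I`. `W`-invariance of `(·,·)_k` makes each of the `|W^I|` components contribute
`(φ, ψ)_k`. -/

theorem sRefl_smul (i : ι) (x : M) : sRefl R i • x = x - R.coroot' i x • R.root i := by
  change RootPairing.Equiv.reflection R i • x = _
  rw [RootPairing.Equiv.reflection_smul, RootPairing.reflection_apply]

theorem weyl_ext [R.IsRootSystem] {w u : R.weylGroup} (h : ∀ x : M, w • x = u • x) : w = u := by
  apply Subtype.ext
  apply RootPairing.Equiv.weightHom_injective R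
  exact LinearEquiv.ext h

theorem weyl_smul_smul (w : R.weylGroup) (c : ℝ) (x : M) : w • (c • x) = c • (w • x) :=
  smul_comm w.1 c x

theorem root_perm (w : R.weylGroup) (i : ι) : R.root (R.weylGroupToPerm w i) = w • R.root i :=
  (R.weylGroup_apply_root w i).symm

theorem perm_mul (w u : R.weylGroup) (i : ι) :
    R.weylGroupToPerm (w * u) i = R.weylGroupToPerm w (R.weylGroupToPerm u i) := by
  rw [map_mul]; rfl

theorem coroot_perm (w : R.weylGroup) (i : ι) (x : M) :
    R.coroot' (R.weylGroupToPerm w i) (w • x) = R.coroot' i x := by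
  obtain ⟨g, hg⟩ := w
  induction hg using RootPairing.weylGroup.induction generalizing i x with
  | mem j =>
    have h1 : R.weylGroupToPerm ⟨RootPairing.Equiv.reflection R j, R.reflection_mem_weylGroup j⟩ i =
        R.reflectionPerm j i := rfl
    have h2 : (⟨RootPairing.Equiv.reflection R j, R.reflection_mem_weylGroup j⟩ : R.weylGroup) • x =
      R.reflection j x := RootPairing.Equiv.reflection_smul R j x
    rw [h1, h2, RootPairing.coroot'_reflection, RootPairing.reflectionPerm_self]
  | one =>
    have h1 : R.weylGroupToPerm ⟨1, one_mem _⟩ i = i := by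
      change R.weylGroupToPerm 1 i = i
      rw [map_one]; rfl
    have h2 : (⟨1, one_mem _⟩ : R.weylGroup) • x = x := one_smul R.weylGroup x
    rw [h1, h2]
  | mul a b ha hb iha ihb =>
    have h : (⟨a * b, mul_mem ha hb⟩ : R.weylGroup) = ⟨a, ha⟩ * ⟨b, hb⟩ := rfl
    rw [h, mul_smul, perm_mul, iha, ihb]

theorem coroot_smul (w : R.weylGroup) (i : ι) (x : M) :
    R.coroot' i (w • x) = R.coroot' (R.weylGroupToPerm w⁻¹ i) x := by
  rw [← coroot_perm w (R.weylGroupToPerm w⁻¹ i), ← perm_mul, mul_inv_cancel, map_one]; rfl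

theorem sRefl_perm [R.IsRootSystem] (w : R.weylGroup) (i : ι) :
    sRefl R (R.weylGroupToPerm w i) = w * sRefl R i * w⁻¹ := by
  refine weyl_ext fun x => ?_
  obtain ⟨y, rfl⟩ : ∃ y, x = w • y := ⟨w⁻¹ • x, by simp⟩
  rw [sRefl_smul, coroot_perm, root_perm, mul_smul, mul_smul, inv_smul_smul, sRefl_smul, smul_sub,
    weyl_smul_smul]

theorem sRefl_mul_self [R.IsRootSystem] (i : ι) : sRefl R i * sRefl R i = 1 := by
  refine weyl_ext fun x => ?_
  rw [mul_smul, one_smul, sRefl_smul, sRefl_smul, map_sub, map_smul]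
  simp only [smul_eq_mul, RootPairing.root_coroot'_eq_pairing, RootPairing.pairing_same, sub_smul,
    mul_smul]
  module

theorem sRefl_inv [R.IsRootSystem] (i : ι) : (sRefl R i)⁻¹ = sRefl R i :=
  inv_eq_of_mul_eq_one_left (sRefl_mul_self i)

theorem root_sRefl_self (i : ι) : R.root (R.weylGroupToPerm (sRefl R i) i) = -R.root i := by
  rw [root_perm, sRefl_smul, RootPairing.root_coroot'_eq_pairing, RootPairing.pairing_same]
  module

/-- In a non-reduced system `α` and `2α` may both be roots; arguments that identify a root only up
to a scalar still determine its reflection. -/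
theorem sRefl_eq_of_root_eq_smul [Finite ι] [R.IsRootSystem] {i j : ι} {t : ℝ}
    (h : R.root j = t • R.root i) : sRefl R j = sRefl R i := by
  have : IsAddTorsionFree N := .of_isTorsionFree ℝ N
  have hc := RootPairing.smul_coroot_eq_of_root_eq_smul i j t h
  refine weyl_ext fun x => ?_
  have hc' : R.coroot' i x = t * R.coroot' j x := by
    have := congrArg (R.toLinearMap x) hc
    rw [map_smul, smul_eq_mul] at this
    exact this.symm
  rw [sRefl_smul, sRefl_smul, h, hc', smul_smul, mul_comm]

/-! ### Coordinates and height relative to the simple roots -/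

variable (D : SimpleSystem R)

/-- The simple roots, as a basis of the ambient space. -/
def SimpleSystem.basis [R.IsRootSystem] : Module.Basis D.support ℝ M :=
  Module.Basis.mk (v := fun i : D.support => R.root i) D.linearIndepOn (by
    rw [← RootPairing.IsRootSystem.span_root_eq_top (P := R), Submodule.span_le]
    rintro _ ⟨i, rfl⟩
    have hle : AddSubmonoid.closure (R.root '' D.support) ≤
        (Submodule.span ℝ (Set.range fun i : D.support => R.root i)).toAddSubmonoid := by
      rw [AddSubmonoid.closure_le]
      rintro _ ⟨j, hj, rfl⟩
      exact Submodule.subset_span ⟨⟨j, hj⟩, rfl⟩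
    rcases D.pos_or_neg i with h | h
    · exact hle h
    · simpa using hle h)

/-- The coordinate of a vector along a simple root. -/
def SimpleSystem.coord [R.IsRootSystem] (a : D.support) : M →ₗ[ℝ] ℝ := D.basis.coord a

/-- The height: the sum of the coordinates along the simple roots. -/
def SimpleSystem.height [R.IsRootSystem] : M →ₗ[ℝ] ℝ := D.basis.constr ℝ fun _ => (1 : ℝ)

variable [R.IsRootSystem]

theorem basis_apply (a : D.support) : D.basis a = R.root a :=
  Module.Basis.mk_apply _ _ a

theorem coord_root_self (a : D.support) : D.coord a (R.root a) = 1 := by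
  rw [← basis_apply, SimpleSystem.coord, Module.Basis.coord_apply]; simp

theorem coord_root_ne {a b : D.support} (h : b ≠ a) : D.coord a (R.root b) = 0 := by
  rw [← basis_apply, SimpleSystem.coord, Module.Basis.coord_apply]; simp [h]

theorem height_root_simple (a : D.support) : D.height (R.root a) = 1 := by
  rw [← basis_apply, SimpleSystem.height, Module.Basis.constr_basis]

theorem coord_nonneg_of_mem {x : M} (hx : x ∈ AddSubmonoid.closure (R.root '' D.support))
    (a : D.support) : 0 ≤ D.coord a x := by
  induction hx using AddSubmonoid.closure_induction with
  | mem y hy =>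
    obtain ⟨j, hj, rfl⟩ := hy
    by_cases h : (⟨j, hj⟩ : D.support) = a
    · subst h; rw [coord_root_self D ⟨j, hj⟩]; norm_num
    · exact (coord_root_ne D h).ge
  | zero => simp
  | add y z _ _ h1 h2 => rw [map_add]; positivity

theorem eq_zero_of_coord {x : M} (h : ∀ a, D.coord a x = 0) : x = 0 :=
  D.basis.ext_elem fun a => by simpa [SimpleSystem.coord] using h a

theorem height_nonneg_of_mem {x : M} (hx : x ∈ AddSubmonoid.closure (R.root '' D.support)) :
    0 ≤ D.height x := by
  induction hx using AddSubmonoid.closure_induction with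
  | mem y hy =>
    obtain ⟨j, hj, rfl⟩ := hy
    rw [height_root_simple D ⟨j, hj⟩]; norm_num
  | zero => simp
  | add y z _ _ h1 h2 => rw [map_add]; positivity

theorem height_pos_of_mem {x : M} (hx : x ∈ AddSubmonoid.closure (R.root '' D.support))
    (h0 : x ≠ 0) : 0 < D.height x := by
  -- Strict positivity is not stable in the induction because of the zero vector; this dichotomy is.
  have key : x = 0 ∨ 1 ≤ D.height x := by
    clear h0
    induction hx using AddSubmonoid.closure_induction with
    | mem y hy =>
      obtain ⟨j, hj, rfl⟩ := hy
      rw [height_root_simple D ⟨j, hj⟩]; right; norm_num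
    | zero => simp
    | add y z hy hz h1 h2 =>
      rw [map_add]
      have := height_nonneg_of_mem D hy
      rcases h1 with rfl | h1
      · rcases h2 with rfl | h2
        · simp
        · right; linarith
      · right; linarith [height_nonneg_of_mem D hz]
  rcases key with h | h
  · exact absurd h h0
  · linarith

theorem mem_posRoots {i : ι} :
    i ∈ posRoots D ↔ R.root i ∈ AddSubmonoid.closure (R.root '' D.support) := Iff.rfl

theorem neg_root_mem_of_not_pos {i : ι} (h : i ∉ posRoots D) :
    -R.root i ∈ AddSubmonoid.closure (R.root '' D.support) :=
  (D.pos_or_neg i).resolve_left h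

theorem not_pos_of_neg_root_mem {i : ι}
    (h : -R.root i ∈ AddSubmonoid.closure (R.root '' D.support)) : i ∉ posRoots D := by
  intro hi
  have h1 := height_pos_of_mem D hi (R.ne_zero i)
  have h2 := height_nonneg_of_mem D h
  rw [map_neg] at h2
  linarith

theorem pos_of_simple {i : ι} (h : i ∈ D.support) : i ∈ posRoots D :=
  AddSubmonoid.subset_closure ⟨i, h, rfl⟩

/-- `-α` is positive iff `α` is not. -/
theorem neg_pos_iff {i j : ι} (h : R.root j = -R.root i) : j ∈ posRoots D ↔ i ∉ posRoots D := by
  constructor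
  · intro hj
    apply not_pos_of_neg_root_mem
    rw [← h]; exact hj
  · intro hi
    rw [mem_posRoots, h]
    exact neg_root_mem_of_not_pos D hi

theorem perm_sRefl_self_pos_iff {i : ι} (w : R.weylGroup) :
    R.weylGroupToPerm (w * sRefl R i) i ∈ posRoots D ↔ R.weylGroupToPerm w i ∉ posRoots D := by
  apply neg_pos_iff
  rw [perm_mul, root_perm, root_sRefl_self, smul_neg, root_perm]

/-- A simple reflection makes only multiples of the simple root negative. -/
theorem root_eq_smul_of_simple_neg {a i : ι} (ha : a ∈ D.support) (hi : i ∈ posRoots D)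
    (h : R.weylGroupToPerm (sRefl R a) i ∉ posRoots D) :
    ∃ c : ℝ, 0 < c ∧ R.root i = c • R.root a := by
  have hn := neg_root_mem_of_not_pos D h
  rw [root_perm, sRefl_smul] at hn
  -- `s_a` changes only the coordinate along `a`. Every other coordinate of the root is nonnegative
  -- before the reflection and nonpositive after it, so it vanishes.
  have hc : ∀ b : D.support, b ≠ ⟨a, ha⟩ → D.coord b (R.root i) = 0 := by
    intro b hb
    have h1 := coord_nonneg_of_mem D hi b
    have h2 := coord_nonneg_of_mem D hn b
    rw [map_neg, map_sub, map_smul, coord_root_ne D (a := b) (b := ⟨a, ha⟩) (Ne.symm hb)] at h2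
    simp only [smul_zero, sub_zero] at h2
    linarith
  have hr : R.root i = D.coord ⟨a, ha⟩ (R.root i) • R.root a := by
    rw [← sub_eq_zero]
    apply eq_zero_of_coord D
    intro b
    rw [map_sub, map_smul]
    by_cases hb : b = ⟨a, ha⟩
    · subst hb; rw [coord_root_self D ⟨a, ha⟩]; simp
    · rw [hc b hb, coord_root_ne D (a := b) (b := ⟨a, ha⟩) (Ne.symm hb)]; simp
  refine ⟨_, lt_of_le_of_ne (coord_nonneg_of_mem D hi _) ?_, hr⟩
  intro h0
  rw [← h0, zero_smul] at hr
  exact R.ne_zero i hr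

/-- The product of the simple reflections in a word. -/
abbrev wordProd (R : RootPairing ι ℝ M N) (l : List ι) : R.weylGroup := (l.map (sRefl R)).prod

/-! ### Exchange condition, length and Bruhat order -/

variable [Fintype ι]

/-- The exchange condition. -/
theorem exchange {l : List ι} (hl : ∀ a ∈ l, a ∈ D.support) {i : ι} (hi : i ∈ posRoots D)
    (h : R.weylGroupToPerm (wordProd R l) i ∉ posRoots D) :
    ∃ l' : List ι, (∀ a ∈ l', a ∈ l) ∧ l'.length + 1 = l.length ∧
      wordProd R l' = wordProd R l * sRefl R i := by
  induction l with
  | nil => 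
    refine absurd hi ?_
    simpa [wordProd] using h
  | cons a l ih =>
    have hp : wordProd R (a :: l) = sRefl R a * wordProd R l := by simp [wordProd]
    -- Read the word from the right and find the letter at which the root turns negative. If it is
    -- the first letter `a`, then `vα_i` is a multiple of `α_a` for the remaining product `v`, so
    -- `s_a = v s_i v⁻¹` and `a` is the letter to delete.
    by_cases hv : R.weylGroupToPerm (wordProd R l) i ∈ posRoots D
    · refine ⟨l, fun b hb => List.mem_cons_of_mem _ hb, by simp, ?_⟩
      rw [hp, perm_mul] at h
      obtain ⟨c, -, hc⟩ := root_eq_smul_of_simple_neg D (hl a (by simp)) hv h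
      have h1 := sRefl_eq_of_root_eq_smul hc
      rw [sRefl_perm] at h1
      rw [hp, ← h1]
      simp only [mul_assoc, inv_mul_cancel_left, sRefl_mul_self, mul_one]
    · obtain ⟨l', h1, h2, h3⟩ := ih (fun b hb => hl b (List.mem_cons_of_mem _ hb)) hv
      refine ⟨a :: l', ?_, by simp [h2], ?_⟩
      · intro b hb
        rcases List.mem_cons.1 hb with rfl | hb
        · simp
        · exact List.mem_cons_of_mem _ (h1 b hb)
      · rw [hp, mul_assoc, ← h3]; simp [wordProd]

theorem exists_word {I : Set ι} {w : R.weylGroup} (hw : w ∈ parabolic R I) :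
    ∃ l : List ι, (∀ a ∈ l, a ∈ I) ∧ wordProd R l = w := by
  induction hw using Subgroup.closure_induction_left with
  | one => exact ⟨[], by simp, by simp [wordProd]⟩
  | mul_left x hx y _ ih =>
    obtain ⟨a, ha, rfl⟩ := hx
    obtain ⟨l, hl, rfl⟩ := ih
    exact ⟨a :: l, by simpa [ha] using hl, by simp [wordProd]⟩
  | inv_mul_cancel x hx y _ ih =>
    obtain ⟨a, ha, rfl⟩ := hx
    obtain ⟨l, hl, rfl⟩ := ih
    exact ⟨a :: l, by simpa [ha] using hl, by rw [sRefl_inv]; simp [wordProd]⟩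

/-- Take a shortest word for `w` among those with letters in `I`. If its last letter stayed positive
under `w`, the prefix would make it negative, and the exchange condition would give a shorter word
with letters still in `I`. -/
theorem exists_simple_neg {I : Set ι} (hI : I ⊆ D.support) {w : R.weylGroup}
    (hw : w ∈ parabolic R I) (h1 : w ≠ 1) :
    ∃ a ∈ I, R.weylGroupToPerm w a ∉ posRoots D := by
  classical
  have hex : ∃ n, ∃ l : List ι, l.length = n ∧ (∀ a ∈ l, a ∈ I) ∧ wordProd R l = w := by
    obtain ⟨l, hl⟩ := exists_word hw
    exact ⟨_, l, rfl, hl⟩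
  obtain ⟨l, hn, hl, hp⟩ := Nat.find_spec hex
  rcases List.eq_nil_or_concat l with rfl | ⟨l₀, a, rfl⟩
  · exact absurd hp.symm h1
  refine ⟨a, hl a (by simp), fun hpos => ?_⟩
  have hv : w = wordProd R l₀ * sRefl R a := by rw [← hp]; simp [wordProd]
  rw [hv, perm_sRefl_self_pos_iff] at hpos
  have hl₀ : ∀ b ∈ l₀, b ∈ I := fun b hb => hl b (by simp [hb])
  obtain ⟨l', h2, h3, h4⟩ := exchange D (fun b hb => hI (hl₀ b hb)) (pos_of_simple D
    (hI (hl a (by simp)))) hpos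
  refine Nat.find_min hex (m := l'.length) ?_ ⟨l', rfl, fun b hb => hl₀ b (h2 b hb), by rw [h4, hv]⟩
  rw [← hn]
  simp [← h3]

/-- Every root is conjugate to a multiple of a simple root. -/
theorem sRefl_mem_parabolic_support [R.IsCrystallographic] (i : ι) :
    sRefl R i ∈ parabolic R D.support := by
  have key : ∀ j ∈ posRoots D, sRefl R j ∈ parabolic R D.support := by
    intro j hj
    -- `m` has least height among the positive roots conjugate to `j` under simple reflections; it
    -- is proportional to a simple root.
    obtain ⟨m, ⟨hm1, w, hw, hm2⟩, hmin⟩ := (Set.toFinite {m | m ∈ posRoots D ∧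
      ∃ w ∈ parabolic R D.support, m = R.weylGroupToPerm w j}).exists_minimalFor
      (fun m => D.height (R.root m)) _ ⟨j, hj, 1, one_mem _, by simp⟩
    have hsj : sRefl R j = w⁻¹ * sRefl R m * w := by
      rw [hm2, sRefl_perm]; group
    suffices h : ∃ a ∈ D.support, sRefl R m = sRefl R a by
      obtain ⟨a, ha, h⟩ := h
      rw [hsj, h]
      exact mul_mem (mul_mem (inv_mem hw) (Subgroup.subset_closure ⟨a, ha, rfl⟩)) hw
    -- A positive root with nonpositive product against all simple roots would have nonpositive
    -- norm.
    obtain ⟨a, ha, hpos⟩ : ∃ a ∈ D.support, 0 < R.RootForm (R.root m) (R.root a) := by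
      by_contra! hcon
      have h1 : ∀ x ∈ AddSubmonoid.closure (R.root '' D.support),
          R.RootForm (R.root m) x ≤ 0 := by
        intro x hx
        induction hx using AddSubmonoid.closure_induction with
        | mem y hy => obtain ⟨b, hb, rfl⟩ := hy; exact hcon b hb
        | zero => simp
        | add y z _ _ h1 h2 => rw [map_add]; linarith
      have h2 := R.rootForm_pos_of_ne_zero (x := R.root m) (by simp) (R.ne_zero m)
      linarith [h1 _ hm1]
    refine ⟨a, ha, ?_⟩
    -- If `s_a m` were positive it would be a root of smaller height in the same set. So `s_a m` is
    -- negative, which forces `m` to be a multiple of `a`.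
    by_cases hp : R.weylGroupToPerm (sRefl R a) m ∈ posRoots D
    · exfalso
      have h3 := hmin (j := R.weylGroupToPerm (sRefl R a) m) ⟨hp, sRefl R a * w,
        mul_mem (Subgroup.subset_closure ⟨a, ha, rfl⟩) hw, by rw [hm2, perm_mul]⟩
      have hpair : 0 < R.coroot' a (R.root m) := by
        have h4 := R.toInvariantForm.two_mul_apply_root_root m a
        simp only [RootPairing.toInvariantForm_form] at h4
        have h5 := R.rootForm_pos_of_ne_zero (x := R.root a) (by simp) (R.ne_zero a)
        rw [RootPairing.root_coroot'_eq_pairing]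
        by_contra! h6
        nlinarith
      simp only at h3
      rw [root_perm, sRefl_smul, map_sub, map_smul, height_root_simple D ⟨a, ha⟩] at h3
      simp only [smul_eq_mul, mul_one] at h3
      have := h3 (by linarith)
      linarith
    · obtain ⟨c, -, hc⟩ := root_eq_smul_of_simple_neg D ha hm1 hp
      exact sRefl_eq_of_root_eq_smul hc
  by_cases hi : i ∈ posRoots D
  · exact key i hi
  · have h := sRefl_eq_of_root_eq_smul (R := R) (i := i)
      (j := R.weylGroupToPerm (sRefl R i) i) (t := -1) (by rw [root_sRefl_self]; simp)
    rw [← h]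
    exact key _ ((neg_pos_iff D (root_sRefl_self i)).2 hi)

theorem parabolic_support_eq_top [R.IsCrystallographic] : parabolic R D.support = ⊤ := by
  rw [eq_top_iff]
  rintro ⟨g, hg⟩ -
  induction hg using RootPairing.weylGroup.induction with
  | mem i => exact sRefl_mem_parabolic_support D i
  | one => exact one_mem _
  | mul x y hx hy ihx ihy => exact mul_mem ihx ihy

theorem weylLength_le {l : List ι} (hl : ∀ a ∈ l, a ∈ D.support) :
    weylLength D (wordProd R l) ≤ l.length :=
  Nat.sInf_le ⟨l, hl, rfl, rfl⟩

theorem exists_reduced_word [R.IsCrystallographic] (w : R.weylGroup) :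
    ∃ l : List ι, (∀ a ∈ l, a ∈ D.support) ∧ l.length = weylLength D w ∧ wordProd R l = w := by
  have hne : {n | ∃ l : List ι, (∀ i ∈ l, i ∈ D.support) ∧ l.length = n ∧
      (l.map (sRefl R)).prod = w}.Nonempty := by
    obtain ⟨l, hl, hp⟩ := exists_word (R := R) (I := D.support) (w := w)
      (by rw [parabolic_support_eq_top]; trivial)
    exact ⟨_, l, hl, rfl, hp⟩
  exact Nat.sInf_mem hne

theorem weylLength_mul_sRefl_lt [R.IsCrystallographic] {w : R.weylGroup} {i : ι}
    (hi : i ∈ posRoots D) (h : R.weylGroupToPerm w i ∉ posRoots D) :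
    weylLength D (w * sRefl R i) < weylLength D w := by
  obtain ⟨l, hl, hn, rfl⟩ := exists_reduced_word D w
  obtain ⟨l', h1, h2, h3⟩ := exchange D hl hi h
  rw [← h3, ← hn]
  have := weylLength_le D (l := l') fun a ha => hl a (h1 a ha)
  omega

theorem bruhat_mul_sRefl [R.IsCrystallographic] {w : R.weylGroup} {i : ι}
    (hi : i ∈ posRoots D) (h : R.weylGroupToPerm w i ∉ posRoots D) :
    BruhatLE D (w * sRefl R i) w := by
  refine Relation.ReflTransGen.single ⟨i, ?_, weylLength_mul_sRefl_lt D hi h⟩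
  rw [mul_assoc, sRefl_mul_self, mul_one]

theorem BruhatLE.length_le {u w : R.weylGroup} (h : BruhatLE D u w) :
    u = w ∨ weylLength D u < weylLength D w := by
  induction h with
  | refl => left; rfl
  | tail _ h ih =>
    obtain ⟨i, -, hi⟩ := h
    right
    rcases ih with rfl | ih
    · exact hi
    · exact ih.trans hi

theorem BruhatLE.antisymm {u w : R.weylGroup} (h : BruhatLE D u w) (h' : BruhatLE D w u) :
    u = w := by
  rcases BruhatLE.length_le D h with h1 | h1
  · exact h1
  · rcases BruhatLE.length_le D h' with h2 | h2
    · exact h2.symm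
    · omega

/-! ### Coset representatives -/

theorem sRefl_mem_parabolic {I : Set ι} {a : ι} (ha : a ∈ I) : sRefl R a ∈ parabolic R I :=
  Subgroup.subset_closure ⟨a, ha, rfl⟩

theorem simple_mem_posRootsI {I : Set ι} (hI : I ⊆ D.support) {a : ι} (ha : a ∈ I) :
    a ∈ posRootsI D I := ⟨sRefl_mem_parabolic ha, pos_of_simple D (hI ha)⟩

theorem posRootsI_support [R.IsCrystallographic] : posRootsI D D.support = posRoots D := by
  ext i
  exact ⟨fun h => h.2, fun h => ⟨sRefl_mem_parabolic_support D i, h⟩⟩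

/-- The root `w s_a a = -wa` is positive and its reflection is a `W_I`-conjugate of `s_a`. The pair
`a`, `-wa` drives the uniqueness proofs below: a positivity condition tested on both gives opposite
inequalities. -/
theorem exists_neg_posRootsI {I : Set ι} (hI : I ⊆ D.support) {w : R.weylGroup}
    (hw : w ∈ parabolic R I) (h1 : w ≠ 1) :
    ∃ a ∈ I, R.weylGroupToPerm w a ∉ posRoots D ∧
      R.weylGroupToPerm (w * sRefl R a) a ∈ posRootsI D I := by
  obtain ⟨a, ha, h⟩ := exists_simple_neg D hI hw h1
  refine ⟨a, ha, h, ?_, (perm_sRefl_self_pos_iff D w).2 h⟩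
  rw [sRefl_perm]
  have hs := sRefl_mem_parabolic (R := R) ha
  exact mul_mem (mul_mem (mul_mem hw hs) hs) (inv_mem (mul_mem hw hs))

/-- As long as `w` makes some root of `R_I⁺` negative, multiplying by its reflection on the right
stays in `wW_I` and lowers the length. -/
theorem exists_minRep [R.IsCrystallographic] (I : Set ι) (w : R.weylGroup) :
    ∃ v ∈ minReps D I, ∃ x ∈ parabolic R I, w = v * x := by
  induction hn : weylLength D w using Nat.strong_induction_on generalizing w with
  | _ n ih =>
    by_cases h : w ∈ minReps D I
    · exact ⟨w, h, 1, one_mem _, by simp⟩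
    · simp only [minReps, Set.mem_ofPred_eq, not_forall] at h
      obtain ⟨i, hi, hw⟩ := h
      obtain ⟨v, hv, x, hx, hwx⟩ := ih _ (hn ▸ weylLength_mul_sRefl_lt D hi.2 hw) _ rfl
      refine ⟨v, hv, x * sRefl R i, mul_mem hx hi.1, ?_⟩
      rw [← mul_assoc, ← hwx, mul_assoc, sRefl_mul_self, mul_one]

/-- If `x ≠ 1`, choose `a ∈ I` with `-xa` in `R_I⁺`. Then `v(-xa)` is positive because `v ∈ W^I`,
and `vxa` is positive because `vx ∈ W^I`. -/
theorem minRep_unique {I : Set ι} (hI : I ⊆ D.support) {v x : R.weylGroup}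
    (hx : x ∈ parabolic R I) (hv : v ∈ minReps D I) (hvx : v * x ∈ minReps D I) : x = 1 := by
  by_contra h1
  obtain ⟨a, ha, -, h⟩ := exists_neg_posRootsI D hI hx h1
  have h2 := hv _ h
  rw [← perm_mul, ← mul_assoc, perm_sRefl_self_pos_iff] at h2
  exact h2 (hvx a (simple_mem_posRootsI D hI ha))

theorem minReps_bijOn [R.IsCrystallographic] {I : Set ι} (hI : I ⊆ D.support) :
    Set.BijOn (fun v => (QuotientGroup.mk v : R.weylGroup ⧸ parabolic R I)) (minReps D I)
      Set.univ := by
  refine ⟨fun _ _ => trivial, ?_, ?_⟩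
  · intro v hv u hu h
    have hx := QuotientGroup.eq.1 h
    have := minRep_unique D hI hx hv (by simpa using hu)
    exact (inv_mul_eq_one.1 this)
  · intro q _
    induction q using QuotientGroup.induction_on with
    | H w =>
      obtain ⟨v, hv, x, hx, rfl⟩ := exists_minRep D I w
      exact ⟨v, hv, QuotientGroup.eq.2 (by simpa using hx)⟩

end RootCombinatorics

/-! ### Weights, dominance and Heckman's order -/

section Weights

variable {ι M N : Type*} [AddCommGroup M] [Module ℝ M] [AddCommGroup N] [Module ℝ N]
  {R : RootPairing ι ℝ M N} [R.IsRootSystem] [R.IsCrystallographic]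

theorem coe_sRefl_smul_weight (i : ι) (lam : weightLattice R) :
    ((sRefl R i • lam : weightLattice R) : M) = lam - R.coroot' i (lam : M) • R.root i := by
  rw [coe_smul_weight, sRefl_smul]

theorem sRefl_smul_eq_self {i : ι} {lam : weightLattice R} (h : R.coroot' i (lam : M) = 0) :
    sRefl R i • lam = lam := by
  apply Subtype.ext
  rw [coe_sRefl_smul_weight, h, zero_smul, sub_zero]

theorem coroot_sRefl_smul_weight (i : ι) (lam : weightLattice R) :
    R.coroot' i ((sRefl R i • lam : weightLattice R) : M) = -R.coroot' i (lam : M) := by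
  rw [coe_sRefl_smul_weight, map_sub, map_smul, RootPairing.root_coroot'_eq_pairing,
    RootPairing.pairing_same, smul_eq_mul]
  ring

theorem coroot_perm_weight (w : R.weylGroup) (i : ι) (lam : weightLattice R) :
    R.coroot' (R.weylGroupToPerm w i) ((w • lam : weightLattice R) : M) =
      R.coroot' i (lam : M) := by
  rw [coe_smul_weight, coroot_perm]

theorem coroot_of_root_eq_neg {i j : ι} (h : R.root j = -R.root i) :
    R.coroot j = -R.coroot i :=
  R.coroot_eq_neg_iff.2 (R.root_eq_neg_iff.1 h)

/-- The integer `⟨lam, α^∨⟩`. -/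
def pairZ (i : ι) (lam : weightLattice R) : ℤ := Classical.choose (lam.2 i)

theorem coroot_eq_pairZ (i : ι) (lam : weightLattice R) :
    R.coroot' i (lam : M) = pairZ i lam := Classical.choose_spec (lam.2 i)

variable (D : SimpleSystem R)

/-- The cone `Q⁺` of nonnegative integral combinations of simple roots. -/
abbrev qPlus : AddSubmonoid M := AddSubmonoid.closure (R.root '' D.support)

theorem zsmul_mem_qPlus {x : M} (hx : x ∈ qPlus D) {n : ℤ} (hn : 0 ≤ n) :
    (n : ℝ) • x ∈ qPlus D := by
  lift n to ℕ using hn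
  rw [Int.cast_natCast, Nat.cast_smul_eq_nsmul]
  exact nsmul_mem hx n

theorem RootLE.refl (lam : weightLattice R) : RootLE D lam lam := by
  simp [RootLE, zero_mem]

variable {D} in
theorem RootLE.trans {lam mu nu : weightLattice R} (h1 : RootLE D lam mu) (h2 : RootLE D mu nu) :
    RootLE D lam nu := by
  have := add_mem h1 h2
  unfold RootLE
  convert! this using 1
  abel

theorem RootLE.height_lt {lam mu : weightLattice R} (h : RootLE D lam mu) (hne : lam ≠ mu) :
    D.height (lam : M) < D.height (mu : M) := by
  have := height_pos_of_mem D h (by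
    rw [sub_ne_zero]; exact fun h => hne (Subtype.ext h.symm))
  rw [map_sub] at this
  linarith

variable {D} in
theorem RootLE.antisymm {lam mu : weightLattice R} (h1 : RootLE D lam mu)
    (h2 : RootLE D mu lam) : lam = mu := by
  by_contra hne
  have := RootLE.height_lt D h1 hne
  have := RootLE.height_lt D h2 (Ne.symm hne)
  linarith

theorem rootLE_sRefl {i : ι} (hi : i ∈ posRoots D) {lam : weightLattice R}
    (h : R.coroot' i (lam : M) < 0) : RootLE D lam (sRefl R i • lam) := by
  unfold RootLE
  rw [coe_sRefl_smul_weight, coroot_eq_pairZ]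
  rw [coroot_eq_pairZ] at h
  have := zsmul_mem_qPlus D hi (n := -pairZ i lam) (by have : pairZ i lam < 0 := by exact_mod_cast h
                                                       omega)
  convert! this using 1
  push_cast
  module

variable [Fintype ι]

/-- Reflecting a weight repeatedly leads to an `I`-dominant weight. -/
theorem exists_smul_mem_domWeights (I : Set ι) (lam : weightLattice R) (p : R.weylGroup → Prop)
    (h1 : p 1) (hstep : ∀ w i, p w → i ∈ posRootsI D I →
      R.coroot' i ((w • lam : weightLattice R) : M) < 0 → p (sRefl R i * w)) :
    ∃ w ∈ parabolic R I, p w ∧ w • lam ∈ domWeights D I := by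
  -- A point of maximal height in the finite orbit is dominant, since otherwise a reflection raises
  -- it. The property `p` is carried along to record how the end point compares with `lam`, in
  -- whichever order is needed.
  obtain ⟨w, ⟨hw, hpw⟩, hmax⟩ := (Set.toFinite {w | w ∈ parabolic R I ∧ p w}).exists_maximalFor
    (fun w => D.height ((w • lam : weightLattice R) : M)) _ ⟨1, one_mem _, h1⟩
  refine ⟨w, hw, hpw, ?_⟩
  intro i hi
  by_contra! hneg
  have h2 := rootLE_sRefl D hi.2 hneg
  have h3 := RootLE.height_lt D h2 (fun h => by
    have h4 := coroot_sRefl_smul_weight i (w • lam)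
    rw [← h] at h4
    linarith)
  have h4 := hmax (j := sRefl R i * w) ⟨mul_mem hi.1 hw, hstep w i hpw hi hneg⟩
  simp only [mul_smul] at h4
  linarith [h4 h3.le]

variable {D}

/-- An `I`-dominant weight is the only one in its `W_I`-orbit. Testing `lam` on `a` and `w • lam` on
`-wa` shows that `⟨lam, a^∨⟩` is both nonnegative and nonpositive. So `s_a` fixes `lam`, and `w` can
be replaced by the shorter `w s_a`. -/
theorem smul_eq_of_mem_domWeights {I : Set ι} (hI : I ⊆ D.support) {lam : weightLattice R}
    (hlam : lam ∈ domWeights D I) {w : R.weylGroup} (hw : w ∈ parabolic R I)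
    (hwl : w • lam ∈ domWeights D I) : w • lam = lam := by
  induction hn : weylLength D w using Nat.strong_induction_on generalizing w with
  | _ n ih =>
    by_cases h1 : w = 1
    · rw [h1, one_smul]
    · obtain ⟨a, ha, hneg, hpos⟩ := exists_neg_posRootsI D hI hw h1
      have h2 := hlam a (simple_mem_posRootsI D hI ha)
      have hww : w • lam = (w * sRefl R a) • (sRefl R a • lam) := by
        rw [smul_smul, mul_assoc, sRefl_mul_self, mul_one]
      have h3 := hwl _ hpos
      rw [hww, coroot_perm_weight, coroot_sRefl_smul_weight] at h3
      have h4 : sRefl R a • lam = lam := sRefl_smul_eq_self (by linarith)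
      rw [h4] at hww
      rw [hww] at hwl ⊢
      exact ih _ (hn ▸ weylLength_mul_sRefl_lt D (pos_of_simple D (hI ha)) hneg)
        (mul_mem hw (sRefl_mem_parabolic ha)) hwl rfl

variable (D) in
theorem dominant_eq : dominant D = domWeights D D.support := by
  rw [dominant, domWeights, posRootsI_support]

variable (D) in
theorem mem_parabolic_support (w : R.weylGroup) : w ∈ parabolic R D.support := by
  rw [parabolic_support_eq_top]; trivial

theorem smul_eq_of_mem_dominant {lam : weightLattice R} (hlam : lam ∈ dominant D)
    {w : R.weylGroup} (hwl : w • lam ∈ dominant D) : w • lam = lam := by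
  rw [dominant_eq] at hlam hwl
  exact smul_eq_of_mem_domWeights subset_rfl hlam (mem_parabolic_support D w) hwl

variable (D) in
theorem exists_dominant (lam : weightLattice R) :
    ∃ w : R.weylGroup, RootLE D lam (w • lam) ∧ w • lam ∈ dominant D := by
  obtain ⟨w, -, h⟩ := exists_smul_mem_domWeights D D.support lam (fun w => RootLE D lam (w • lam))
    (by rw [one_smul]; exact RootLE.refl D lam) (by
      intro w i hw hi hneg
      rw [mul_smul]
      exact hw.trans (rootLE_sRefl D hi.2 hneg))
  exact ⟨w, by rwa [dominant_eq]⟩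

/-- Climbing from `w • lam` by reflections ends at a dominant weight of the orbit, which can only be
`lam`. -/
theorem smul_rootLE {lam : weightLattice R} (hlam : lam ∈ dominant D) (w : R.weylGroup) :
    RootLE D (w • lam) lam := by
  obtain ⟨u, h1, h2⟩ := exists_dominant D (w • lam)
  rw [smul_smul] at h1 h2
  rwa [smul_eq_of_mem_dominant hlam h2] at h1

/-! #### Shortest elements -/

variable (D) in
/-- `v` sends the positive roots orthogonal to `mu` to positive roots. -/
def IsMinimalFor (mu : weightLattice R) (v : R.weylGroup) : Prop :=
  ∀ i ∈ posRoots D, R.coroot' i (mu : M) = 0 → R.weylGroupToPerm v i ∈ posRoots D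

variable (D) in
-- Right multiplication by a reflection fixing `mu` keeps `u • mu`, and each such step that removes
-- a violation descends in the Bruhat order.
theorem exists_isMinimalFor (mu : weightLattice R) (u : R.weylGroup) :
    ∃ v, IsMinimalFor D mu v ∧ v • mu = u • mu ∧ BruhatLE D v u := by
  induction hn : weylLength D u using Nat.strong_induction_on generalizing u with
  | _ n ih =>
    by_cases h : IsMinimalFor D mu u
    · exact ⟨u, h, rfl, Relation.ReflTransGen.refl⟩
    · simp only [IsMinimalFor, not_forall] at h
      obtain ⟨i, hi, h0, hneg⟩ := h
      obtain ⟨v, h1, h2, h3⟩ := ih _ (hn ▸ weylLength_mul_sRefl_lt D hi hneg) _ rfl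
      refine ⟨v, h1, ?_, h3.trans (bruhat_mul_sRefl D hi hneg)⟩
      rw [h2, mul_smul, sRefl_smul_eq_self h0]

/-- Here `x = v⁻¹u` fixes `mu`. If `x ≠ 1`, there is a simple `a` with `-xa` positive, and dominance
makes both `a` and `-xa` orthogonal to `mu`. Then `v(-xa) = -ua` and `ua` would both be positive. -/
theorem IsMinimalFor.unique {mu : weightLattice R} (hmu : mu ∈ dominant D) {v u : R.weylGroup}
    (hv : IsMinimalFor D mu v) (hu : IsMinimalFor D mu u) (h : v • mu = u • mu) : v = u := by
  by_contra hne
  have hx : v⁻¹ * u ≠ 1 := fun h1 => hne (inv_mul_eq_one.1 h1)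
  obtain ⟨a, ha, hneg, hpos⟩ := exists_neg_posRootsI D subset_rfl
    (mem_parabolic_support D (v⁻¹ * u)) hx
  set x := v⁻¹ * u
  have hxm : x • mu = mu := by rw [mul_smul, ← h, inv_smul_smul]
  have h1 := hmu a (pos_of_simple D ha)
  have h2 := hmu _ hpos.2
  have hmm : mu = (x * sRefl R a) • (sRefl R a • mu) := by
    rw [smul_smul, mul_assoc, sRefl_mul_self, mul_one, hxm]
  have h3 : R.coroot' (R.weylGroupToPerm (x * sRefl R a) a) (mu : M) = - R.coroot' a (mu : M) := by
    nth_rw 1 [hmm]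
    rw [coroot_perm_weight, coroot_sRefl_smul_weight]
  rw [h3] at h2
  have h4 : R.coroot' a (mu : M) = 0 := by linarith
  have h5 := hv _ hpos.2 (by rw [h3, h4, neg_zero])
  rw [← perm_mul, ← mul_assoc, mul_inv_cancel_left, perm_sRefl_self_pos_iff] at h5
  exact h5 (hu a (pos_of_simple D ha) h4)

/-- Replaces a minimum of lengths by a condition on roots. It also makes the shortest element
Bruhat-least: every `w` with `w • mu = lam` descends to a minimal element, which is unique. -/
theorem isShortest_iff {mu lam : weightLattice R} (hmu : mu ∈ dominant D) {v : R.weylGroup} :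
    IsShortest D mu lam v ↔ v • mu = lam ∧ IsMinimalFor D mu v := by
  constructor
  · rintro ⟨h1, h2⟩
    refine ⟨h1, ?_⟩
    intro i hi h0
    by_contra hneg
    have h3 := weylLength_mul_sRefl_lt D hi hneg
    have h4 := h2 (v * sRefl R i) (by rw [mul_smul, sRefl_smul_eq_self h0, h1])
    omega
  · rintro ⟨h1, h2⟩
    refine ⟨h1, fun w hw => ?_⟩
    obtain ⟨u, hu1, hu2, hu3⟩ := exists_isMinimalFor D mu w
    have : v = u := h2.unique hmu hu1 (by rw [h1, hu2, hw])
    subst this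
    rcases BruhatLE.length_le D hu3 with h | h
    · rw [h]
    · exact h.le

theorem IsShortest.unique {mu mu' lam : weightLattice R} (hmu : mu ∈ dominant D)
    (hmu' : mu' ∈ dominant D) {v v' : R.weylGroup} (h : IsShortest D mu lam v)
    (h' : IsShortest D mu' lam v') : mu = mu' ∧ v = v' := by
  have h1 : mu = mu' := by
    have h2 : (v'⁻¹ * v) • mu = mu' := by
      rw [mul_smul, h.1, ← h'.1, inv_smul_smul]
    rw [← h2]
    exact (smul_eq_of_mem_dominant hmu (h2 ▸ hmu')).symm
  subst h1
  rw [isShortest_iff hmu] at h h'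
  exact ⟨rfl, h.2.unique hmu h'.2 (h.1.trans h'.1.symm)⟩

variable (D) in
theorem exists_isShortest (lam : weightLattice R) :
    ∃ mu ∈ dominant D, ∃ v, IsShortest D mu lam v := by
  obtain ⟨w, -, hw⟩ := exists_dominant D lam
  obtain ⟨v, h1, h2, -⟩ := exists_isMinimalFor D (w • lam) w⁻¹
  exact ⟨w • lam, hw, v, (isShortest_iff hw).2 ⟨by rw [h2, inv_smul_smul], h1⟩⟩

/-! #### Heckman's order -/

variable (D) in
theorem WeightLE.refl (lam : weightLattice R) : WeightLE D lam lam := by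
  obtain ⟨mu, hmu, v, hv⟩ := exists_isShortest D lam
  exact ⟨mu, hmu, mu, hmu, v, v, hv, hv, RootLE.refl D mu, fun _ => Relation.ReflTransGen.refl⟩

theorem WeightLE.trans {lam mu nu : weightLattice R} (h1 : WeightLE D lam mu)
    (h2 : WeightLE D mu nu) : WeightLE D lam nu := by
  obtain ⟨l, hl, m, hm, v, u, hv, hu, h3, h4⟩ := h1
  obtain ⟨m', hm', n, hn, u', x, hu', hx, h5, h6⟩ := h2
  obtain ⟨rfl, rfl⟩ := hu.unique hm hm' hu'
  refine ⟨l, hl, n, hn, v, x, hv, hx, h3.trans h5, ?_⟩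
  rintro rfl
  obtain rfl := h3.antisymm h5
  exact (h4 rfl).trans (h6 rfl)

theorem WeightLE.antisymm {lam mu : weightLattice R} (h1 : WeightLE D lam mu)
    (h2 : WeightLE D mu lam) : lam = mu := by
  obtain ⟨l, hl, m, hm, v, u, hv, hu, h3, h4⟩ := h1
  obtain ⟨m', hm', l', hl', u', v', hu', hv', h5, h6⟩ := h2
  obtain ⟨rfl, rfl⟩ := hu.unique hm hm' hu'
  obtain ⟨rfl, rfl⟩ := hv.unique hl hl' hv'
  obtain rfl := h3.antisymm h5
  obtain rfl := BruhatLE.antisymm D (h4 rfl) (h6 rfl)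
  rw [← hv.1, ← hu.1]

variable (D) in
/-- The strict order attached to `WeightLE`. -/
def WeightLT (mu lam : weightLattice R) : Prop := WeightLE D mu lam ∧ mu ≠ lam

theorem WeightLE.trans_lt {lam mu nu : weightLattice R} (h1 : WeightLE D lam mu)
    (h2 : WeightLT D mu nu) : WeightLT D lam nu := by
  refine ⟨h1.trans h2.1, ?_⟩
  rintro rfl
  exact h2.2 (h2.1.antisymm h1)

theorem WeightLT.trans {lam mu nu : weightLattice R} (h1 : WeightLT D lam mu)
    (h2 : WeightLT D mu nu) : WeightLT D lam nu := h1.1.trans_lt h2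

/-- Both weights lie in one orbit, so the Bruhat order decides. With `v` shortest for `lam` and `j`
the root `-v⁻¹α_i`, one has `s_i v = v s_j`. Dominance of `mu` makes `j` positive, while `v` sends
it to `-α_i`; hence `v s_j` is below `v`. -/
theorem sRefl_weightLT {i : ι} (hi : i ∈ posRoots D) {lam : weightLattice R}
    (h : R.coroot' i (lam : M) < 0) : WeightLT D (sRefl R i • lam) lam := by
  obtain ⟨mu, hmu, v, hv⟩ := exists_isShortest D lam
  have hne : sRefl R i • lam ≠ lam := by
    intro h1
    have h2 := coroot_sRefl_smul_weight i lam
    rw [h1] at h2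
    linarith
  refine ⟨?_, hne⟩
  obtain ⟨v', h1, h2, h3⟩ := exists_isMinimalFor D mu (sRefl R i * v)
  have hv' : IsShortest D mu (sRefl R i • lam) v' :=
    (isShortest_iff hmu).2 ⟨by rw [h2, mul_smul, hv.1], h1⟩
  refine ⟨mu, hmu, mu, hmu, v', v, hv', hv, RootLE.refl D mu, fun _ => h3.trans ?_⟩
  set j := R.weylGroupToPerm (v⁻¹ * sRefl R i) i with hj
  have hji : R.weylGroupToPerm v j = R.weylGroupToPerm (sRefl R i) i := by
    rw [hj, ← perm_mul, mul_inv_cancel_left]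
  have hvj : R.weylGroupToPerm v j ∉ posRoots D := by
    rw [hji]
    exact fun h => (neg_pos_iff D (root_sRefl_self i)).1 h hi
  have hjp : j ∈ posRoots D := by
    rw [hj, perm_sRefl_self_pos_iff]
    intro hp
    have h4 := hmu _ hp
    rw [← coroot_perm_weight v, hv.1, ← perm_mul, mul_inv_cancel, map_one] at h4
    exact absurd h4 (not_le.2 h)
  have := bruhat_mul_sRefl D hjp hvj
  convert! this using 1
  rw [hj, sRefl_perm]
  group

/-- It is enough to compare the dominant representative of `mu` with any point of the orbit of
`lam`, as all of these lie below `lam₊`. -/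
theorem weightLT_of_rootLE {lam mu : weightLattice R} {u x : R.weylGroup}
    (hu : u • mu ∈ dominant D) (h : RootLE D (u • mu) (x • lam)) (hne : u • mu ≠ x • lam) :
    WeightLT D mu lam := by
  obtain ⟨l, hl, v, hv⟩ := exists_isShortest D lam
  obtain ⟨m, hm, y, hy⟩ := exists_isShortest D mu
  have hum : u • mu = m := by
    rw [← hy.1, smul_smul] at hu ⊢
    exact smul_eq_of_mem_dominant hm hu
  have hxl : RootLE D (x • lam) l := by
    rw [← hv.1, smul_smul]
    exact smul_rootLE hl _
  rw [hum] at h hne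
  have hml : m ≠ l := by
    rintro rfl
    exact hne (h.antisymm hxl)
  refine ⟨⟨m, hm, l, hl, y, v, hy, hv, h.trans hxl, fun h => absurd h hml⟩, ?_⟩
  rintro rfl
  exact hml (hy.unique hm hl hv).1

/-- Interior points of the `α`-string from `lam` to `s_α lam` are lower already in the dominance
order. Let `u` make `mu` dominant. Then `u • mu` differs from `u • lam` and from `u s_α • lam` by
multiples of `uα` of opposite signs, so it lies below one of them whatever the sign of `uα`. -/
theorem string_weightLT {i : ι} {lam mu : weightLattice R} {c : ℤ}
    (hc : 0 < c ∧ c < pairZ i lam ∨ pairZ i lam < c ∧ c < 0)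
    (hmu : (mu : M) = lam - (c : ℝ) • R.root i) : WeightLT D mu lam := by
  obtain ⟨u, -, hu⟩ := exists_dominant D mu
  set n := pairZ i lam with hn
  set j := R.weylGroupToPerm u i with hj
  have hj0 : R.root j ≠ 0 := R.ne_zero j
  have e1 : ((u • mu : weightLattice R) : M) = (u • lam : weightLattice R) - (c : ℝ) • R.root j := by
    rw [coe_smul_weight, coe_smul_weight, hmu, smul_sub, weyl_smul_smul, hj, root_perm]
  have e2 : ((u • mu : weightLattice R) : M) = ((u * sRefl R i) • lam : weightLattice R) +
      ((n - c : ℤ) : ℝ) • R.root j := by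
    rw [mul_smul, e1, coe_smul_weight R u (sRefl R i • lam), coe_sRefl_smul_weight, coroot_eq_pairZ,
      ← hn, smul_sub, weyl_smul_smul, hj, root_perm, coe_smul_weight]
    generalize u • (lam : M) = y
    generalize u • R.root i = z
    push_cast
    module
  have key1 : ∀ y ∈ qPlus D, ∀ d : ℤ, 0 < d → y ≠ 0 →
      (c : ℝ) • R.root j = (d : ℝ) • y → WeightLT D mu lam := by
    intro y hy d hd hy0 he
    refine weightLT_of_rootLE hu (x := u) ?_ ?_
    · unfold RootLE
      rw [e1, sub_sub_cancel, he]
      exact zsmul_mem_qPlus D hy hd.le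
    · intro h
      rw [← h, he, eq_comm, sub_eq_self] at e1
      have : (d : ℝ) ≠ 0 := by exact_mod_cast hd.ne'
      exact hy0 ((smul_eq_zero.1 e1).resolve_left this)
  have key2 : ∀ y ∈ qPlus D, ∀ d : ℤ, 0 < d → y ≠ 0 →
      ((n - c : ℤ) : ℝ) • R.root j = -((d : ℝ) • y) → WeightLT D mu lam := by
    intro y hy d hd hy0 he
    refine weightLT_of_rootLE hu (x := u * sRefl R i) ?_ ?_
    · unfold RootLE
      rw [e2, he, ← sub_eq_add_neg, sub_sub_cancel]
      exact zsmul_mem_qPlus D hy hd.le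
    · intro h
      rw [← h, he, eq_comm, add_eq_left, neg_eq_zero] at e2
      have : (d : ℝ) ≠ 0 := by exact_mod_cast hd.ne'
      exact hy0 ((smul_eq_zero.1 e2).resolve_left this)
  by_cases hp : j ∈ posRoots D
  · rcases hc with ⟨h1, h2⟩ | ⟨h1, h2⟩
    · exact key1 _ hp c h1 hj0 rfl
    · exact key2 _ hp (c - n) (by omega) hj0 (by push_cast; module)
  · have hp' := neg_root_mem_of_not_pos D hp
    rcases hc with ⟨h1, h2⟩ | ⟨h1, h2⟩
    · exact key2 _ hp' (n - c) (by omega) (neg_ne_zero.2 hj0) (by push_cast; module)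
    · exact key1 _ hp' (-c) (by omega) (neg_ne_zero.2 hj0) (by push_cast; module)

/-! #### Finiteness of lower sets -/

theorem two_mul_rootForm_root (x : M) (i : ι) :
    2 * R.RootForm x (R.root i) = R.coroot' i x * R.RootForm (R.root i) (R.root i) := by
  have h := R.rootForm_reflection_reflection_apply i x (R.root i)
  rw [RootPairing.reflection_apply_self, RootPairing.reflection_apply, map_neg, map_sub, map_smul,
    LinearMap.sub_apply, LinearMap.smul_apply, smul_eq_mul] at h
  linarith

theorem rootForm_root_pos (i : ι) : 0 < R.RootForm (R.root i) (R.root i) :=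
  R.rootForm_pos_of_ne_zero (by simp) (R.ne_zero i)

theorem rootForm_smul_smul (w : R.weylGroup) (x y : M) :
    R.RootForm (w • x) (w • y) = R.RootForm x y :=
  RootPairing.InvariantForm.apply_weylGroup_smul R (B := R.toInvariantForm) w x y

theorem rootForm_nonneg_of_dominant {lam : weightLattice R} (h : lam ∈ dominant D) {x : M}
    (hx : x ∈ qPlus D) : 0 ≤ R.RootForm (lam : M) x := by
  induction hx using AddSubmonoid.closure_induction with
  | mem y hy =>
    obtain ⟨i, hi, rfl⟩ := hy
    have h1 := two_mul_rootForm_root (R := R) (lam : M) i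
    have h2 := rootForm_root_pos (R := R) i
    have h3 := h i (pos_of_simple D hi)
    nlinarith
  | zero => simp
  | add y z _ _ h1 h2 => rw [map_add]; positivity

/-- For dominant `l`, `m` with `l - m ∈ Q⁺` one has `|l|² - |m|² = (l + m, l - m) ≥ 0`. -/
theorem rootForm_le_of_weightLE {lam mu : weightLattice R} (h : WeightLE D mu lam) :
    R.RootForm (mu : M) mu ≤ R.RootForm (lam : M) lam := by
  obtain ⟨m, hm, l, hl, v, u, hv, hu, h1, -⟩ := h
  rw [← hv.1, ← hu.1, coe_smul_weight, coe_smul_weight, rootForm_smul_smul, rootForm_smul_smul]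
  have h2 := rootForm_nonneg_of_dominant hm h1
  have h3 := rootForm_nonneg_of_dominant hl h1
  rw [map_sub] at h2 h3
  have h4 : R.RootForm (m : M) l = R.RootForm (l : M) m := R.rootForm_symmetric.eq _ _
  linarith

theorem eq_of_pairZ_eq {lam mu : weightLattice R} (h : ∀ i, pairZ i lam = pairZ i mu) :
    lam = mu := by
  apply Subtype.ext
  rw [← sub_eq_zero]
  apply R.eq_zero_of_mem_rootSpan_of_rootForm_self_eq_zero (by simp)
  rw [RootPairing.rootForm_apply_apply]
  refine Finset.sum_eq_zero fun i _ => ?_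
  rw [map_sub, coroot_eq_pairZ, coroot_eq_pairZ, h, sub_self, zero_mul]

variable (D) in
-- The root form is `∑ ⟨x, α^∨⟩²`, so a norm bound leaves finitely many values for the integers
-- `⟨mu, α^∨⟩`, and these determine `mu`.
theorem finite_weightLE (lam : weightLattice R) : {mu | WeightLE D mu lam}.Finite := by
  obtain ⟨B, hB⟩ := exists_nat_ge (R.RootForm (lam : M) lam)
  have hfin : (Set.univ.pi fun _ : ι => Set.Icc (-(B : ℤ)) B).Finite :=
    Set.Finite.pi fun _ => Set.finite_Icc _ _
  refine (hfin.preimage (f := fun mu : weightLattice R => fun i => pairZ i mu)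
    (fun a _ b _ h => eq_of_pairZ_eq fun i => congrFun h i)).subset ?_
  intro mu hmu i _
  have h1 := (rootForm_le_of_weightLE hmu).trans hB
  rw [RootPairing.rootForm_apply_apply] at h1
  have h2 : R.coroot' i (mu : M) * R.coroot' i (mu : M) ≤
      ∑ i, R.coroot' i (mu : M) * R.coroot' i (mu : M) :=
    Finset.single_le_sum (f := fun i => R.coroot' i (mu : M) * R.coroot' i (mu : M))
      (fun j _ => mul_self_nonneg _) (Finset.mem_univ i)
  have h3 := h2.trans h1
  rw [coroot_eq_pairZ] at h3
  have h4 : pairZ i mu * pairZ i mu ≤ B := by exact_mod_cast h3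
  simp only [Set.mem_Icc]
  constructor <;> nlinarith

variable (D) in
theorem finite_lowerWeights (I : Set ι) (lam : weightLattice R) : (lowerWeights D I lam).Finite :=
  (finite_weightLE D lam).subset fun _ h => h.2.1

variable (D) in
-- Lower sets are finite, so the number of strict predecessors is a rank function.
theorem wellFounded_weightLT : WellFounded (WeightLT D) := by
  have : IsStrictOrder (weightLattice R) (WeightLT D) :=
    { irrefl := fun _ h => h.2 rfl
      trans := fun _ _ _ h1 h2 => h1.trans h2 }
  let f : weightLattice R → ℕ := fun lam => {mu | WeightLT D mu lam}.ncard
  refine Subrelation.wf (r := InvImage (· < ·) f) ?_ (InvImage.wf f Nat.lt_wfRel.wf)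
  intro mu lam h
  refine Set.ncard_lt_ncard ?_ ((finite_weightLE D lam).subset fun _ h => h.1)
  refine ⟨fun nu hnu => WeightLT.trans hnu h, fun hsub => ?_⟩
  exact (hsub h).2 rfl

/-! #### `I`-dominant weights -/

variable (D) in
theorem exists_domWeights_le (I : Set ι) (lam : weightLattice R) :
    ∃ w ∈ parabolic R I, WeightLE D (w • lam) lam ∧ w • lam ∈ domWeights D I :=
  exists_smul_mem_domWeights D I lam (fun w => WeightLE D (w • lam) lam)
    (by rw [one_smul]; exact WeightLE.refl D lam) (by
      intro w i hw hi hneg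
      rw [mul_smul]
      exact (sRefl_weightLT hi.2 hneg).1.trans hw)

/-- The `I`-dominant weight is the least element of its `W_I`-orbit in Heckman's order, although it
is the highest for dominance: reflecting upwards shortens `v̄`. -/
theorem weightLE_smul {I : Set ι} (hI : I ⊆ D.support) {lam : weightLattice R}
    (hlam : lam ∈ domWeights D I) {w : R.weylGroup} (hw : w ∈ parabolic R I) :
    WeightLE D lam (w • lam) := by
  obtain ⟨u, hu, h1, h2⟩ := exists_domWeights_le D I (w • lam)
  rw [smul_smul] at h1 h2
  rwa [smul_eq_of_mem_domWeights hI hlam (mul_mem hu hw) h2] at h1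

variable (D) in
theorem posRootsI_empty : posRootsI D ∅ = ∅ := by
  rw [Set.eq_empty_iff_forall_notMem]
  rintro i ⟨hi, -⟩
  have h1 : sRefl R i = 1 := by simpa [parabolic] using hi
  have h2 := root_sRefl_self (R := R) i
  rw [root_perm, h1, one_smul, eq_neg_iff_add_eq_zero, ← two_smul ℝ] at h2
  exact R.ne_zero i ((smul_eq_zero.1 h2).resolve_left two_ne_zero)

variable (D) in
theorem mem_domWeights_empty (lam : weightLattice R) : lam ∈ domWeights D ∅ := by
  intro i hi
  rw [posRootsI_empty] at hi
  exact absurd hi (Set.notMem_empty i)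

end Weights

/-! ### Cherednik operators -/

section Operators

variable {ι M N : Type*} [AddCommGroup M] [Module ℝ M] [AddCommGroup N] [Module ℝ N]
  {R : RootPairing ι ℝ M N} [R.IsRootSystem] [R.IsCrystallographic]

/-! ### Exponentials and divided differences -/

/-- The element `e^lam` of `ℂ[P]`. -/
abbrev expo (lam : weightLattice R) : Laurent R := AddMonoidAlgebra.single lam 1

variable (R) in
/-- The basis `e^lam` of `ℂ[P]`. -/
def expBasis : Module.Basis (weightLattice R) ℂ (Laurent R) :=
  Module.Basis.ofRepr (AddMonoidAlgebra.coeffLinearEquiv ℂ)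

theorem expBasis_apply (lam : weightLattice R) : expBasis R lam = expo lam := rfl

theorem expo_mul (lam mu : weightLattice R) : expo lam * expo mu = expo (lam + mu) := by
  rw [expo, expo, AddMonoidAlgebra.single_mul_single, one_mul]

theorem expo_zero : expo (0 : weightLattice R) = 1 := rfl

theorem expo_injective : Function.Injective (expo (R := R)) := (expBasis R).injective

theorem weylAct_expo (w : R.weylGroup) (lam : weightLattice R) :
    weylAct R w (expo lam) = expo (w • lam) := by
  simp [weylAct, expo]

theorem laurent_hom_ext {V : Type*} [AddCommGroup V] [Module ℂ V] {f g : Laurent R →ₗ[ℂ] V}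
    (h : ∀ lam, f (expo lam) = g (expo lam)) : f = g :=
  (expBasis R).ext h

theorem weylAct_mul (w u : R.weylGroup) (phi : Laurent R) :
    weylAct R (w * u) phi = weylAct R w (weylAct R u phi) := by
  have : (weylAct R (w * u)).toLinearMap =
      (weylAct R w).toLinearMap ∘ₗ (weylAct R u).toLinearMap := by
    refine laurent_hom_ext fun lam => ?_
    simp only [AlgHom.toLinearMap_apply, LinearMap.comp_apply, weylAct_expo, mul_smul]
  exact LinearMap.congr_fun this phi

theorem weylAct_one (phi : Laurent R) : weylAct R 1 phi = phi := by
  have : (weylAct R 1).toLinearMap = LinearMap.id := by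
    refine laurent_hom_ext fun lam => ?_
    simp only [AlgHom.toLinearMap_apply, LinearMap.id_apply, weylAct_expo, one_smul]
  exact LinearMap.congr_fun this phi

/-- Makes `ℂ[P]` a ring without zero divisors, so identities between divided differences can be
checked after multiplication by `1 - e^{-α}`. -/
instance : TwoUniqueSums (weightLattice R) := by
  have : Module ℚ M := Module.compHom M (algebraMap ℚ ℝ)
  exact TwoUniqueSums.of_injective_addHom (weightLattice R).subtype.toAddHom
    Subtype.val_injective inferInstance

theorem weylAct_sRefl_self (i : ι) (phi : Laurent R) :
    weylAct R (sRefl R i) (weylAct R (sRefl R i) phi) = phi := by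
  rw [← weylAct_mul, sRefl_mul_self, weylAct_one]

theorem coe_rootWeight (i : ι) : (rootWeight R i : M) = R.root i := rfl

theorem smul_rootWeight (w : R.weylGroup) (i : ι) :
    w • rootWeight R i = rootWeight R (R.weylGroupToPerm w i) := by
  apply Subtype.ext
  rw [coe_smul_weight, coe_rootWeight, coe_rootWeight, root_perm]

theorem rootWeight_ne_zero (i : ι) : rootWeight R i ≠ 0 := by
  intro h
  exact R.ne_zero i (congrArg Subtype.val h)

theorem one_sub_expo_ne_zero (i : ι) : (1 : Laurent R) - expo (-rootWeight R i) ≠ 0 := by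
  rw [sub_ne_zero, ← expo_zero]
  intro h
  exact rootWeight_ne_zero i (neg_eq_zero.1 (expo_injective h).symm)

/-- The divided difference `(1 - s_α) / (1 - e^{-α})`. -/
def divDiff (i : ι) : Laurent R →ₗ[ℂ] Laurent R :=
  (expBasis R).constr ℂ fun lam =>
    -- Telescoping geometric sums with `n = ⟨lam, α^∨⟩`. For `n > 0` the string contains `lam` but
    -- not `s_α lam`; for `n < 0` it contains `s_α lam` but not `lam`. This asymmetry produces
    -- triangularity.
    if 0 ≤ pairZ i lam then ∑ j ∈ Finset.range (pairZ i lam).toNat, expo (lam - j • rootWeight R i)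
    else -∑ j ∈ Finset.range (-pairZ i lam).toNat, expo (lam + (j + 1) • rootWeight R i)

theorem divDiff_expo (i : ι) (lam : weightLattice R) : divDiff i (expo lam) =
    if 0 ≤ pairZ i lam then ∑ j ∈ Finset.range (pairZ i lam).toNat, expo (lam - j • rootWeight R i)
    else -∑ j ∈ Finset.range (-pairZ i lam).toNat, expo (lam + (j + 1) • rootWeight R i) := by
  rw [divDiff, ← expBasis_apply, Module.Basis.constr_basis]

theorem sRefl_smul_weight (i : ι) (lam : weightLattice R) :
    sRefl R i • lam = lam - pairZ i lam • rootWeight R i := by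
  apply Subtype.ext
  rw [coe_smul_weight, sRefl_smul, coroot_eq_pairZ, AddSubgroup.coe_sub, AddSubgroup.coe_zsmul,
    coe_rootWeight, Int.cast_smul_eq_zsmul]

theorem one_sub_mul_divDiff (i : ι) (phi : Laurent R) :
    (1 - expo (-rootWeight R i)) * divDiff i phi = phi - weylAct R (sRefl R i) phi := by
  have : LinearMap.mulLeft ℂ (1 - expo (-rootWeight R i)) ∘ₗ divDiff i =
      LinearMap.id - (weylAct R (sRefl R i)).toLinearMap := by
    refine laurent_hom_ext fun lam => ?_
    simp only [AlgHom.toLinearMap_apply, LinearMap.comp_apply, LinearMap.sub_apply,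
      LinearMap.id_apply, LinearMap.mulLeft_apply, weylAct_expo, sRefl_smul_weight, divDiff_expo]
    split_ifs with h
    · obtain ⟨n, hn⟩ := Int.eq_ofNat_of_zero_le h
      rw [hn, Int.toNat_natCast, Finset.mul_sum]
      have : ∀ j ∈ Finset.range n, (1 - expo (-rootWeight R i)) * expo (lam - j • rootWeight R i) =
          expo (lam - j • rootWeight R i) - expo (lam - (j + 1) • rootWeight R i) := by
        intro j _
        rw [sub_mul, one_mul, expo_mul]
        congr 2
        module
      rw [Finset.sum_congr rfl this,
        Finset.sum_range_sub' (fun j => expo (lam - j • rootWeight R i))]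
      simp
    · obtain ⟨n, hn⟩ := Int.eq_ofNat_of_zero_le (a := -pairZ i lam) (by omega)
      have hn' : pairZ i lam = -(n : ℤ) := by omega
      rw [hn', neg_neg, Int.toNat_natCast, mul_neg, Finset.mul_sum]
      have : ∀ j ∈ Finset.range n,
          (1 - expo (-rootWeight R i)) * expo (lam + (j + 1) • rootWeight R i) =
          expo (lam + (j + 1) • rootWeight R i) - expo (lam + j • rootWeight R i) := by
        intro j _
        rw [sub_mul, one_mul, expo_mul]
        congr 2
        module
      rw [Finset.sum_congr rfl this,
        Finset.sum_range_sub (fun j => expo (lam + j • rootWeight R i))]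
      simp
  exact LinearMap.congr_fun this phi

/-- The operator `(1 + e^{-α}) / (1 - e^{-α}) * (1 - s_α)`. -/
def symDiff (i : ι) : Laurent R →ₗ[ℂ] Laurent R :=
  -- With `q = e^{-α}` this uses `(1 + q)/(1 - q) = 2/(1 - q) - 1`.
  (2 : ℂ) • divDiff i - LinearMap.id + (weylAct R (sRefl R i)).toLinearMap

theorem symDiff_apply (i : ι) (phi : Laurent R) :
    symDiff i phi = (2 : ℂ) • divDiff i phi - phi + weylAct R (sRefl R i) phi := rfl

theorem one_sub_mul_symDiff (i : ι) (phi : Laurent R) :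
    (1 - expo (-rootWeight R i)) * symDiff i phi =
      (1 + expo (-rootWeight R i)) * (phi - weylAct R (sRefl R i) phi) := by
  rw [symDiff_apply, mul_add, mul_sub, mul_smul_comm, one_sub_mul_divDiff, two_smul]
  ring

theorem weylAct_symDiff (w : R.weylGroup) (i : ι) (phi : Laurent R) :
    weylAct R w (symDiff i phi) = symDiff (R.weylGroupToPerm w i) (weylAct R w phi) := by
  apply mul_left_cancel₀ (one_sub_expo_ne_zero (R.weylGroupToPerm w i))
  rw [one_sub_mul_symDiff, sRefl_perm, ← weylAct_mul, inv_mul_cancel_right]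
  have h := congrArg (weylAct R w) (one_sub_mul_symDiff i phi)
  rw [map_mul, map_mul, map_sub, map_sub, map_add, map_one, weylAct_expo, smul_neg,
    smul_rootWeight] at h
  rw [h, weylAct_mul]

/-- The index of the root `-α`. -/
abbrev negIdx (R : RootPairing ι ℝ M N) (i : ι) : ι := R.weylGroupToPerm (sRefl R i) i

theorem rootWeight_negIdx (i : ι) : rootWeight R (negIdx R i) = -rootWeight R i := by
  apply Subtype.ext
  rw [coe_rootWeight, root_sRefl_self]; rfl

theorem sRefl_negIdx (i : ι) : sRefl R (negIdx R i) = sRefl R i := by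
  rw [sRefl_perm, mul_inv_cancel_right]

/-- The factor `(1 + q)/(1 - q)` is odd under `q ↦ q⁻¹`, and `s_{-α} = s_α`. -/
theorem symDiff_negIdx (i : ι) (phi : Laurent R) : symDiff (negIdx R i) phi = -symDiff i phi := by
  apply mul_left_cancel₀ (one_sub_expo_ne_zero (R := R) (negIdx R i))
  have h : (1 : Laurent R) - expo (-rootWeight R (negIdx R i)) =
      -(expo (rootWeight R i) * (1 - expo (-rootWeight R i))) := by
    rw [rootWeight_negIdx, neg_neg, mul_sub, expo_mul, add_neg_cancel, expo_zero]
    ring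
  have h2 : (1 : Laurent R) + expo (-rootWeight R (negIdx R i)) =
      expo (rootWeight R i) * (1 + expo (-rootWeight R i)) := by
    rw [rootWeight_negIdx, neg_neg, mul_add, expo_mul, add_neg_cancel, expo_zero]
    ring
  rw [one_sub_mul_symDiff, h2, h, neg_mul_neg, mul_assoc, mul_assoc, one_sub_mul_symDiff,
    sRefl_negIdx]

/-- The derivation `e^lam ↦ f(lam) e^lam`. -/
def formDeriv (f : Module.Dual ℝ M) : Laurent R →ₗ[ℂ] Laurent R :=
  (expBasis R).constr ℂ fun lam => (f lam : ℂ) • expo lam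

theorem formDeriv_expo (f : Module.Dual ℝ M) (lam : weightLattice R) :
    formDeriv f (expo lam) = (f lam : ℂ) • expo lam := by
  rw [formDeriv, ← expBasis_apply, Module.Basis.constr_basis]; rfl

/-- A linear form composed with a reflection. -/
def reflForm (f : Module.Dual ℝ M) (i : ι) : Module.Dual ℝ M := f ∘ₗ (R.reflection i).toLinearMap

theorem reflForm_apply (f : Module.Dual ℝ M) (i : ι) (x : M) :
    reflForm (R := R) f i x = f (sRefl R i • x) := by
  rw [sRefl_smul, reflForm]; rfl

theorem weylAct_formDeriv (i : ι) (f : Module.Dual ℝ M) (phi : Laurent R) :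
    weylAct R (sRefl R i) (formDeriv f phi) =
      formDeriv (reflForm (R := R) f i) (weylAct R (sRefl R i) phi) := by
  have : (weylAct R (sRefl R i)).toLinearMap ∘ₗ formDeriv f =
      formDeriv (reflForm (R := R) f i) ∘ₗ (weylAct R (sRefl R i)).toLinearMap := by
    refine laurent_hom_ext fun lam => ?_
    simp only [AlgHom.toLinearMap_apply, LinearMap.comp_apply, weylAct_expo, formDeriv_expo, map_smul,
      reflForm_apply]
    rw [← coe_smul_weight, smul_smul, sRefl_mul_self, one_smul]
  exact LinearMap.congr_fun this phi

/-! ### Heckman and Cherednik operators and their relations with reflections -/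

variable [Fintype ι] (D : SimpleSystem R) (k : ι → ℝ)

/-- The Weyl group equivariant operators of Heckman. -/
def heckmanOp (f : Module.Dual ℝ M) : Laurent R →ₗ[ℂ] Laurent R :=
  -- The sum runs over all roots. For `W`-invariant `k` the terms of `α` and `-α` agree, so `1/4`
  -- here is the usual `1/2` over positive roots.
  formDeriv f + ∑ i, ((k i * f (R.root i) / 4 : ℝ) : ℂ) • symDiff i

theorem heckmanOp_apply (f : Module.Dual ℝ M) (phi : Laurent R) : heckmanOp k f phi =
    formDeriv f phi + ∑ i, ((k i * f (R.root i) / 4 : ℝ) : ℂ) • symDiff i phi := by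
  simp [heckmanOp]

open Classical in
/-- `1` on positive and `-1` on negative roots. -/
def rootSign (i : ι) : ℝ := if i ∈ posRoots D then 1 else -1

theorem rootSign_negIdx (i : ι) : rootSign D (negIdx R i) = -rootSign D i := by
  rw [rootSign, rootSign]
  by_cases h : i ∈ posRoots D
  · rw [if_neg (fun h' => (neg_pos_iff D (root_sRefl_self i)).1 h' h), if_pos h]
  · rw [if_pos ((neg_pos_iff D (root_sRefl_self i)).2 h), if_neg h, neg_neg]

/-- The combination of reflections by which the operators of Heckman and Cherednik differ. -/
def reflOp (f : Module.Dual ℝ M) : Laurent R →ₗ[ℂ] Laurent R :=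
  ∑ i, ((k i * f (R.root i) / 4 * rootSign D i : ℝ) : ℂ) • (weylAct R (sRefl R i)).toLinearMap

theorem reflOp_apply (f : Module.Dual ℝ M) (phi : Laurent R) : reflOp D k f phi =
    ∑ i, ((k i * f (R.root i) / 4 * rootSign D i : ℝ) : ℂ) • weylAct R (sRefl R i) phi := by
  simp [reflOp]

/-- The Cherednik operators. -/
def cherednik (f : Module.Dual ℝ M) : Laurent R →ₗ[ℂ] Laurent R :=
  -- For positive `α` the combination `symDiff - s_α` is `2 * divDiff - 1`. The result is the usual
  -- `∂_f + ∑_{α>0} k_α f(α) (1 - e^{-α})⁻¹(1 - s_α)` minus the constant `½ ∑_{α>0} k_α f(α)`.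
  heckmanOp k f - reflOp D k f

theorem cherednik_apply (f : Module.Dual ℝ M) (phi : Laurent R) :
    cherednik D k f phi = formDeriv f phi + ∑ i, ((k i * f (R.root i) / 4 : ℝ) : ℂ) •
      (symDiff i phi - (rootSign D i : ℂ) • weylAct R (sRefl R i) phi) := by
  rw [cherednik, LinearMap.sub_apply, heckmanOp_apply, reflOp_apply, add_sub_assoc,
    ← Finset.sum_sub_distrib]
  congr 1
  refine Finset.sum_congr rfl fun i _ => ?_
  rw [smul_sub, smul_smul]
  push_cast
  rfl

variable {k} in
theorem weylAct_heckmanOp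
    (hkW : ∀ (w : R.weylGroup) (i : ι), k (R.weylGroupToPerm w i) = k i) (i : ι)
    (f : Module.Dual ℝ M) (phi : Laurent R) :
    weylAct R (sRefl R i) (heckmanOp k f phi) =
      heckmanOp k (reflForm (R := R) f i) (weylAct R (sRefl R i) phi) := by
  rw [heckmanOp_apply, heckmanOp_apply, map_add, map_sum, weylAct_formDeriv]
  congr 1
  rw [← Equiv.sum_comp (R.weylGroupToPerm (sRefl R i))]
  refine Finset.sum_congr rfl fun j _ => ?_
  rw [map_smul, weylAct_symDiff, hkW, ← perm_mul, sRefl_mul_self, map_one, root_perm,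
    ← reflForm_apply]
  rfl

/-- The scalar in the cross relation between a simple reflection and a Cherednik operator. -/
def crossCoeff (a : ι) (f : Module.Dual ℝ M) : ℝ :=
  ∑ j, k j * f (R.root j) / 4 *
    (rootSign D (R.weylGroupToPerm (sRefl R a) j) - rootSign D j)

variable {k} in
-- Conjugation by `s_a` permutes the reflections and can change `rootSign` only at roots
-- proportional to `α_a`. For these `s_j = s_a`, the two reflections cancel, and a scalar multiple
-- of `phi` remains.
theorem weylAct_reflOp
    (hkW : ∀ (w : R.weylGroup) (i : ι), k (R.weylGroupToPerm w i) = k i) {a : ι}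
    (ha : a ∈ D.support) (f : Module.Dual ℝ M) (phi : Laurent R) :
    weylAct R (sRefl R a) (reflOp D k f phi) =
      reflOp D k (reflForm (R := R) f a) (weylAct R (sRefl R a) phi) -
        ((crossCoeff D k a f : ℝ) : ℂ) • phi := by
  have h1 : weylAct R (sRefl R a) (reflOp D k f phi) =
      ∑ j, ((k j * f (sRefl R a • R.root j) / 4 *
        rootSign D (R.weylGroupToPerm (sRefl R a) j) : ℝ) : ℂ) •
          weylAct R (sRefl R j) (weylAct R (sRefl R a) phi) := by
    rw [reflOp_apply, map_sum, ← Equiv.sum_comp (R.weylGroupToPerm (sRefl R a))]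
    refine Finset.sum_congr rfl fun j _ => ?_
    rw [map_smul, hkW, root_perm, sRefl_perm, sRefl_inv, ← weylAct_mul, ← weylAct_mul,
      ← mul_assoc, ← mul_assoc, sRefl_mul_self, one_mul]
  rw [h1, reflOp_apply, eq_sub_iff_add_eq, ← eq_sub_iff_add_eq', ← Finset.sum_sub_distrib,
    crossCoeff, Complex.ofReal_sum, Finset.sum_smul]
  refine Finset.sum_congr rfl fun j _ => ?_
  rw [reflForm_apply, ← sub_smul, ← Complex.ofReal_sub, ← mul_sub]
  by_cases hs : rootSign D (R.weylGroupToPerm (sRefl R a) j) = rootSign D j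
  · rw [hs]; simp
  · obtain ⟨c, hc⟩ : ∃ c : ℝ, R.root j = c • R.root a := by
      by_cases hj : j ∈ posRoots D
      · obtain ⟨c, -, hc⟩ := root_eq_smul_of_simple_neg D ha hj (fun h => hs (by
          rw [rootSign, rootSign, if_pos hj, if_pos h]))
        exact ⟨c, hc⟩
      · obtain ⟨c, -, hc⟩ := root_eq_smul_of_simple_neg D ha (i := negIdx R j)
          ((neg_pos_iff D (root_sRefl_self j)).2 hj) (fun h => hs (by
          rw [rootSign, rootSign, if_neg hj, if_neg]
          refine (neg_pos_iff D (i := R.weylGroupToPerm (sRefl R a) j) ?_).1 h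
          rw [root_perm, root_sRefl_self, smul_neg, root_perm]))
        rw [root_sRefl_self] at hc
        exact ⟨-c, by rw [neg_smul, ← hc, neg_neg]⟩
    rw [sRefl_eq_of_root_eq_smul hc, weylAct_sRefl_self]
    have hneg : sRefl R a • R.root j = -R.root j := by
      rw [hc, weyl_smul_smul, ← root_perm, root_sRefl_self, smul_neg]
    rw [hneg, map_neg]
    congr 2
    ring

variable {k} in
theorem weylAct_cherednik
    (hkW : ∀ (w : R.weylGroup) (i : ι), k (R.weylGroupToPerm w i) = k i) {a : ι}
    (ha : a ∈ D.support) (f : Module.Dual ℝ M) (phi : Laurent R) :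
    weylAct R (sRefl R a) (cherednik D k f phi) =
      cherednik D k (reflForm (R := R) f a) (weylAct R (sRefl R a) phi) +
        ((crossCoeff D k a f : ℝ) : ℂ) • phi := by
  rw [cherednik, LinearMap.sub_apply, map_sub, weylAct_heckmanOp hkW, weylAct_reflOp D hkW ha,
    cherednik, LinearMap.sub_apply]
  abel

/-! #### Triangularity -/

open Classical in
/-- The sign of `⟨lam, α^∨⟩`; for `⟨lam, α^∨⟩ = 0` it is `-1` if `α` is positive, `1` otherwise. -/
def pairSign (i : ι) (lam : weightLattice R) : ℝ :=
  if 0 < R.coroot' i (lam : M) then 1 else if R.coroot' i (lam : M) < 0 then -1 else -rootSign D i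

/-- The joint spectrum of the Cherednik operators. -/
def spectralWeight (lam : weightLattice R) : M :=
  lam + ∑ i, (k i / 4 * pairSign D i lam) • R.root i

/-- The span of the `e^mu` with `mu < lam`. -/
def lowerSpan (lam : weightLattice R) : Submodule ℂ (Laurent R) :=
  Submodule.span ℂ (expo '' {mu | WeightLT D mu lam})

variable {D} in
theorem expo_mem_lowerSpan {lam mu : weightLattice R} (h : WeightLT D mu lam) :
    expo mu ∈ lowerSpan D lam := Submodule.subset_span ⟨mu, h, rfl⟩

theorem coroot_negIdx (i : ι) (x : M) : R.coroot' (negIdx R i) x = -R.coroot' i x := by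
  change R.toLinearMap x (R.coroot (negIdx R i)) = -R.toLinearMap x (R.coroot i)
  rw [coroot_of_root_eq_neg (root_sRefl_self i), map_neg]

theorem pairSign_negIdx (i : ι) (lam : weightLattice R) :
    pairSign D (negIdx R i) lam = -pairSign D i lam := by
  rw [pairSign, pairSign, coroot_negIdx, rootSign_negIdx]
  rcases lt_trichotomy (R.coroot' i (lam : M)) 0 with h | h | h
  · rw [if_pos (by linarith), if_neg (by linarith), if_pos h, neg_neg]
  · simp [h]
  · rw [if_neg (by linarith), if_pos (by linarith), if_pos h]

/-- For positive `α` the operator is `2 * divDiff - 1`. The monomial `e^lam` occurs in the divided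
difference exactly when `⟨lam, α^∨⟩ > 0`, so its total coefficient is `1` in that case and `-1`
otherwise, zero pairing included. -/
theorem symDiff_sub_triangular_of_pos {i : ι} (hi : i ∈ posRoots D) (lam : weightLattice R) :
    symDiff i (expo lam) - weylAct R (sRefl R i) (expo lam) - (pairSign D i lam : ℂ) • expo lam ∈
      lowerSpan D lam := by
  rw [symDiff_apply, add_sub_cancel_right]
  have hn := coroot_eq_pairZ i lam
  rcases lt_trichotomy (pairZ i lam) 0 with h | h | h
  · have hs : pairSign D i lam = -1 := by
      have h' : ((pairZ i lam : ℤ) : ℝ) < 0 := by exact_mod_cast h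
      rw [pairSign, hn, if_neg (by linarith), if_pos h']
    rw [divDiff_expo, if_neg (by omega), hs]
    have : (2 : ℂ) • -∑ j ∈ Finset.range (-pairZ i lam).toNat,
        expo (lam + (j + 1) • rootWeight R i) - expo lam - (((-1 : ℝ)) : ℂ) • expo lam =
        (-2 : ℂ) • ∑ j ∈ Finset.range (-pairZ i lam).toNat,
          expo (lam + (j + 1) • rootWeight R i) := by
      push_cast; module
    rw [this]
    refine Submodule.smul_mem _ _ (Submodule.sum_mem _ fun j hj => expo_mem_lowerSpan ?_)
    rw [Finset.mem_range] at hj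
    -- The last term is the end point `s_α lam`, lower by the Bruhat order; the others are interior
    -- to the string.
    by_cases hj' : (j : ℤ) + 1 = -pairZ i lam
    · have : lam + (j + 1) • rootWeight R i = sRefl R i • lam := by
        rw [sRefl_smul_weight, show pairZ i lam = -((j + 1 : ℕ) : ℤ) by push_cast; omega, neg_smul,
          natCast_zsmul, sub_neg_eq_add]
      rw [this]
      exact sRefl_weightLT hi (by rw [hn]; exact_mod_cast h)
    · refine string_weightLT (i := i) (c := -(j + 1)) (Or.inr ⟨by omega, by omega⟩) ?_
      rw [AddSubgroup.coe_add, AddSubgroup.coe_nsmul, coe_rootWeight]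
      push_cast
      module
  · have hs : pairSign D i lam = -1 := by
      rw [pairSign, hn, h, rootSign, if_pos hi]; simp
    rw [divDiff_expo, if_pos h.ge, hs, h]
    simp
  · have hs : pairSign D i lam = 1 := by
      have h' : 0 < ((pairZ i lam : ℤ) : ℝ) := by exact_mod_cast h
      rw [pairSign, hn, if_pos h']
    obtain ⟨m, hm⟩ : ∃ m : ℕ, pairZ i lam = m + 1 := ⟨(pairZ i lam - 1).toNat, by omega⟩
    rw [divDiff_expo, if_pos h.le, hs, show (pairZ i lam).toNat = m + 1 by omega,
      Finset.sum_range_succ']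
    have : (2 : ℂ) • (∑ j ∈ Finset.range m, expo (lam - (j + 1) • rootWeight R i) +
        expo (lam - 0 • rootWeight R i)) - expo lam - (((1 : ℝ)) : ℂ) • expo lam =
        (2 : ℂ) • ∑ j ∈ Finset.range m, expo (lam - (j + 1) • rootWeight R i) := by
      rw [zero_smul, sub_zero]
      push_cast; module
    rw [this]
    refine Submodule.smul_mem _ _ (Submodule.sum_mem _ fun j hj => expo_mem_lowerSpan ?_)
    rw [Finset.mem_range] at hj
    refine string_weightLT (i := i) (c := j + 1) (Or.inl ⟨by omega, by omega⟩) ?_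
    rw [AddSubgroup.coe_sub, AddSubgroup.coe_nsmul, coe_rootWeight]
    push_cast
    module

theorem symDiff_sub_triangular (i : ι) (lam : weightLattice R) :
    symDiff i (expo lam) - (rootSign D i : ℂ) • weylAct R (sRefl R i) (expo lam) -
      (pairSign D i lam : ℂ) • expo lam ∈ lowerSpan D lam := by
  by_cases hi : i ∈ posRoots D
  · have := symDiff_sub_triangular_of_pos D hi lam
    rw [rootSign, if_pos hi]
    simpa using this
  · have := symDiff_sub_triangular_of_pos D ((neg_pos_iff D (root_sRefl_self i)).2 hi) lam
    rw [rootSign, if_neg hi]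
    rw [symDiff_negIdx, pairSign_negIdx, sRefl_negIdx] at this
    convert! Submodule.neg_mem _ this using 1
    push_cast
    module

theorem cherednik_triangular (f : Module.Dual ℝ M) (lam : weightLattice R) :
    cherednik D k f (expo lam) - (f (spectralWeight D k lam) : ℂ) • expo lam ∈
      lowerSpan D lam := by
  have : cherednik D k f (expo lam) - (f (spectralWeight D k lam) : ℂ) • expo lam =
      ∑ i, ((k i * f (R.root i) / 4 : ℝ) : ℂ) • (symDiff i (expo lam) -
        (rootSign D i : ℂ) • weylAct R (sRefl R i) (expo lam) -
        (pairSign D i lam : ℂ) • expo lam) := by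
    rw [cherednik_apply, formDeriv_expo, spectralWeight, map_add, map_sum, Complex.ofReal_add, add_smul,
      add_sub_add_left_eq_sub, Complex.ofReal_sum, Finset.sum_smul, ← Finset.sum_sub_distrib]
    refine Finset.sum_congr rfl fun i _ => ?_
    rw [map_smul, smul_eq_mul, smul_sub _ _ ((pairSign D i lam : ℂ) • expo lam), smul_smul]
    congr 2
    push_cast
    ring
  rw [this]
  exact Submodule.sum_mem _ fun i _ => Submodule.smul_mem _ _ (symDiff_sub_triangular D i lam)

/-! #### Simplicity of the spectrum -/

/-- A choice of signs of the numbers `⟨lam, α^∨⟩`, with values in `[-1, 1]` where these vanish. -/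
structure IsSignOf (c : ι → ℝ) (lam : weightLattice R) : Prop where
  le_one : ∀ i, c i ≤ 1
  neg_one_le : ∀ i, -1 ≤ c i
  eq_one : ∀ i, 0 < R.coroot' i (lam : M) → c i = 1
  eq_neg_one : ∀ i, R.coroot' i (lam : M) < 0 → c i = -1

theorem isSignOf_pairSign (lam : weightLattice R) :
    IsSignOf (fun i => pairSign D i lam) lam where
  le_one i := by
    simp only [pairSign, rootSign]; split_ifs <;> norm_num
  neg_one_le i := by
    simp only [pairSign, rootSign]; split_ifs <;> norm_num
  eq_one i h := by simp only [pairSign]; rw [if_pos h]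
  eq_neg_one i h := by simp only [pairSign]; rw [if_neg (by linarith), if_pos h]

variable {k} in
-- For `x = lam - mu` the hypothesis expands `(x, x)` as a sum of terms `k_α/8 · (d - c) · ⟨x, α^∨⟩
-- · (α, α)`. Each is nonpositive, since signs are monotone in the pairing and `k ≥ 0`, so `x = 0`.
-- The freedom at vanishing pairings lets the lemma apply also to `W`-translates of spectral
-- weights.
theorem eq_of_spectral_eq (hk0 : ∀ i, 0 ≤ k i) {c d : ι → ℝ} {lam mu : weightLattice R}
    (hc : IsSignOf c lam) (hd : IsSignOf d mu)
    (h : (lam : M) + ∑ i, (k i / 4 * c i) • R.root i = mu + ∑ i, (k i / 4 * d i) • R.root i) :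
    lam = mu := by
  apply Subtype.ext
  rw [← sub_eq_zero]
  set x : M := (lam : M) - mu with hx
  have hx2 : x = ∑ i, (k i / 4 * (d i - c i)) • R.root i := by
    simp only [mul_sub, sub_smul, Finset.sum_sub_distrib, hx]
    rw [sub_eq_sub_iff_add_eq_add, h, add_comm]
  apply R.eq_zero_of_mem_rootSpan_of_rootForm_self_eq_zero (by simp)
  apply le_antisymm _ (R.zero_le_rootForm x)
  nth_rw 2 [hx2]
  rw [map_sum]
  refine Finset.sum_nonpos fun i _ => ?_
  rw [map_smul, smul_eq_mul]
  have h1 := two_mul_rootForm_root (R := R) x i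
  have h2 := rootForm_root_pos (R := R) i
  have h3 : (d i - c i) * R.coroot' i x ≤ 0 := by
    rw [hx, map_sub]
    rcases lt_trichotomy (R.coroot' i (lam : M)) (R.coroot' i (mu : M)) with hlt | heq | hlt
    · refine mul_nonpos_of_nonneg_of_nonpos ?_ (by linarith)
      by_cases hm : 0 < R.coroot' i (mu : M)
      · rw [hd.eq_one i hm]; linarith [hc.le_one i]
      · rw [hc.eq_neg_one i (by linarith)]; linarith [hd.neg_one_le i]
    · rw [heq]; simp
    · refine mul_nonpos_of_nonpos_of_nonneg ?_ (by linarith)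
      by_cases hm : 0 < R.coroot' i (lam : M)
      · rw [hc.eq_one i hm]; linarith [hd.le_one i]
      · rw [hd.eq_neg_one i (by linarith)]; linarith [hc.neg_one_le i]
  have h4 : k i / 4 * (d i - c i) * R.RootForm x (R.root i) =
      k i / 8 * ((d i - c i) * R.coroot' i x) * R.RootForm (R.root i) (R.root i) := by
    linear_combination (k i / 8 * (d i - c i)) * h1
  rw [h4]
  exact mul_nonpos_of_nonpos_of_nonneg
    (mul_nonpos_of_nonneg_of_nonpos (by linarith [hk0 i]) h3) h2.le

variable {k} in
theorem spectralWeight_injective (hk0 : ∀ i, 0 ≤ k i) {lam mu : weightLattice R}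
    (h : spectralWeight D k lam = spectralWeight D k mu) : lam = mu :=
  eq_of_spectral_eq hk0 (isSignOf_pairSign D lam) (isSignOf_pairSign D mu) h

variable {k} in
-- `w • spectralWeight lam` has the shape of a spectral weight of `w • lam`, but with signs
-- transported by `w`, which may differ from `pairSign` where the pairing vanishes.
theorem eq_smul_of_spectralWeight_eq (hk0 : ∀ i, 0 ≤ k i)
    (hkW : ∀ (w : R.weylGroup) (i : ι), k (R.weylGroupToPerm w i) = k i)
    {lam mu : weightLattice R} {w : R.weylGroup}
    (h : spectralWeight D k mu = w • spectralWeight D k lam) : mu = w • lam := by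
  refine eq_of_spectral_eq hk0 (isSignOf_pairSign D mu)
    (d := fun i => pairSign D (R.weylGroupToPerm w⁻¹ i) lam) (mu := w • lam) ?_ ?_
  · have h1 := isSignOf_pairSign D lam
    refine ⟨fun i => h1.le_one _, fun i => h1.neg_one_le _, fun i hi => h1.eq_one _ ?_,
      fun i hi => h1.eq_neg_one _ ?_⟩
    · rwa [← coroot_smul, ← coe_smul_weight]
    · rwa [← coroot_smul, ← coe_smul_weight]
  · have h2 : w • spectralWeight D k lam = ((w • lam : weightLattice R) : M) +
        ∑ i, (k i / 4 * pairSign D (R.weylGroupToPerm w⁻¹ i) lam) • R.root i := by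
      rw [spectralWeight, smul_add, Finset.smul_sum, coe_smul_weight]
      congr 1
      rw [← Equiv.sum_comp (R.weylGroupToPerm w)
        (fun i => (k i / 4 * pairSign D (R.weylGroupToPerm w⁻¹ i) lam) • R.root i)]
      refine Finset.sum_congr rfl fun i _ => ?_
      rw [weyl_smul_smul, hkW, ← perm_mul, inv_mul_cancel, map_one, root_perm]
      rfl
    rw [← h2, ← h, spectralWeight]

end Operators

/-! ### Integration over the compact torus -/

section TorusIntegrals

open MeasureTheory

variable {ι M N : Type*} [AddCommGroup M] [Module ℝ M] [NormedAddCommGroup N] [NormedSpace ℝ N]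
  {R : RootPairing ι ℝ M N}

theorem continuous_mk (R : RootPairing ι ℝ M N) : Continuous (Torus.mk R) :=
  QuotientAddGroup.continuous_mk

theorem isQuotientMap_mk (R : RootPairing ι ℝ M N) : Topology.IsQuotientMap (Torus.mk R) :=
  QuotientAddGroup.isQuotientMap_mk _

theorem finiteDimensional_of_isRootSystem [Finite ι] (R : RootPairing ι ℝ M N) [R.IsRootSystem] :
    FiniteDimensional ℝ N := by
  refine ⟨⟨(Set.finite_range R.coroot).toFinset, ?_⟩⟩
  rw [Set.Finite.coe_toFinset]
  exact RootPairing.IsRootSystem.span_coroot_eq_top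

theorem continuous_linear [Finite ι] (R : RootPairing ι ℝ M N) [R.IsRootSystem]
    {V : Type*} [NormedAddCommGroup V] [NormedSpace ℝ V] (f : N →ₗ[ℝ] V) : Continuous f := by
  have := finiteDimensional_of_isRootSystem R
  exact f.continuous_of_finiteDimensional

/-- The coroots span `𝔞`, so reducing coefficients modulo `1` exhibits `T` as the image of a cube.
-/
instance [Finite ι] [R.IsRootSystem] : CompactSpace (Torus R) := by
  cases nonempty_fintype ι
  let F : (ι → ℝ) → Torus R := fun c => Torus.mk R (∑ i, c i • R.coroot i)
  have hF : Continuous F := (continuous_mk R).comp (by fun_prop)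
  have hK : IsCompact (Set.univ.pi fun _ : ι => Set.Icc (0 : ℝ) 1) :=
    isCompact_univ_pi fun _ => isCompact_Icc
  refine ⟨?_⟩
  convert! hK.image hF using 1
  symm
  rw [Set.eq_univ_iff_forall]
  intro t
  obtain ⟨x, rfl⟩ := Torus.mk_surjective R t
  have hx : x ∈ Submodule.span ℝ (Set.range R.coroot) := by
    rw [RootPairing.IsRootSystem.span_coroot_eq_top]; trivial
  obtain ⟨c, rfl⟩ := (Submodule.mem_span_range_iff_exists_fun ℝ).1 hx
  refine ⟨fun i => Int.fract (c i), fun i _ => ⟨Int.fract_nonneg _, (Int.fract_lt_one _).le⟩, ?_⟩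
  change Torus.mk R _ = Torus.mk R _
  refine QuotientAddGroup.eq.2 ?_
  have : -∑ i, Int.fract (c i) • R.coroot i + ∑ i, c i • R.coroot i =
      ∑ i, ⌊c i⌋ • R.coroot i := by
    rw [neg_add_eq_sub, ← Finset.sum_sub_distrib]
    refine Finset.sum_congr rfl fun i _ => ?_
    rw [← sub_smul, Int.self_sub_fract, Int.cast_smul_eq_zsmul]
  rw [this]
  exact sum_mem fun i _ => zsmul_mem (AddSubgroup.subset_closure (Set.mem_range_self i)) _

theorem expWeight_add (t : Torus R) (lam mu : weightLattice R) :
    expWeight R t (lam + mu) = expWeight R t lam * expWeight R t mu := by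
  obtain ⟨x, rfl⟩ := Torus.mk_surjective R t
  simp [expWeight_mk, mul_add, Complex.exp_add]

theorem expWeight_zero (t : Torus R) : expWeight R t 0 = 1 := by
  obtain ⟨x, rfl⟩ := Torus.mk_surjective R t
  simp [expWeight_mk]

theorem norm_expWeight (t : Torus R) (lam : weightLattice R) : ‖expWeight R t lam‖ = 1 := by
  rw [expWeight]; exact Circle.norm_coe _

theorem expWeight_neg (t : Torus R) (lam : weightLattice R) :
    expWeight R t (-lam) = conj (expWeight R t lam) := by
  have h1 : expWeight R t (-lam) * expWeight R t lam = 1 := by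
    rw [← expWeight_add, neg_add_cancel, expWeight_zero]
  have h2 : conj (expWeight R t lam) * expWeight R t lam = 1 := by
    rw [mul_comm, Complex.mul_conj, Complex.normSq_eq_norm_sq, norm_expWeight]; simp
  have h3 : expWeight R t lam ≠ 0 := by
    rw [← norm_ne_zero_iff, norm_expWeight]; exact one_ne_zero
  exact mul_right_cancel₀ h3 (h1.trans h2.symm)

theorem evalAt_expo [R.IsCrystallographic] (t : Torus R) (lam : weightLattice R) :
    evalAt R t (expo lam) = expWeight R t lam := by
  rw [evalAt_single, one_mul]

variable [Fintype ι] [R.IsRootSystem]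

theorem continuous_expWeight (lam : weightLattice R) : Continuous fun t => expWeight R t lam := by
  rw [(isQuotientMap_mk R).continuous_iff]
  have : (fun t => expWeight R t lam) ∘ Torus.mk R = fun x =>
      Complex.exp (2 * Real.pi * Complex.I * (R.toLinearMap (lam : M) x : ℝ)) :=
    funext fun x => expWeight_mk R x lam
  rw [this]
  have := continuous_linear R (R.toLinearMap (lam : M))
  fun_prop

theorem continuous_evalAt (phi : Laurent R) : Continuous fun t => evalAt R t phi := by
  induction phi using AddMonoidAlgebra.induction_linear with
  | zero => simp only [map_zero]; exact continuous_const
  | add x y hx hy => simp only [map_add]; exact hx.add hy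
  | single lam c =>
    simp only [evalAt_single]
    exact continuous_const.mul (continuous_expWeight lam)

variable [R.IsCrystallographic] {k : ι → ℝ}

theorem continuous_weightFun (hk0 : ∀ i, 0 ≤ k i) : Continuous (weightFun R k) := by
  unfold weightFun
  refine continuous_finsetProd _ fun i _ => ?_
  exact Continuous.rpow_const (((continuous_expWeight _).sub continuous_const).norm)
    fun _ => Or.inr (hk0 i)

theorem weightFun_nonneg (t : Torus R) : 0 ≤ weightFun R k t :=
  Finset.prod_nonneg fun _ _ => Real.rpow_nonneg (norm_nonneg _) _

variable (dt : Measure (Torus R)) [dt.IsAddHaarMeasure]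

theorem integrable_of_continuous {F : Torus R → ℂ} (hF : Continuous F) : Integrable F dt :=
  hF.integrable_of_hasCompactSupport (HasCompactSupport.of_compactSpace _)

theorem continuous_integrand (hk0 : ∀ i, 0 ≤ k i) (phi psi : Laurent R) :
    Continuous (integrand R k phi psi) := by
  unfold integrand
  exact ((Complex.continuous_conj.comp (continuous_evalAt phi)).mul (continuous_evalAt psi)).mul
    (Complex.continuous_ofReal.comp (continuous_weightFun hk0))

theorem integrable_integrand (hk0 : ∀ i, 0 ≤ k i) (phi psi : Laurent R) :
    Integrable (integrand R k phi psi) dt :=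
  integrable_of_continuous dt (continuous_integrand hk0 phi psi)

/-! #### Invariance -/

/-- The action of a reflection on the torus. -/
def torusRefl (R : RootPairing ι ℝ M N) (i : ι) : Torus R →+ Torus R :=
  QuotientAddGroup.map (corootLattice R) (corootLattice R) (R.coreflection i).toAddMonoidHom (by
    rw [corootLattice, AddSubgroup.closure_le]
    rintro _ ⟨j, rfl⟩
    refine AddSubgroup.subset_closure ⟨R.reflectionPerm i j, ?_⟩
    rw [RootPairing.coroot_reflectionPerm]; rfl)

theorem torusRefl_mk (i : ι) (x : N) :
    torusRefl R i (Torus.mk R x) = Torus.mk R (R.coreflection i x) := rfl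

theorem torusRefl_torusRefl (i : ι) (t : Torus R) : torusRefl R i (torusRefl R i t) = t := by
  obtain ⟨x, rfl⟩ := Torus.mk_surjective R t
  rw [torusRefl_mk, torusRefl_mk, RootPairing.coreflection_same]

theorem continuous_torusRefl (i : ι) : Continuous (torusRefl R i) := by
  rw [(isQuotientMap_mk R).continuous_iff]
  exact (continuous_mk R).comp (continuous_linear R (R.coreflection i).toLinearMap)

theorem expWeight_torusRefl (i : ι) (t : Torus R) (lam : weightLattice R) :
    expWeight R (torusRefl R i t) lam = expWeight R t (sRefl R i • lam) := by
  obtain ⟨x, rfl⟩ := Torus.mk_surjective R t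
  have h : R.toLinearMap (lam : M) (R.coreflection i x) =
      R.toLinearMap ((sRefl R i • lam : weightLattice R) : M) x := by
    rw [coe_smul_weight, sRefl_smul, RootPairing.coreflection_apply, map_sub, map_sub,
      LinearMap.sub_apply, map_smul, map_smul, LinearMap.smul_apply, smul_eq_mul, smul_eq_mul,
      mul_comm]
    rfl
  rw [torusRefl_mk, expWeight_mk, expWeight_mk, h]

theorem evalAt_torusRefl (i : ι) (t : Torus R) (phi : Laurent R) :
    evalAt R (torusRefl R i t) phi = evalAt R t (weylAct R (sRefl R i) phi) := by
  have : (evalAt R (torusRefl R i t)).toLinearMap =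
      (evalAt R t).toLinearMap ∘ₗ (weylAct R (sRefl R i)).toLinearMap := by
    refine laurent_hom_ext fun lam => ?_
    simp only [AlgHom.toLinearMap_apply, LinearMap.comp_apply, weylAct_expo, evalAt_expo,
      expWeight_torusRefl]
  exact LinearMap.congr_fun this phi

/-- The action of a reflection on the torus, as a homeomorphism. -/
def torusReflHomeo (R : RootPairing ι ℝ M N) [R.IsRootSystem] [R.IsCrystallographic] (i : ι) :
    Torus R ≃ₜ Torus R where
  toFun := torusRefl R i
  invFun := torusRefl R i
  left_inv := torusRefl_torusRefl i
  right_inv := torusRefl_torusRefl i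
  continuous_toFun := continuous_torusRefl i
  continuous_invFun := continuous_torusRefl i

/-- The pushforward is again invariant, hence a multiple of `dt`, and it has the same finite nonzero
total mass. -/
theorem map_torusRefl (i : ι) : dt.map (torusRefl R i) = dt := by
  have hm : Measurable (torusRefl R i) := (continuous_torusRefl i).measurable
  have h1 : (dt.map (torusRefl R i)).IsAddLeftInvariant := by
    refine ⟨fun g => ?_⟩
    obtain ⟨g', rfl⟩ : ∃ g', g = torusRefl R i g' := ⟨_, (torusRefl_torusRefl i g).symm⟩
    rw [Measure.map_map (continuous_const_add _).measurable hm]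
    have : (fun x => torusRefl R i g' + x) ∘ torusRefl R i =
        torusRefl R i ∘ fun x => g' + x := by
      ext x; simp
    rw [this, ← Measure.map_map hm (continuous_const_add _).measurable, map_add_left_eq_self]
  have h2 : IsFiniteMeasure (dt.map (torusRefl R i)) := inferInstance
  have h3 := Measure.isAddInvariant_eq_smul_of_compactSpace (dt.map (torusRefl R i)) dt
  have h4 : dt.map (torusRefl R i) Set.univ = dt Set.univ := by
    rw [Measure.map_apply hm MeasurableSet.univ, Set.preimage_univ]
  rw [h3]
  rw [h3] at h4
  set c := (dt.map (torusRefl R i)).addHaarScalarFactor dt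
  have h5 : dt Set.univ ≠ 0 := by
    simpa using (NeZero.ne dt)
  have h6 : dt Set.univ ≠ ⊤ := measure_ne_top _ _
  rw [Measure.smul_apply, ENNReal.smul_def, smul_eq_mul] at h4
  have h7 : (c : ENNReal) = 1 := by
    have := (ENNReal.mul_eq_right h5 h6).1 h4
    exact this
  have h8 : c = 1 := by exact_mod_cast h7
  rw [h8, one_smul]

theorem integral_torusRefl (i : ι) (F : Torus R → ℂ) :
    ∫ t, F (torusRefl R i t) ∂dt = ∫ t, F t ∂dt := by
  nth_rw 2 [← map_torusRefl dt i]
  exact ((torusReflHomeo R i).measurableEmbedding.integral_map F).symm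

theorem weightFun_torusRefl (hkW : ∀ (w : R.weylGroup) (i : ι), k (R.weylGroupToPerm w i) = k i)
    (i : ι) (t : Torus R) : weightFun R k (torusRefl R i t) = weightFun R k t := by
  unfold weightFun
  rw [← Equiv.prod_comp (R.weylGroupToPerm (sRefl R i))
    (fun j => ‖expWeight R t (rootWeight R j) - 1‖ ^ k j)]
  refine Finset.prod_congr rfl fun j _ => ?_
  rw [expWeight_torusRefl, smul_rootWeight, hkW]

theorem innerK_weylAct (hkW : ∀ (w : R.weylGroup) (i : ι), k (R.weylGroupToPerm w i) = k i)
    (w : R.weylGroup) (phi psi : Laurent R) :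
    innerK R k dt (weylAct R w phi) (weylAct R w psi) = innerK R k dt phi psi := by
  obtain ⟨g, hg⟩ := w
  induction hg using RootPairing.weylGroup.induction generalizing phi psi with
  | mem i =>
    change innerK R k dt (weylAct R (sRefl R i) phi) (weylAct R (sRefl R i) psi) = _
    unfold innerK
    rw [← integral_torusRefl dt i (integrand R k phi psi)]
    refine integral_congr_ae (Filter.Eventually.of_forall fun t => ?_)
    simp only [integrand]
    rw [evalAt_torusRefl, evalAt_torusRefl, weightFun_torusRefl hkW]
  | one =>
    change innerK R k dt (weylAct R 1 phi) (weylAct R 1 psi) = _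
    rw [weylAct_one, weylAct_one]
  | mul x y hx hy ihx ihy =>
    have h : (⟨x * y, mul_mem hx hy⟩ : R.weylGroup) = ⟨x, hx⟩ * ⟨y, hy⟩ := rfl
    rw [h, weylAct_mul, weylAct_mul, ihx, ihy]

/-! #### Positivity -/

theorem exists_toLinearMap_eq (f : Module.Dual ℝ M) : ∃ x : N, ∀ m : M, R.toLinearMap m x = f m := by
  obtain ⟨x, hx⟩ := (R.toLinearMap.flip.toPerfPair).surjective f
  exact ⟨x, fun m => by rw [← hx]; rfl⟩

theorem expWeight_injective {lam mu : weightLattice R}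
    (h : ∀ t, expWeight R t lam = expWeight R t mu) : lam = mu := by
  by_contra hne
  obtain ⟨i, hi⟩ : ∃ i, pairZ i lam ≠ pairZ i mu := by
    by_contra! hcon
    exact hne (eq_of_pairZ_eq hcon)
  have hi' : ((pairZ i lam : ℤ) : ℝ) - pairZ i mu ≠ 0 := by
    rw [sub_ne_zero]; exact_mod_cast hi
  have h1 : ∀ t, expWeight R t (lam - mu) = 1 := by
    intro t
    rw [sub_eq_add_neg, expWeight_add, expWeight_neg, h t, Complex.mul_conj,
      Complex.normSq_eq_norm_sq, norm_expWeight]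
    simp
  -- At this point `lam - mu` takes the value `1/2`, so its character takes the value `-1`.
  have h2 := h1 (Torus.mk R ((2 * ((pairZ i lam : ℝ) - pairZ i mu))⁻¹ • R.coroot i))
  have h3 : R.toLinearMap ((lam - mu : weightLattice R) : M)
      ((2 * ((pairZ i lam : ℝ) - pairZ i mu))⁻¹ • R.coroot i) = 1 / 2 := by
    have h4 : R.toLinearMap ((lam - mu : weightLattice R) : M) (R.coroot i) =
        (pairZ i lam : ℝ) - pairZ i mu := by
      rw [← coroot_eq_pairZ, ← coroot_eq_pairZ, ← map_sub]; rfl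
    rw [map_smul, h4, smul_eq_mul]
    field_simp
  rw [expWeight_mk, h3] at h2
  have h5 : (2 * Real.pi * Complex.I * ((1 / 2 : ℝ) : ℂ) : ℂ) = Real.pi * Complex.I := by
    push_cast; ring
  rw [h5, Complex.exp_pi_mul_I] at h2
  norm_num at h2

/-- Distinct weights give distinct characters of `T`, and distinct characters are linearly
independent. -/
theorem eq_zero_of_evalAt {phi : Laurent R} (h : ∀ t, evalAt R t phi = 0) : phi = 0 := by
  let chi : weightLattice R → (Multiplicative (Torus R) →* ℂ) := fun lam =>
    { toFun := fun t => expWeight R t.toAdd lam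
      map_one' := by simp [expWeight]
      map_mul' := by intro a b; simp [expWeight, AddCircle.toCircle_add] }
  have hchi : Function.Injective chi := by
    intro lam mu hlm
    exact expWeight_injective fun t => DFunLike.congr_fun hlm (Multiplicative.ofAdd t)
  have hli := (linearIndependent_monoidHom (Multiplicative (Torus R)) ℂ).comp chi hchi
  rw [linearIndependent_iff] at hli
  apply AddMonoidAlgebra.coeff_injective
  apply hli
  ext t
  have := h t.toAdd
  rw [evalAt, AddMonoidAlgebra.lift_apply] at this
  rw [Finsupp.linearCombination_apply, Finsupp.sum, Finset.sum_apply]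
  exact this

variable {dt}

theorem innerK_self_pos (hk0 : ∀ i, 0 ≤ k i) {phi : Laurent R} (h : phi ≠ 0) :
    0 < (innerK R k dt phi phi).re := by
  have h1 : ∀ t, integrand R k phi phi t = ((‖evalAt R t phi‖ ^ 2 * weightFun R k t : ℝ) : ℂ) := by
    intro t
    rw [integrand, mul_comm (conj _), Complex.mul_conj, Complex.normSq_eq_norm_sq]
    push_cast
    rfl
  rw [innerK, integral_congr_ae (Filter.Eventually.of_forall h1), integral_complex_ofReal,
    Complex.ofReal_re]
  -- A point is needed where neither `phi` nor any `1 - e^{-α}` vanishes; it exists because their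
  -- product is a nonzero Laurent polynomial.
  have hne : phi * ∏ i, ((1 : Laurent R) - expo (-rootWeight R i)) ≠ 0 :=
    mul_ne_zero h (Finset.prod_ne_zero_iff.2 fun i _ => one_sub_expo_ne_zero i)
  obtain ⟨t, ht⟩ : ∃ t, evalAt R t (phi * ∏ i, ((1 : Laurent R) - expo (-rootWeight R i))) ≠ 0 := by
    by_contra! hcon
    exact hne (eq_zero_of_evalAt hcon)
  rw [map_mul, map_prod] at ht
  have ht1 := left_ne_zero_of_mul ht
  have ht2 := right_ne_zero_of_mul ht
  refine Continuous.integral_pos_of_hasCompactSupport_nonneg_nonzero (x := t)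
    (((continuous_evalAt phi).norm.pow 2).mul (continuous_weightFun hk0))
    (HasCompactSupport.of_compactSpace _)
    (fun t => mul_nonneg (sq_nonneg _) (weightFun_nonneg t)) ?_
  refine mul_ne_zero (pow_ne_zero _ (norm_ne_zero_iff.2 ht1)) ?_
  rw [weightFun]
  refine Finset.prod_ne_zero_iff.2 fun i _ => (Real.rpow_pos_of_pos (norm_pos_iff.2 ?_) _).ne'
  have h2 := Finset.prod_ne_zero_iff.1 ht2 i (Finset.mem_univ i)
  rw [map_sub, map_one, evalAt_expo, expWeight_neg] at h2
  intro h3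
  apply h2
  rw [sub_eq_zero.1 h3, map_one, sub_self]

theorem innerK_conj (phi psi : Laurent R) :
    conj (innerK R k dt psi phi) = innerK R k dt phi psi := by
  rw [innerK, innerK, ← integral_conj]
  refine integral_congr_ae (Filter.Eventually.of_forall fun t => ?_)
  simp only [integrand, map_mul, Complex.conj_conj, Complex.conj_ofReal]
  ring

theorem innerK_add_left (hk0 : ∀ i, 0 ≤ k i) (phi phi' psi : Laurent R) :
    innerK R k dt (phi + phi') psi = innerK R k dt phi psi + innerK R k dt phi' psi := by
  rw [innerK, innerK, innerK, ← integral_add (integrable_integrand dt hk0 _ _)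
    (integrable_integrand dt hk0 _ _)]
  refine integral_congr_ae (Filter.Eventually.of_forall fun t => ?_)
  simp only [integrand, map_add]
  ring

theorem innerK_smul_left (c : ℂ) (phi psi : Laurent R) :
    innerK R k dt (c • phi) psi = conj c * innerK R k dt phi psi := by
  rw [innerK, innerK, ← integral_const_mul]
  refine integral_congr_ae (Filter.Eventually.of_forall fun t => ?_)
  simp only [integrand, map_smul, smul_eq_mul, map_mul]
  ring

variable (dt) in
/-- `ℂ[P]` with the inner product `(φ, ψ)_k`. -/
abbrev innerCore (hk0 : ∀ i, 0 ≤ k i) : InnerProductSpace.Core ℂ (Laurent R) where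
  inner phi psi := innerK R k dt phi psi
  conj_inner_symm phi psi := innerK_conj phi psi
  re_inner_nonneg phi := by
    by_cases h : phi = 0
    · subst h
      have : innerK R k dt (0 : Laurent R) 0 = 0 := by
        simpa using innerK_smul_left (k := k) (dt := dt) 0 (0 : Laurent R) 0
      rw [this]; simp
    · exact (innerK_self_pos hk0 h).le
  add_left := innerK_add_left hk0
  smul_left phi psi c := innerK_smul_left c phi psi
  definite phi h := by
    by_contra hne
    have := innerK_self_pos (dt := dt) hk0 hne
    rw [h] at this
    exact lt_irrefl _ this

end TorusIntegrals

/-! ### Symmetry of the Cherednik operators -/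

section Symmetry

open MeasureTheory Filter Topology

variable {ι M N : Type*} [AddCommGroup M] [Module ℝ M] [NormedAddCommGroup N] [NormedSpace ℝ N]
  {R : RootPairing ι ℝ M N} [Fintype ι] [R.IsRootSystem] [R.IsCrystallographic] {k : ι → ℝ}
  {dt : Measure (Torus R)} [dt.IsAddHaarMeasure]

/-! #### Integrals of derivatives -/

/-- By invariance `s ↦ ∫ F(t + sx) dt` is constant. Compactness bounds `F'`, which permits
differentiation under the integral. -/
theorem integral_eq_zero_of_hasDerivAt {F F' : Torus R → ℂ} (hF : Continuous F)
    (hF' : Continuous F') (x : N)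
    (h : ∀ t, HasDerivAt (fun s : ℝ => F (t + Torus.mk R (s • x))) (F' t) 0) :
    ∫ t, F' t ∂dt = 0 := by
  obtain ⟨C, hC⟩ : ∃ C, ∀ t, ‖F' t‖ ≤ C := by
    obtain ⟨C, hC⟩ := (isCompact_range hF'.norm).bddAbove
    exact ⟨C, fun t => hC ⟨t, rfl⟩⟩
  have hder : ∀ (t : Torus R) (s : ℝ), HasDerivAt (fun s : ℝ => F (t + Torus.mk R (s • x)))
      (F' (t + Torus.mk R (s • x))) s := by
    intro t s
    have h1 := h (t + Torus.mk R (s • x))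
    have h2 : HasDerivAt (fun u : ℝ => u - s) 1 s := (hasDerivAt_id s).sub_const s
    have h3 := HasDerivAt.scomp (h := fun u : ℝ => u - s) s (by simpa using h1) h2
    rw [one_smul] at h3
    refine h3.congr_of_eventuallyEq (Eventually.of_forall fun u => ?_)
    simp only [Function.comp_apply]
    rw [add_assoc, ← map_add, ← add_smul]
    congr 4
    ring
  have hc : ∀ s : ℝ, Continuous fun t : Torus R => t + Torus.mk R (s • x) :=
    fun s => continuous_add_const _
  have key := hasDerivAt_integral_of_dominated_loc_of_deriv_le (μ := dt) (𝕜 := ℝ)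
    (F := fun s t => F (t + Torus.mk R (s • x))) (F' := fun s t => F' (t + Torus.mk R (s • x)))
    (x₀ := 0) (bound := fun _ => C) (s := Set.univ) univ_mem
    (Eventually.of_forall fun s => (hF.comp (hc s)).aestronglyMeasurable)
    (integrable_of_continuous dt (hF.comp (hc 0)))
    (hF'.comp (hc 0)).aestronglyMeasurable
    (Eventually.of_forall fun t s _ => hC _) (integrable_const C)
    (Eventually.of_forall fun t s _ => hder t s)
  have h1 := key.2
  simp only [integral_add_right_eq_self (μ := dt)] at h1
  exact h1.unique (hasDerivAt_const (0 : ℝ) (∫ t, F t ∂dt))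

theorem hasDerivAt_expWeight (x : N) (t : Torus R) (lam : weightLattice R) :
    HasDerivAt (fun s : ℝ => expWeight R (t + Torus.mk R (s • x)) lam)
      (2 * Real.pi * Complex.I * (R.toLinearMap (lam : M) x : ℝ) * expWeight R t lam) 0 := by
  obtain ⟨y, rfl⟩ := Torus.mk_surjective R t
  have h1 : (fun s : ℝ => expWeight R (Torus.mk R y + Torus.mk R (s • x)) lam) = fun s : ℝ =>
      expWeight R (Torus.mk R y) lam *
        Complex.exp (s * (2 * Real.pi * Complex.I * (R.toLinearMap (lam : M) x : ℝ))) := by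
    funext s
    rw [← map_add, expWeight_mk, expWeight_mk, ← Complex.exp_add, map_add, map_smul, smul_eq_mul]
    congr 1
    push_cast
    ring
  rw [h1]
  have h2 : HasDerivAt (fun s : ℝ => (s : ℂ) *
      (2 * Real.pi * Complex.I * (R.toLinearMap (lam : M) x : ℝ)))
      (1 * (2 * Real.pi * Complex.I * (R.toLinearMap (lam : M) x : ℝ))) 0 :=
    (Complex.ofRealCLM.hasDerivAt (x := (0 : ℝ))).mul_const _
  convert! (h2.cexp).const_mul (expWeight R (Torus.mk R y) lam) using 1
  simp only [Complex.ofReal_zero, zero_mul, Complex.exp_zero]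
  ring

theorem hasDerivAt_evalAt {f : Module.Dual ℝ M} {x : N} (hx : ∀ m, R.toLinearMap m x = f m)
    (t : Torus R) (phi : Laurent R) :
    HasDerivAt (fun s : ℝ => evalAt R (t + Torus.mk R (s • x)) phi)
      (2 * Real.pi * Complex.I * evalAt R t (formDeriv f phi)) 0 := by
  induction phi using AddMonoidAlgebra.induction_linear with
  | zero => simpa using hasDerivAt_const (0 : ℝ) (0 : ℂ)
  | add a b ha hb =>
    simp only [map_add, mul_add]
    exact ha.add hb
  | single lam c =>
    have h1 : (AddMonoidAlgebra.single lam c : Laurent R) = c • expo lam := by simp [expo]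
    simp only [h1, map_smul, formDeriv_expo, evalAt_expo, smul_eq_mul]
    convert! (hasDerivAt_expWeight x t lam).const_mul c using 1
    rw [hx]
    ring

/-! #### Regularized weight functions -/

/-- The function `|e^α - 1|^2`. -/
def rootDist (i : ι) (t : Torus R) : ℝ := ‖expWeight R t (rootWeight R i) - 1‖ ^ 2

theorem rootDist_nonneg (i : ι) (t : Torus R) : 0 ≤ rootDist i t := sq_nonneg _

theorem rootDist_eq (i : ι) (t : Torus R) :
    rootDist i t = 2 - 2 * (expWeight R t (rootWeight R i)).re := by
  have h := norm_expWeight t (rootWeight R i)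
  rw [rootDist, Complex.sq_norm, Complex.normSq_apply]
  have h1 : ‖expWeight R t (rootWeight R i)‖ ^ 2 = 1 := by rw [h]; norm_num
  rw [Complex.sq_norm, Complex.normSq_apply] at h1
  simp only [Complex.sub_re, Complex.sub_im, Complex.one_re, Complex.one_im]
  linarith

theorem rootDist_le (i : ι) (t : Torus R) : rootDist i t ≤ 4 := by
  have h := (Complex.abs_re_le_norm (expWeight R t (rootWeight R i)))
  rw [norm_expWeight] at h
  rw [rootDist_eq]
  linarith [(abs_le.1 h).1]

theorem continuous_rootDist (i : ι) : Continuous (rootDist (R := R) i) :=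
  ((continuous_expWeight _).sub continuous_const).norm.pow 2

variable (k) in
/-- The regularized weight function. -/
def regWeight (eps : ℝ) (t : Torus R) : ℝ := ∏ i, (rootDist i t + eps) ^ (k i / 2)

theorem continuous_regWeight (hk0 : ∀ i, 0 ≤ k i) (eps : ℝ) :
    Continuous (regWeight (R := R) k eps) := by
  unfold regWeight
  refine continuous_finsetProd _ fun i _ => ?_
  exact Continuous.rpow_const ((continuous_rootDist i).add continuous_const)
    fun _ => Or.inr (by linarith [hk0 i])

theorem regWeight_zero (t : Torus R) : regWeight k 0 t = weightFun R k t := by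
  refine Finset.prod_congr rfl fun i _ => ?_
  rw [add_zero, rootDist, ← Real.rpow_natCast, ← Real.rpow_mul (norm_nonneg _)]
  congr 1
  push_cast
  ring

theorem tendsto_regWeight (hk0 : ∀ i, 0 ≤ k i) (t : Torus R) :
    Tendsto (fun eps => regWeight k eps t) (𝓝[>] 0) (𝓝 (weightFun R k t)) := by
  rw [← regWeight_zero]
  have : Continuous fun eps => regWeight k eps t := by
    unfold regWeight
    refine continuous_finsetProd _ fun i _ => ?_
    exact Continuous.rpow_const (continuous_const.add continuous_id)
      fun _ => Or.inr (by linarith [hk0 i])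
  exact this.continuousAt.tendsto.mono_left nhdsWithin_le_nhds

theorem regWeight_nonneg {eps : ℝ} (he : 0 ≤ eps) (t : Torus R) : 0 ≤ regWeight k eps t :=
  Finset.prod_nonneg fun i _ => Real.rpow_nonneg (add_nonneg (rootDist_nonneg i t) he) _

/-- The constant `5` comes from `|e^α - 1|² ≤ 4` and `ε ≤ 1`; the bound is uniform in `ε`. -/
theorem regWeight_le (hk0 : ∀ i, 0 ≤ k i) {eps : ℝ} (he : 0 ≤ eps) (he1 : eps ≤ 1)
    (t : Torus R) : regWeight k eps t ≤ ∏ i, (5 : ℝ) ^ (k i / 2) := by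
  refine Finset.prod_le_prod (fun i _ => Real.rpow_nonneg (add_nonneg (rootDist_nonneg i t) he) _)
    fun i _ => Real.rpow_le_rpow (add_nonneg (rootDist_nonneg i t) he) ?_ (by linarith [hk0 i])
  linarith [rootDist_le i t]

theorem rootDist_torusRefl (i j : ι) (t : Torus R) :
    rootDist j (torusRefl R i t) = rootDist (R.weylGroupToPerm (sRefl R i) j) t := by
  rw [rootDist, rootDist, expWeight_torusRefl, smul_rootWeight]

theorem rootDist_torusRefl_self (i : ι) (t : Torus R) :
    rootDist i (torusRefl R i t) = rootDist i t := by
  rw [rootDist_torusRefl, rootDist_eq, rootDist_eq, rootWeight_negIdx, expWeight_neg,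
    Complex.conj_re]

theorem regWeight_torusRefl (hkW : ∀ (w : R.weylGroup) (i : ι), k (R.weylGroupToPerm w i) = k i)
    (eps : ℝ) (i : ι) (t : Torus R) :
    regWeight k eps (torusRefl R i t) = regWeight k eps t := by
  unfold regWeight
  rw [← Equiv.prod_comp (R.weylGroupToPerm (sRefl R i))
    (fun j => (rootDist j t + eps) ^ (k j / 2))]
  refine Finset.prod_congr rfl fun j _ => ?_
  rw [rootDist_torusRefl, hkW]

theorem hasDerivAt_rootDist {f : Module.Dual ℝ M} {x : N} (hx : ∀ m, R.toLinearMap m x = f m)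
    (i : ι) (t : Torus R) :
    HasDerivAt (fun s : ℝ => rootDist i (t + Torus.mk R (s • x)))
      (4 * Real.pi * f (R.root i) * (expWeight R t (rootWeight R i)).im) 0 := by
  simp only [rootDist_eq]
  have h1 := hasDerivAt_expWeight x t (rootWeight R i)
  have h2 := Complex.reCLM.hasFDerivAt.comp_hasDerivAt (0 : ℝ) h1
  convert! (h2.const_mul 2).const_sub 2 using 1
  rw [coe_rootWeight, hx]
  simp only [Complex.reCLM_apply, Complex.mul_re, Complex.mul_im, Complex.I_re, Complex.I_im,
    Complex.ofReal_re, Complex.ofReal_im, Complex.re_ofNat, Complex.im_ofNat]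
  ring

/-- For `ε > 0` all factors are positive, so the product can be differentiated logarithmically, even
at zeros of `δ_k`. -/
theorem hasDerivAt_regWeight {f : Module.Dual ℝ M} {x : N} (hx : ∀ m, R.toLinearMap m x = f m)
    {eps : ℝ} (he : 0 < eps) (t : Torus R) :
    HasDerivAt (fun s : ℝ => regWeight k eps (t + Torus.mk R (s • x)))
      (regWeight k eps t * ∑ i, k i * f (R.root i) * (2 * Real.pi) *
        ((expWeight R t (rootWeight R i)).im / (rootDist i t + eps))) 0 := by
  have hpos : ∀ i (t : Torus R), 0 < rootDist i t + eps :=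
    fun i t => add_pos_of_nonneg_of_pos (rootDist_nonneg i t) he
  have hexp : ∀ t : Torus R, regWeight k eps t =
      Real.exp (∑ i, Real.log (rootDist i t + eps) * (k i / 2)) := by
    intro t
    rw [Real.exp_sum]
    exact Finset.prod_congr rfl fun i _ => Real.rpow_def_of_pos (hpos i t) _
  simp only [hexp]
  have h1 : HasDerivAt (fun s : ℝ => ∑ i, Real.log (rootDist i (t + Torus.mk R (s • x)) + eps) *
      (k i / 2)) (∑ i, (4 * Real.pi * f (R.root i) * (expWeight R t (rootWeight R i)).im) /
        (rootDist i t + eps) * (k i / 2)) 0 := by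
    refine HasDerivAt.fun_sum fun i _ => ?_
    have h2 := ((hasDerivAt_rootDist hx i t).add_const eps).log (hpos i _).ne'
    convert! h2.mul_const (k i / 2) using 2
    simp
  convert! h1.exp using 1
  simp only [zero_smul, map_zero, add_zero]
  congr 1
  refine Finset.sum_congr rfl fun i _ => ?_
  ring

/-! #### Symmetrization -/

theorem integral_sub_eq_mul_integral_sub {P P' U V : Torus R → ℂ} (hP : Continuous P)
    (hP' : Continuous P') (hU : Continuous U) (hV : Continuous V) (c : ℂ)
    (h : ∀ t, P t - P' t = c * (U t - V t)) :
    ∫ t, P t ∂dt - ∫ t, P' t ∂dt = c * (∫ t, U t ∂dt - ∫ t, V t ∂dt) := by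
  rw [← integral_sub (integrable_of_continuous dt hP) (integrable_of_continuous dt hP'),
    ← integral_sub (integrable_of_continuous dt hU) (integrable_of_continuous dt hV),
    ← integral_const_mul]
  exact integral_congr_ae (Eventually.of_forall h)

theorem integral_add_sum {A : Torus R → ℂ} {P : ι → Torus R → ℂ} (hA : Continuous A)
    (hP : ∀ i, Continuous (P i)) (c : ι → ℂ) :
    ∫ t, (A t + ∑ i, c i * P i t) ∂dt = ∫ t, A t ∂dt + ∑ i, c i * ∫ t, P i t ∂dt := by
  have h1 : ∀ i, Continuous fun t => c i * P i t := fun i => continuous_const.mul (hP i)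
  have h2 : Continuous fun t => ∑ i, c i * P i t := continuous_finsetSum _ fun i _ => h1 i
  rw [integral_add (integrable_of_continuous dt hA) (integrable_of_continuous dt h2),
    integral_finsetSum _ fun i _ => integrable_of_continuous dt (h1 i)]
  congr 1
  exact Finset.sum_congr rfl fun i _ => integral_const_mul _ _

theorem symDiff_eq (i : ι) (phi : Laurent R) :
    symDiff i phi = (1 + expo (-rootWeight R i)) * divDiff i phi := by
  apply mul_left_cancel₀ (one_sub_expo_ne_zero (R := R) i)
  rw [one_sub_mul_symDiff, mul_left_comm, one_sub_mul_divDiff]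

theorem weylAct_symDiff_self (i : ι) (phi : Laurent R) :
    weylAct R (sRefl R i) (symDiff i phi) = symDiff i phi := by
  rw [weylAct_symDiff, symDiff_negIdx, neg_eq_iff_eq_neg]
  apply mul_left_cancel₀ (one_sub_expo_ne_zero (R := R) i)
  rw [mul_neg, one_sub_mul_symDiff, one_sub_mul_symDiff, weylAct_sRefl_self]
  ring

/-- With `z = e^α(t)` and `|z| = 1`, the identity `z - conj z = (z - 1)(1 + conj z)` turns `(1 -
conj z) Im z` into `i/2 · |z - 1|² (1 + conj z)`. The factor `|z - 1|²` compensates the small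
denominator `rootDist + ε`. -/
theorem sub_mul_im (i : ι) (t : Torus R) (phi : Laurent R) :
    (evalAt R t phi - evalAt R t (weylAct R (sRefl R i) phi)) *
        (expWeight R t (rootWeight R i)).im =
      Complex.I / 2 * rootDist i t * evalAt R t (symDiff i phi) := by
  set z := expWeight R t (rootWeight R i) with hz
  have h1 : evalAt R t phi - evalAt R t (weylAct R (sRefl R i) phi) =
      (1 - conj z) * evalAt R t (divDiff i phi) := by
    rw [← map_sub, ← one_sub_mul_divDiff, map_mul, map_sub, map_one, evalAt_expo, expWeight_neg]
  have h2 : evalAt R t (symDiff i phi) = (1 + conj z) * evalAt R t (divDiff i phi) := by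
    rw [symDiff_eq, map_mul, map_add, map_one, evalAt_expo, expWeight_neg]
  have h3 : z * conj z = 1 := by
    rw [Complex.mul_conj, Complex.normSq_eq_norm_sq, norm_expWeight]; simp
  have h4 : (rootDist i t : ℂ) = (z - 1) * (conj z - 1) := by
    rw [rootDist, ← Complex.normSq_eq_norm_sq, ← Complex.mul_conj, map_sub, map_one]
  have h5 : (z.im : ℂ) = -Complex.I / 2 * (z - conj z) := by
    rw [Complex.sub_conj]
    push_cast
    linear_combination (z.im : ℂ) * Complex.I_sq
  rw [h1, h2, h4, h5]
  linear_combination (-(Complex.I / 2 * evalAt R t (divDiff i phi) * (conj z - 1))) * h3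

/-- `Im e^α` is odd under `s_α` and the other weights are even, so `conj φ · ψ` may be replaced by
half of `conj φ · ψ - conj(sφ) · sψ = conj φ (ψ - sψ) + conj(φ - sφ) sψ`. Each difference absorbs
`Im e^α` by `sub_mul_im`. -/
theorem integral_im_eq (hkW : ∀ (w : R.weylGroup) (i : ι), k (R.weylGroupToPerm w i) = k i)
    (hk0 : ∀ i, 0 ≤ k i) {eps : ℝ} (he : 0 < eps) (i : ι) (phi psi : Laurent R) :
    ∫ t, conj (evalAt R t phi) * evalAt R t psi * (expWeight R t (rootWeight R i)).im *
        (regWeight k eps t / (rootDist i t + eps) : ℝ) ∂dt =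
      Complex.I / 4 * ∫ t, (conj (evalAt R t phi) * evalAt R t (symDiff i psi) -
        conj (evalAt R t (symDiff i phi)) * evalAt R t psi) * rootDist i t *
        (regWeight k eps t / (rootDist i t + eps) : ℝ) ∂dt := by
  set om : Torus R → ℝ := fun t => regWeight k eps t / (rootDist i t + eps) with hom
  have hom_cont : Continuous om := (continuous_regWeight hk0 eps).div
    ((continuous_rootDist i).add continuous_const)
    fun t => (add_pos_of_nonneg_of_pos (rootDist_nonneg i t) he).ne'
  have hom_inv : ∀ t, om (torusRefl R i t) = om t := by
    intro t
    simp only [hom]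
    rw [regWeight_torusRefl hkW, rootDist_torusRefl_self]
  have him : ∀ t, (expWeight R (torusRefl R i t) (rootWeight R i)).im =
      -(expWeight R t (rootWeight R i)).im := by
    intro t
    rw [expWeight_torusRefl, smul_rootWeight, rootWeight_negIdx, expWeight_neg, Complex.conj_im]
  have hs := continuous_evalAt (weylAct R (sRefl R i) psi)
  have hs' := Complex.continuous_conj.comp (continuous_evalAt (weylAct R (sRefl R i) phi))
  have hp := continuous_evalAt psi
  have hp' := Complex.continuous_conj.comp (continuous_evalAt phi)
  have hb := continuous_evalAt (symDiff i psi)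
  have hb' := Complex.continuous_conj.comp (continuous_evalAt (symDiff i phi))
  have hd := Complex.continuous_ofReal.comp (continuous_rootDist (R := R) i)
  have hz := Complex.continuous_ofReal.comp (Complex.continuous_im.comp
    (continuous_expWeight (R := R) (rootWeight R i)))
  have ho := Complex.continuous_ofReal.comp hom_cont
  set P : Torus R → ℂ := fun t => conj (evalAt R t phi) * evalAt R t psi *
      (expWeight R t (rootWeight R i)).im * om t with hP
  set P' : Torus R → ℂ := fun t => conj (evalAt R t (weylAct R (sRefl R i) phi)) *
      evalAt R t (weylAct R (sRefl R i) psi) * (expWeight R t (rootWeight R i)).im * om t with hP'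
  set U : Torus R → ℂ := fun t => conj (evalAt R t phi) * evalAt R t (symDiff i psi) *
      rootDist i t * om t with hU
  set V : Torus R → ℂ := fun t => conj (evalAt R t (symDiff i phi)) *
      evalAt R t (weylAct R (sRefl R i) psi) * rootDist i t * om t with hV
  set V' : Torus R → ℂ := fun t => conj (evalAt R t (symDiff i phi)) * evalAt R t psi *
      rootDist i t * om t with hV'
  have cP : Continuous P := ((hp'.mul hp).mul hz).mul ho
  have cP' : Continuous P' := ((hs'.mul hs).mul hz).mul ho
  have cU : Continuous U := ((hp'.mul hb).mul hd).mul ho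
  have cV : Continuous V := ((hb'.mul hs).mul hd).mul ho
  have cV' : Continuous V' := ((hb'.mul hp).mul hd).mul ho
  have e1 : ∫ t, P t ∂dt = -∫ t, P' t ∂dt := by
    rw [← integral_torusRefl dt i, ← integral_neg]
    refine integral_congr_ae (Eventually.of_forall fun t => ?_)
    simp only [hP, hP']
    rw [hom_inv, him, evalAt_torusRefl, evalAt_torusRefl]
    push_cast
    ring
  -- A second reflection turns `sψ` back into `ψ`, because `symDiff i phi` is `s_α`-invariant.
  have e2 : ∫ t, V t ∂dt = ∫ t, V' t ∂dt := by
    rw [← integral_torusRefl dt i]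
    refine integral_congr_ae (Eventually.of_forall fun t => ?_)
    simp only [hV, hV']
    rw [hom_inv, rootDist_torusRefl_self, evalAt_torusRefl, evalAt_torusRefl, weylAct_sRefl_self,
      weylAct_symDiff_self]
  have e3 : ∫ t, P t ∂dt - ∫ t, P' t ∂dt = Complex.I / 2 * (∫ t, U t ∂dt - ∫ t, V t ∂dt) := by
    refine integral_sub_eq_mul_integral_sub cP cP' cU cV _ fun t => ?_
    have h1 := sub_mul_im i t psi
    have h2 := congrArg conj (sub_mul_im i t phi)
    simp only [map_mul, map_sub, map_div₀, Complex.conj_ofReal, Complex.conj_I, map_ofNat] at h2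
    simp only [hP, hP', hU, hV]
    linear_combination (conj (evalAt R t phi) * om t) * h1 +
      (evalAt R t (weylAct R (sRefl R i) psi) * om t) * h2
  have e4 : ∫ t, (conj (evalAt R t phi) * evalAt R t (symDiff i psi) -
        conj (evalAt R t (symDiff i phi)) * evalAt R t psi) * rootDist i t * om t ∂dt =
      ∫ t, U t ∂dt - ∫ t, V' t ∂dt := by
    rw [← integral_sub (integrable_of_continuous dt cU) (integrable_of_continuous dt cV')]
    exact integral_congr_ae (Eventually.of_forall fun t => by simp only [hU, hV']; ring)
  rw [e4, ← e2]
  linear_combination (1 / 2 : ℂ) * e3 + (1 / 2 : ℂ) * e1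

/-! #### The limit -/

/-- The regularized symmetry relation: integrate the derivative of `conj φ · ψ · regWeight`, then
rewrite the terms from the weight by `integral_im_eq`. Its factor `i/4` accounts for the `1/4` in
`heckmanOp`. -/
theorem integral_regularized (hkW : ∀ (w : R.weylGroup) (i : ι), k (R.weylGroupToPerm w i) = k i)
    (hk0 : ∀ i, 0 ≤ k i) (f : Module.Dual ℝ M) {eps : ℝ} (he : 0 < eps) (phi psi : Laurent R) :
    ∫ t, (conj (evalAt R t phi) * evalAt R t (formDeriv f psi) -
        conj (evalAt R t (formDeriv f phi)) * evalAt R t psi) * regWeight k eps t +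
      ∑ i, ((k i * f (R.root i) / 4 : ℝ) : ℂ) *
        ((conj (evalAt R t phi) * evalAt R t (symDiff i psi) -
        conj (evalAt R t (symDiff i phi)) * evalAt R t psi) * rootDist i t *
        (regWeight k eps t / (rootDist i t + eps) : ℝ)) ∂dt = 0 := by
  obtain ⟨x, hx⟩ := exists_toLinearMap_eq (R := R) f
  have hp := continuous_evalAt psi
  have hp' := Complex.continuous_conj.comp (continuous_evalAt phi)
  have hq := continuous_evalAt (formDeriv f psi)
  have hq' := Complex.continuous_conj.comp (continuous_evalAt (formDeriv f phi))
  have hg := Complex.continuous_ofReal.comp (continuous_regWeight (R := R) hk0 eps)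
  have hom : ∀ i, Continuous fun t : Torus R =>
      ((regWeight k eps t / (rootDist i t + eps) : ℝ) : ℂ) :=
    fun i => Complex.continuous_ofReal.comp ((continuous_regWeight hk0 eps).div
      ((continuous_rootDist i).add continuous_const)
      fun t => (add_pos_of_nonneg_of_pos (rootDist_nonneg i t) he).ne')
  have hb := fun i => continuous_evalAt (symDiff i psi)
  have hb' := fun i => Complex.continuous_conj.comp (continuous_evalAt (symDiff i phi))
  have hd := fun i => Complex.continuous_ofReal.comp (continuous_rootDist (R := R) i)
  have hz := fun i => Complex.continuous_ofReal.comp (Complex.continuous_im.comp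
    (continuous_expWeight (R := R) (rootWeight R i)))
  set P : ι → Torus R → ℂ := fun i t => conj (evalAt R t phi) * evalAt R t psi *
      (expWeight R t (rootWeight R i)).im * (regWeight k eps t / (rootDist i t + eps) : ℝ) with hP
  set Q : ι → Torus R → ℂ := fun i t => (conj (evalAt R t phi) * evalAt R t (symDiff i psi) -
        conj (evalAt R t (symDiff i phi)) * evalAt R t psi) * rootDist i t *
        (regWeight k eps t / (rootDist i t + eps) : ℝ) with hQ
  set A : Torus R → ℂ := fun t => (conj (evalAt R t phi) * evalAt R t (formDeriv f psi) -
        conj (evalAt R t (formDeriv f phi)) * evalAt R t psi) * regWeight k eps t with hA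
  have cP : ∀ i, Continuous (P i) := fun i => ((hp'.mul hp).mul (hz i)).mul (hom i)
  have cQ : ∀ i, Continuous (Q i) :=
    fun i => (((hp'.mul (hb i)).sub ((hb' i).mul hp)).mul (hd i)).mul (hom i)
  have cA : Continuous A := ((hp'.mul hq).sub (hq'.mul hp)).mul hg
  have key := integral_eq_zero_of_hasDerivAt (dt := dt)
    (F := fun t => conj (evalAt R t phi) * evalAt R t psi * regWeight k eps t)
    -- The common factor `2πi` is pulled out. It turns the real factor `2π` in the derivative of the
    -- weight into `-i`, and conjugating it in the derivative of `conj φ` gives the minus sign in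
    -- `A`.
    (F' := fun t => (2 * Real.pi * Complex.I) * (A t +
        ∑ i, (-Complex.I * ((k i * f (R.root i) : ℝ) : ℂ)) * P i t))
    ((hp'.mul hp).mul hg)
    (continuous_const.mul (cA.add (continuous_finsetSum _ fun i _ => continuous_const.mul (cP i))))
    x (by
      intro t
      have d1 : HasDerivAt (fun s : ℝ => conj (evalAt R (t + Torus.mk R (s • x)) phi))
          (conj (2 * Real.pi * Complex.I * evalAt R t (formDeriv f phi))) 0 :=
        (hasDerivAt_evalAt hx t phi).star
      have d2 := hasDerivAt_evalAt hx t psi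
      have d3 := (hasDerivAt_regWeight (k := k) hx he t).ofReal_comp
      refine ((d1.fun_mul d2).fun_mul d3).congr_deriv ?_
      simp only [zero_smul, map_zero, add_zero, map_mul, Complex.conj_I, Complex.conj_ofReal,
        map_ofNat, Complex.ofReal_mul, Complex.ofReal_sum, hA, hP]
      rw [mul_add, Finset.mul_sum, Finset.mul_sum, Finset.mul_sum]
      congr 1
      · ring
      · refine Finset.sum_congr rfl fun i _ => ?_
        generalize conj (evalAt R t phi) = a
        generalize evalAt R t psi = b
        generalize (expWeight R t (rootWeight R i)).im = c
        generalize regWeight k eps t = g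
        generalize rootDist i t + eps = d
        push_cast
        linear_combination (2 * Real.pi * (k i) * (f (R.root i)) * a * b * c * (g / d) : ℂ) *
          Complex.I_sq)
  rw [integral_const_mul] at key
  have key2 := (mul_eq_zero.1 key).resolve_left Complex.two_pi_I_ne_zero
  rw [integral_add_sum cA cP] at key2
  rw [integral_add_sum cA cQ, ← key2]
  congr 1
  refine Finset.sum_congr rfl fun i _ => ?_
  rw [hP, hQ]
  simp only
  rw [integral_im_eq hkW hk0 he]
  generalize ∫ t, (conj (evalAt R t phi) * evalAt R t (symDiff i psi) -
    conj (evalAt R t (symDiff i phi)) * evalAt R t psi) * rootDist i t *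
    ((regWeight k eps t / (rootDist i t + eps) : ℝ) : ℂ) ∂dt = y
  push_cast
  linear_combination ((k i) * (f (R.root i)) / 4 * y : ℂ) * Complex.I_sq

/-- Off the zeros of `e^α - 1` the quotient `d/(d + ε)` tends to `1`. On them the left side is `0`,
and so is `δ_k` unless `k_α = 0`; the factor `k i` covers that exception. -/
theorem tendsto_regularized_term (hk0 : ∀ i, 0 ≤ k i) (i : ι) (t : Torus R) :
    Tendsto (fun eps => k i * (rootDist i t * (regWeight k eps t / (rootDist i t + eps))))
      (𝓝[>] 0) (𝓝 (k i * weightFun R k t)) := by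
  by_cases hd : rootDist i t = 0
  · have h0 : k i * weightFun R k t = 0 := by
      by_cases hk : k i = 0
      · rw [hk, zero_mul]
      · rw [← regWeight_zero, regWeight, Finset.prod_eq_zero (Finset.mem_univ i), mul_zero]
        rw [hd, add_zero, Real.zero_rpow (by simpa using hk)]
    rw [h0, hd]
    simp
  · have h1 : Tendsto (fun eps : ℝ => rootDist i t + eps) (𝓝[>] 0) (𝓝 (rootDist i t)) := by
      have : Continuous fun eps : ℝ => rootDist i t + eps := by fun_prop
      simpa using (this.tendsto 0).mono_left nhdsWithin_le_nhds
    have h2 := ((((tendsto_regWeight hk0 t).div h1 hd).const_mul (rootDist i t)).const_mul (k i))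
    rwa [mul_div_cancel₀ _ hd] at h2

theorem innerK_heckmanOp (hkW : ∀ (w : R.weylGroup) (i : ι), k (R.weylGroupToPerm w i) = k i)
    (hk0 : ∀ i, 0 ≤ k i) (f : Module.Dual ℝ M) (phi psi : Laurent R) :
    innerK R k dt (heckmanOp k f phi) psi = innerK R k dt phi (heckmanOp k f psi) := by
  set A : Torus R → ℂ := fun t => conj (evalAt R t phi) * evalAt R t (formDeriv f psi) -
        conj (evalAt R t (formDeriv f phi)) * evalAt R t psi with hA
  set C : ι → Torus R → ℂ := fun i t => conj (evalAt R t phi) * evalAt R t (symDiff i psi) -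
        conj (evalAt R t (symDiff i phi)) * evalAt R t psi with hC
  have hp := continuous_evalAt psi
  have hp' := Complex.continuous_conj.comp (continuous_evalAt phi)
  have cA : Continuous A := (hp'.mul (continuous_evalAt (formDeriv f psi))).sub
    ((Complex.continuous_conj.comp (continuous_evalAt (formDeriv f phi))).mul hp)
  have cC : ∀ i, Continuous (C i) := fun i => (hp'.mul (continuous_evalAt (symDiff i psi))).sub
    ((Complex.continuous_conj.comp (continuous_evalAt (symDiff i phi))).mul hp)
  let F : ℝ → Torus R → ℂ := fun eps t => A t * regWeight k eps t +
    ∑ i, ((k i * f (R.root i) / 4 : ℝ) : ℂ) *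
      (C i t * rootDist i t * (regWeight k eps t / (rootDist i t + eps) : ℝ))
  have hF0 : ∀ eps, 0 < eps → ∫ t, F eps t ∂dt = 0 := fun eps he =>
    integral_regularized hkW hk0 f he phi psi
  have hFc : ∀ eps, 0 < eps → Continuous (F eps) := by
    intro eps he
    refine (cA.mul (Complex.continuous_ofReal.comp (continuous_regWeight hk0 eps))).add
      (continuous_finsetSum _ fun i _ => continuous_const.mul (((cC i).mul
        (Complex.continuous_ofReal.comp (continuous_rootDist i))).mul
        (Complex.continuous_ofReal.comp ((continuous_regWeight hk0 eps).div
          ((continuous_rootDist i).add continuous_const)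
          fun t => (add_pos_of_nonneg_of_pos (rootDist_nonneg i t) he).ne'))))
  let F0 : Torus R → ℂ := fun t => A t * weightFun R k t +
    ∑ i, ((f (R.root i) / 4 : ℝ) : ℂ) * (C i t * (k i * weightFun R k t : ℝ))
  have hlim : ∀ t, Tendsto (fun eps => F eps t) (𝓝[>] 0) (𝓝 (F0 t)) := by
    intro t
    refine Tendsto.add (((Complex.continuous_ofReal.tendsto _).comp
      (tendsto_regWeight hk0 t)).const_mul _) (tendsto_finsetSum _ fun i _ => ?_)
    have h1 := (((Complex.continuous_ofReal.tendsto _).comp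
      (tendsto_regularized_term hk0 i t)).const_mul (C i t)).const_mul
        ((f (R.root i) / 4 : ℝ) : ℂ)
    refine h1.congr fun eps => ?_
    simp only [Function.comp_apply]
    push_cast
    ring
  set G : ℝ := ∏ i, (5 : ℝ) ^ (k i / 2) with hG
  let bound : Torus R → ℝ := fun t => ‖A t‖ * G +
    ∑ i, |k i * f (R.root i) / 4| * (‖C i t‖ * G)
  have hbc : Continuous bound := (cA.norm.mul continuous_const).add
    (continuous_finsetSum _ fun i _ => continuous_const.mul ((cC i).norm.mul continuous_const))
  have hbound : ∀ eps, 0 < eps → eps ≤ 1 → ∀ t, ‖F eps t‖ ≤ bound t := by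
    intro eps he he1 t
    have hg0 := regWeight_nonneg (k := k) he.le t
    have hg1 := regWeight_le hk0 he.le he1 t
    refine (norm_add_le _ _).trans (add_le_add ?_ ((norm_sum_le _ _).trans
      (Finset.sum_le_sum fun i _ => ?_)))
    · rw [norm_mul, Complex.norm_real, Real.norm_of_nonneg hg0]
      gcongr
    · rw [norm_mul, Complex.norm_real, Real.norm_eq_abs, mul_assoc, norm_mul, norm_mul,
        Complex.norm_real, Complex.norm_real]
      have hd := rootDist_nonneg i t
      have hde : 0 < rootDist i t + eps := by linarith
      rw [Real.norm_of_nonneg hd, Real.norm_of_nonneg (div_nonneg hg0 hde.le)]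
      -- Bounding `d/(d + ε)` by `1` gives a dominating function independent of `ε`.
      have : rootDist i t * (regWeight k eps t / (rootDist i t + eps)) ≤ G := by
        calc rootDist i t * (regWeight k eps t / (rootDist i t + eps))
            = rootDist i t / (rootDist i t + eps) * regWeight k eps t := by ring
          _ ≤ 1 * regWeight k eps t := by
              gcongr
              rw [div_le_one hde]; linarith
          _ ≤ G := by rw [one_mul]; exact hg1
      gcongr
  have htend := tendsto_integral_filter_of_dominated_convergence (μ := dt) (l := 𝓝[>] (0 : ℝ))
    (F := F) (f := F0) bound
    (by filter_upwards [self_mem_nhdsWithin] with eps he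
        exact (hFc eps he).aestronglyMeasurable)
    (by
      filter_upwards [self_mem_nhdsWithin, Ioc_mem_nhdsGT (zero_lt_one' ℝ)] with eps he he1
      exact Eventually.of_forall (hbound eps he he1.2))
    (hbc.integrable_of_hasCompactSupport (HasCompactSupport.of_compactSpace _))
    (Eventually.of_forall hlim)
  have hzero : ∫ t, F0 t ∂dt = 0 := by
    refine tendsto_nhds_unique htend ?_
    refine (tendsto_const_nhds (x := (0 : ℂ))).congr' ?_
    filter_upwards [self_mem_nhdsWithin] with eps he
    exact (hF0 eps he).symm
  have hdiff : ∀ t, F0 t = integrand R k phi (heckmanOp k f psi) t -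
      integrand R k (heckmanOp k f phi) psi t := by
    intro t
    simp only [F0, integrand, heckmanOp_apply, map_add, map_sum, map_smul, smul_eq_mul, map_mul,
      Complex.conj_ofReal, hA, hC, add_mul, mul_add, Finset.mul_sum, Finset.sum_mul]
    rw [add_sub_add_comm, ← Finset.sum_sub_distrib]
    congr 1
    · ring
    · refine Finset.sum_congr rfl fun i _ => ?_
      push_cast
      ring
  rw [integral_congr_ae (Eventually.of_forall hdiff), integral_sub
    (integrable_integrand dt hk0 _ _) (integrable_integrand dt hk0 _ _), sub_eq_zero] at hzero
  exact hzero.symm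

variable (dt) in
/-- The inner product as a linear map in the second variable. -/
def innerLin (hk0 : ∀ i, 0 ≤ k i) (phi : Laurent R) : Laurent R →ₗ[ℂ] ℂ where
  toFun psi := innerK R k dt phi psi
  map_add' a b := by
    rw [← innerK_conj, innerK_add_left hk0, map_add, innerK_conj, innerK_conj]
  map_smul' c a := by
    rw [← innerK_conj, innerK_smul_left, map_mul, Complex.conj_conj, innerK_conj]
    rfl

theorem innerLin_apply (hk0 : ∀ i, 0 ≤ k i) (phi psi : Laurent R) :
    innerLin dt hk0 phi psi = innerK R k dt phi psi := rfl

theorem innerK_sRefl (hkW : ∀ (w : R.weylGroup) (i : ι), k (R.weylGroupToPerm w i) = k i)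
    (i : ι) (phi psi : Laurent R) :
    innerK R k dt (weylAct R (sRefl R i) phi) psi =
      innerK R k dt phi (weylAct R (sRefl R i) psi) := by
  rw [← innerK_weylAct dt hkW (sRefl R i) phi, weylAct_sRefl_self]

theorem innerK_reflOp (hkW : ∀ (w : R.weylGroup) (i : ι), k (R.weylGroupToPerm w i) = k i)
    (hk0 : ∀ i, 0 ≤ k i) (D : SimpleSystem R) (f : Module.Dual ℝ M) (phi psi : Laurent R) :
    innerK R k dt (reflOp D k f phi) psi = innerK R k dt phi (reflOp D k f psi) := by
  rw [← innerK_conj, ← innerLin_apply hk0, ← innerLin_apply hk0, reflOp_apply, reflOp_apply,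
    map_sum, map_sum, map_sum]
  refine Finset.sum_congr rfl fun i _ => ?_
  rw [LinearMap.map_smul, LinearMap.map_smul, smul_eq_mul, smul_eq_mul, map_mul,
    Complex.conj_ofReal, innerLin_apply,
    innerLin_apply, innerK_conj, innerK_sRefl hkW]

theorem innerK_cherednik (hkW : ∀ (w : R.weylGroup) (i : ι), k (R.weylGroupToPerm w i) = k i)
    (hk0 : ∀ i, 0 ≤ k i) (D : SimpleSystem R) (f : Module.Dual ℝ M) (phi psi : Laurent R) :
    innerK R k dt (cherednik D k f phi) psi = innerK R k dt phi (cherednik D k f psi) := by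
  have h1 := innerK_heckmanOp (dt := dt) hkW hk0 f phi psi
  have h2 := innerK_reflOp (dt := dt) hkW hk0 D f phi psi
  rw [← innerK_conj, ← innerLin_apply hk0, ← innerLin_apply hk0] at h1 h2 ⊢
  rw [cherednik, LinearMap.sub_apply, LinearMap.sub_apply, map_sub, map_sub, map_sub, h1, h2]

end Symmetry

/-! ### Jacobi polynomials -/

section JacobiPolynomials

open MeasureTheory

theorem existsUnique_sub_mem_orthogonal {V : Type*} [NormedAddCommGroup V] [InnerProductSpace ℂ V]
    (S : Submodule ℂ V) [FiniteDimensional ℂ S] (v : V) :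
    ∃! p : V, p - v ∈ S ∧ ∀ u ∈ S, inner ℂ p u = 0 := by
  refine ⟨v - S.starProjection v, ⟨?_, Submodule.starProjection_inner_eq_zero v⟩, ?_⟩
  · simp
  · rintro q ⟨hq1, hq2⟩
    rw [← sub_eq_zero]
    set p := v - S.starProjection v with hp
    have h1 : q - p ∈ S := by
      rw [show q - p = (q - v) + S.starProjection v by rw [hp]; abel]
      exact add_mem hq1 (Submodule.starProjection_apply_mem S v)
    have h2 : inner ℂ (q - p) (q - p) = 0 := by
      rw [inner_sub_left, hq2 _ h1, Submodule.starProjection_inner_eq_zero v _ h1, sub_zero]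
    exact inner_self_eq_zero.1 h2

variable {ι M N : Type*} [AddCommGroup M] [Module ℝ M] [NormedAddCommGroup N] [NormedSpace ℝ N]
  {R : RootPairing ι ℝ M N} [Fintype ι] [R.IsRootSystem] [R.IsCrystallographic] {k : ι → ℝ}
  {dt : Measure (Torus R)} [dt.IsAddHaarMeasure]

theorem innerK_eq_zero_of_mem_span (hk0 : ∀ i, 0 ≤ k i) {s : Set (Laurent R)} {phi psi : Laurent R}
    (h : ∀ u ∈ s, innerK R k dt phi u = 0) (hpsi : psi ∈ Submodule.span ℂ s) :
    innerK R k dt phi psi = 0 := by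
  have : Submodule.span ℂ s ≤ LinearMap.ker (innerLin dt hk0 phi) :=
    Submodule.span_le.2 fun u hu => h u hu
  exact this hpsi

theorem innerK_eq_zero_symm {phi psi : Laurent R} (h : innerK R k dt phi psi = 0) :
    innerK R k dt psi phi = 0 := by
  rw [← innerK_conj, h, map_zero]

theorem innerK_eq_zero_of_span_span (hk0 : ∀ i, 0 ≤ k i) {s t : Set (Laurent R)}
    (h : ∀ u ∈ s, ∀ v ∈ t, innerK R k dt u v = 0) {phi psi : Laurent R}
    (hphi : phi ∈ Submodule.span ℂ s) (hpsi : psi ∈ Submodule.span ℂ t) :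
    innerK R k dt phi psi = 0 :=
  innerK_eq_zero_of_mem_span hk0 (fun v hv => innerK_eq_zero_symm
    (innerK_eq_zero_of_mem_span hk0 (fun u hu => innerK_eq_zero_symm (h u hu v hv)) hphi)) hpsi

theorem innerK_self_ne_zero (hk0 : ∀ i, 0 ≤ k i) {phi : Laurent R} (h : phi ≠ 0) :
    innerK R k dt phi phi ≠ 0 := by
  intro h0
  have := innerK_self_pos (dt := dt) hk0 h
  rw [h0] at this
  exact lt_irrefl _ this

variable (D : SimpleSystem R) (I : Set ι)

variable (dt) in
-- `p` is the orbit sum minus its orthogonal projection onto a span that is finite-dimensional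
-- because lower sets are finite.
theorem existsUnique_isJacobi (hk0 : ∀ i, 0 ≤ k i) (lam : weightLattice R) :
    ∃! p : Laurent R, IsJacobi D I k dt lam p := by
  let : NormedAddCommGroup (Laurent R) := (innerCore dt hk0).toNormedAddCommGroup
  let : InnerProductSpace ℂ (Laurent R) := InnerProductSpace.ofCore (innerCore dt hk0).toCore
  have hfin : FiniteDimensional ℂ (Submodule.span ℂ (orbitSum R I '' lowerWeights D I lam)) :=
    FiniteDimensional.span_of_finite ℂ ((finite_lowerWeights D I lam).image _)
  have h := existsUnique_sub_mem_orthogonal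
    (Submodule.span ℂ (orbitSum R I '' lowerWeights D I lam)) (orbitSum R I lam)
  have heq : ∀ p : Laurent R, IsJacobi D I k dt lam p ↔
      (p - orbitSum R I lam ∈ Submodule.span ℂ (orbitSum R I '' lowerWeights D I lam) ∧
        ∀ u ∈ Submodule.span ℂ (orbitSum R I '' lowerWeights D I lam),
          innerK R k dt p u = 0) := by
    intro p
    refine and_congr_right fun _ => ⟨fun h u hu => ?_, fun h mu hmu => ?_⟩
    · refine innerK_eq_zero_of_mem_span hk0 ?_ hu
      rintro _ ⟨mu, hmu, rfl⟩
      exact h mu hmu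
    · exact h _ (Submodule.subset_span ⟨mu, hmu, rfl⟩)
  simp only [heq]
  exact h

variable (dt) in
theorem isJacobi_jacobi (hk0 : ∀ i, 0 ≤ k i) (lam : weightLattice R) :
    IsJacobi D I k dt lam (jacobi D I k dt lam) :=
  Classical.epsilon_spec (existsUnique_isJacobi dt D I hk0 lam).exists

/-! #### Nonsymmetric Jacobi polynomials -/

theorem parabolic_empty : parabolic R ∅ = ⊥ := by simp [parabolic]

theorem orbitSum_empty (lam : weightLattice R) : orbitSum R ∅ lam = expo lam := by
  have : MulAction.orbit (parabolic R ∅) lam = {lam} := by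
    ext mu
    constructor
    · rintro ⟨⟨w, hw⟩, rfl⟩
      rw [parabolic_empty, Subgroup.mem_bot] at hw
      subst hw
      exact one_smul R.weylGroup lam
    · rintro rfl
      exact MulAction.mem_orbit_self _
  rw [orbitSum, this, finsum_mem_singleton]

theorem lowerWeights_empty (lam : weightLattice R) :
    lowerWeights D ∅ lam = {mu | WeightLT D mu lam} := by
  ext mu
  exact ⟨fun h => h.2, fun h => ⟨mem_domWeights_empty D mu, h⟩⟩

variable (k dt) in
/-- The nonsymmetric Jacobi polynomials. -/
abbrev nonsymJacobi (lam : weightLattice R) : Laurent R := jacobi D ∅ k dt lam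

theorem nonsymJacobi_sub_mem (hk0 : ∀ i, 0 ≤ k i) (lam : weightLattice R) :
    nonsymJacobi k dt D lam - expo lam ∈ lowerSpan D lam := by
  have h := (isJacobi_jacobi dt D ∅ hk0 lam).1
  rw [orbitSum_empty, lowerWeights_empty] at h
  rw [lowerSpan, show (expo : weightLattice R → Laurent R) = orbitSum R ∅ from
    funext fun lam => (orbitSum_empty lam).symm, orbitSum_empty]
  exact h

theorem innerK_nonsymJacobi_of_mem (hk0 : ∀ i, 0 ≤ k i) {lam : weightLattice R} {phi : Laurent R}
    (h : phi ∈ lowerSpan D lam) : innerK R k dt (nonsymJacobi k dt D lam) phi = 0 := by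
  refine innerK_eq_zero_of_mem_span hk0 ?_ h
  rintro _ ⟨mu, hmu, rfl⟩
  have := (isJacobi_jacobi dt D ∅ hk0 lam).2 mu (by rwa [lowerWeights_empty])
  rwa [orbitSum_empty] at this

theorem cherednik_mem_lowerSpan (f : Module.Dual ℝ M) {lam : weightLattice R} {phi : Laurent R}
    (h : phi ∈ lowerSpan D lam) : cherednik D k f phi ∈ lowerSpan D lam := by
  induction h using Submodule.span_induction with
  | mem x hx =>
    obtain ⟨mu, hmu, rfl⟩ := hx
    have h1 := cherednik_triangular D k f mu
    have h2 : lowerSpan D mu ≤ lowerSpan D lam :=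
      Submodule.span_mono (Set.image_mono fun nu hnu => WeightLT.trans hnu hmu)
    have h3 := add_mem (h2 h1) (Submodule.smul_mem _ (f (spectralWeight D k mu) : ℂ)
      (expo_mem_lowerSpan hmu))
    rwa [sub_add_cancel] at h3
  | zero => rw [map_zero]; exact zero_mem _
  | add x y _ _ hx hy => rw [map_add]; exact add_mem hx hy
  | smul c x _ hx => rw [map_smul]; exact Submodule.smul_mem _ c hx

/-- By triangularity `(T_f - c)E` lies in the span of the lower monomials. By symmetry of `T_f`,
which preserves that span, it is also orthogonal to the span, hence to itself. -/
theorem cherednik_nonsymJacobi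
    (hkW : ∀ (w : R.weylGroup) (i : ι), k (R.weylGroupToPerm w i) = k i)
    (hk0 : ∀ i, 0 ≤ k i) (f : Module.Dual ℝ M) (lam : weightLattice R) :
    cherednik D k f (nonsymJacobi k dt D lam) =
      (f (spectralWeight D k lam) : ℂ) • nonsymJacobi k dt D lam := by
  set E := nonsymJacobi k dt D lam with hE
  set c : ℂ := (f (spectralWeight D k lam) : ℂ) with hc
  have hl := nonsymJacobi_sub_mem (dt := dt) D hk0 lam
  have h1 : cherednik D k f E - c • E ∈ lowerSpan D lam := by
    have h2 := add_mem (cherednik_triangular D k f lam) (sub_mem (cherednik_mem_lowerSpan D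
      (k := k) f hl) (Submodule.smul_mem _ c hl))
    convert! h2 using 1
    rw [map_sub, smul_sub]
    abel
  rw [← sub_eq_zero]
  by_contra hne
  apply innerK_self_ne_zero (dt := dt) hk0 hne
  have h3 : ∀ u ∈ lowerSpan D lam, innerK R k dt u (cherednik D k f E - c • E) = 0 := by
    intro u hu
    rw [← innerLin_apply hk0, map_sub, LinearMap.map_smul, innerLin_apply, innerLin_apply,
      ← innerK_cherednik hkW hk0, innerK_eq_zero_symm (innerK_nonsymJacobi_of_mem D hk0
        (cherednik_mem_lowerSpan D f hu)),
      innerK_eq_zero_symm (innerK_nonsymJacobi_of_mem D hk0 hu), smul_zero, sub_zero]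
  exact h3 _ h1

theorem smul_innerK_cherednik
    (hkW : ∀ (w : R.weylGroup) (i : ι), k (R.weylGroupToPerm w i) = k i)
    (hk0 : ∀ i, 0 ≤ k i) (f : Module.Dual ℝ M) (phi : Laurent R) (nu : weightLattice R) :
    innerK R k dt (cherednik D k f phi) (nonsymJacobi k dt D nu) =
      (f (spectralWeight D k nu) : ℂ) * innerK R k dt phi (nonsymJacobi k dt D nu) := by
  rw [innerK_cherednik hkW hk0, cherednik_nonsymJacobi D hkW hk0, ← innerLin_apply hk0,
    LinearMap.map_smul]
  rfl

/-- In the applications `c` is an inner product to be shown zero: if it were not, it could be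
cancelled and two spectral weights would coincide. -/
theorem eq_of_forall_dual {x y : M} {c : ℂ} (hc : c ≠ 0)
    (h : ∀ f : Module.Dual ℝ M, (f x : ℂ) * c = (f y : ℂ) * c) : x = y := by
  rw [← sub_eq_zero, ← Module.forall_dual_apply_eq_zero_iff ℝ]
  intro f
  rw [map_sub, sub_eq_zero]
  exact_mod_cast mul_right_cancel₀ hc (h f)

theorem innerK_nonsymJacobi
    (hkW : ∀ (w : R.weylGroup) (i : ι), k (R.weylGroupToPerm w i) = k i)
    (hk0 : ∀ i, 0 ≤ k i) {lam nu : weightLattice R} (hne : lam ≠ nu) :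
    innerK R k dt (nonsymJacobi k dt D lam) (nonsymJacobi k dt D nu) = 0 := by
  by_contra h0
  refine hne (spectralWeight_injective D hk0 (eq_of_forall_dual h0 fun f => ?_))
  rw [← smul_innerK_cherednik D hkW hk0, cherednik_nonsymJacobi D hkW hk0, innerK_smul_left,
    Complex.conj_ofReal]

/-- So `s_a E_lam` involves only `E_lam` and `E_{s_a lam}`. Pairing the cross relation with `E_nu`
loses its scalar term since `nu ≠ lam`. A nonzero product would then force the spectral weights of
`lam` and `nu` to be exchanged by `s_a`. -/
theorem innerK_sRefl_nonsymJacobi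
    (hkW : ∀ (w : R.weylGroup) (i : ι), k (R.weylGroupToPerm w i) = k i)
    (hk0 : ∀ i, 0 ≤ k i) {a : ι} (ha : a ∈ D.support) {lam nu : weightLattice R} (h1 : nu ≠ lam)
    (h2 : nu ≠ sRefl R a • lam) :
    innerK R k dt (weylAct R (sRefl R a) (nonsymJacobi k dt D lam)) (nonsymJacobi k dt D nu) =
      0 := by
  by_contra h0
  have h3 : spectralWeight D k lam = sRefl R a • spectralWeight D k nu := by
    refine eq_of_forall_dual h0 fun f => ?_
    have h4 := weylAct_cherednik D hkW ha f (nonsymJacobi k dt D lam)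
    rw [cherednik_nonsymJacobi D hkW hk0, map_smul, ← sub_eq_iff_eq_add] at h4
    have h5 := smul_innerK_cherednik (dt := dt) D hkW hk0 (reflForm (R := R) f a)
      (weylAct R (sRefl R a) (nonsymJacobi k dt D lam)) nu
    rw [← h4, reflForm_apply, sub_eq_add_neg, ← neg_smul, innerK_add_left hk0, innerK_smul_left,
      innerK_smul_left, innerK_nonsymJacobi D hkW hk0 h1.symm, mul_zero, add_zero,
      Complex.conj_ofReal] at h5
    exact h5
  have h6 := eq_smul_of_spectralWeight_eq D hk0 hkW h3
  apply h2
  rw [h6, smul_smul, sRefl_mul_self, one_smul]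

variable (k dt) in
/-- The span of the nonsymmetric Jacobi polynomials with labels in a set. -/
def nonsymSpan (S : Set (weightLattice R)) : Submodule ℂ (Laurent R) :=
  Submodule.span ℂ (nonsymJacobi k dt D '' S)

theorem expo_mem_nonsymSpan (hk0 : ∀ i, 0 ≤ k i) (lam : weightLattice R) :
    expo lam ∈ nonsymSpan k dt D {mu | WeightLE D mu lam} := by
  induction lam using (wellFounded_weightLT D).induction with
  | _ lam ih =>
    have h1 := nonsymJacobi_sub_mem (dt := dt) D hk0 lam
    have h2 : lowerSpan D lam ≤ nonsymSpan k dt D {mu | WeightLE D mu lam} := by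
      rw [lowerSpan, Submodule.span_le]
      rintro _ ⟨mu, hmu, rfl⟩
      exact Submodule.span_mono (Set.image_mono fun nu hnu => WeightLE.trans hnu hmu.1) (ih mu hmu)
    have h3 : nonsymJacobi k dt D lam ∈ nonsymSpan k dt D {mu | WeightLE D mu lam} :=
      Submodule.subset_span ⟨lam, WeightLE.refl D lam, rfl⟩
    have h4 := sub_mem h3 (h2 h1)
    rwa [sub_sub_cancel] at h4

theorem mem_nonsymSpan_univ (hk0 : ∀ i, 0 ≤ k i) (phi : Laurent R) :
    phi ∈ Submodule.span ℂ (Set.range (nonsymJacobi k dt D)) := by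
  have h1 : (⊤ : Submodule ℂ (Laurent R)) ≤
      Submodule.span ℂ (Set.range (nonsymJacobi k dt D)) := by
    rw [← (expBasis R).span_eq, Submodule.span_le]
    rintro _ ⟨lam, rfl⟩
    exact Submodule.span_mono (Set.image_subset_range _ _) (expo_mem_nonsymSpan D hk0 lam)
  exact h1 trivial

theorem nonsymJacobi_ne_zero (hk0 : ∀ i, 0 ≤ k i) (lam : weightLattice R) :
    nonsymJacobi k dt D lam ≠ 0 := by
  intro h0
  have h1 := nonsymJacobi_sub_mem (dt := dt) D hk0 lam
  rw [h0, zero_sub, neg_mem_iff] at h1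
  have h2 := (expBasis R).linearIndependent.notMem_span_image (s := {mu | WeightLT D mu lam})
    (x := lam) fun h => h.2 rfl
  exact h2 h1

theorem mem_nonsymSpan_of_orthogonal
    (hkW : ∀ (w : R.weylGroup) (i : ι), k (R.weylGroupToPerm w i) = k i)
    (hk0 : ∀ i, 0 ≤ k i) {S : Set (weightLattice R)} {phi : Laurent R}
    (h : ∀ nu ∉ S, innerK R k dt phi (nonsymJacobi k dt D nu) = 0) :
    phi ∈ nonsymSpan k dt D S := by
  obtain ⟨c, rfl⟩ := Finsupp.mem_span_range_iff_exists_finsupp.1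
    (mem_nonsymSpan_univ (dt := dt) D hk0 phi)
  rw [nonsymSpan, Finsupp.mem_span_image_iff_linearCombination]
  refine ⟨c, ?_, Finsupp.linearCombination_apply _ _⟩
  rw [Finsupp.mem_supported]
  intro nu hnu
  by_contra hS
  have h1 := innerK_eq_zero_symm (h nu hS)
  rw [← innerLin_apply hk0, Finsupp.sum, map_sum, Finset.sum_eq_single nu, LinearMap.map_smul,
    innerLin_apply, smul_eq_mul, mul_eq_zero] at h1
  · rcases h1 with h1 | h1
    · exact Finsupp.mem_support_iff.1 hnu h1
    · exact innerK_self_ne_zero hk0 (nonsymJacobi_ne_zero D hk0 nu) h1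
  · intro mu _ hmu
    rw [LinearMap.map_smul, innerLin_apply, innerK_nonsymJacobi D hkW hk0 hmu.symm, smul_zero]
  · intro hnot
    exact absurd hnu hnot

theorem innerK_nonsymSpan
    (hkW : ∀ (w : R.weylGroup) (i : ι), k (R.weylGroupToPerm w i) = k i)
    (hk0 : ∀ i, 0 ≤ k i) {S S' : Set (weightLattice R)} (hS : ∀ lam ∈ S, lam ∉ S')
    {phi psi : Laurent R} (hphi : phi ∈ nonsymSpan k dt D S) (hpsi : psi ∈ nonsymSpan k dt D S') :
    innerK R k dt phi psi = 0 := by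
  refine innerK_eq_zero_of_span_span hk0 ?_ hphi hpsi
  rintro _ ⟨lam, hlam, rfl⟩ _ ⟨mu, hmu, rfl⟩
  refine innerK_nonsymJacobi D hkW hk0 ?_
  rintro rfl
  exact hS _ hlam hmu

theorem weylAct_mem_nonsymSpan
    (hkW : ∀ (w : R.weylGroup) (i : ι), k (R.weylGroupToPerm w i) = k i)
    (hk0 : ∀ i, 0 ≤ k i) {I : Set ι} (hI : I ⊆ D.support) {lam : weightLattice R}
    {w : R.weylGroup} (hw : w ∈ parabolic R I) {phi : Laurent R}
    (hphi : phi ∈ nonsymSpan k dt D (MulAction.orbit (parabolic R I) lam)) :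
    weylAct R w phi ∈ nonsymSpan k dt D (MulAction.orbit (parabolic R I) lam) := by
  have hstep : ∀ a ∈ I, ∀ psi ∈ nonsymSpan k dt D (MulAction.orbit (parabolic R I) lam),
      weylAct R (sRefl R a) psi ∈ nonsymSpan k dt D (MulAction.orbit (parabolic R I) lam) := by
    intro a ha psi hpsi
    have hle : nonsymSpan k dt D (MulAction.orbit (parabolic R I) lam) ≤
        (nonsymSpan k dt D (MulAction.orbit (parabolic R I) lam)).comap
          (weylAct R (sRefl R a)).toLinearMap := by
      rw [nonsymSpan, Submodule.span_le]
      rintro _ ⟨mu, hmu, rfl⟩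
      refine mem_nonsymSpan_of_orthogonal D hkW hk0 fun nu hnu => ?_
      refine innerK_sRefl_nonsymJacobi D hkW hk0 (hI ha) ?_ ?_
      · rintro rfl; exact hnu hmu
      · rintro rfl
        apply hnu
        have := MulAction.mem_orbit_of_mem_orbit
          (⟨sRefl R a, sRefl_mem_parabolic ha⟩ : parabolic R I) hmu
        exact this
    exact hle hpsi
  obtain ⟨l, hl, rfl⟩ := exists_word hw
  clear hw
  induction l with
  | nil => simpa [wordProd, weylAct_one] using hphi
  | cons a l ih =>
    have h1 : wordProd R (a :: l) = sRefl R a * wordProd R l := by simp [wordProd]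
    rw [h1, weylAct_mul]
    exact hstep a (hl a (by simp)) _ (ih fun b hb => hl b (List.mem_cons_of_mem _ hb))

/-! #### Symmetrization over a parabolic subgroup -/

variable (R) in
/-- The sum over a parabolic subgroup. -/
def parabolicSum : Laurent R →ₗ[ℂ] Laurent R :=
  letI := Fintype.ofFinite (parabolic R I)
  ∑ w : parabolic R I, (weylAct R (w : R.weylGroup)).toLinearMap

theorem parabolicSum_apply [Fintype (parabolic R I)] (phi : Laurent R) :
    parabolicSum R I phi = ∑ w : parabolic R I, weylAct R (w : R.weylGroup) phi := by
  rw [parabolicSum, LinearMap.sum_apply]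
  refine Finset.sum_congr ?_ fun _ _ => rfl
  ext; simp

theorem weylAct_parabolicSum {w : R.weylGroup} (hw : w ∈ parabolic R I) (phi : Laurent R) :
    weylAct R w (parabolicSum R I phi) = parabolicSum R I phi := by
  let := Fintype.ofFinite (parabolic R I)
  rw [parabolicSum_apply, map_sum,
    ← Equiv.sum_comp (Equiv.mulLeft (⟨w, hw⟩ : parabolic R I)) fun u : parabolic R I =>
      weylAct R (u : R.weylGroup) phi]
  refine Finset.sum_congr rfl fun u _ => ?_
  rw [← weylAct_mul]; rfl

theorem parabolicSum_weylAct {w : R.weylGroup} (hw : w ∈ parabolic R I) (phi : Laurent R) :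
    parabolicSum R I (weylAct R w phi) = parabolicSum R I phi := by
  let := Fintype.ofFinite (parabolic R I)
  rw [parabolicSum_apply, parabolicSum_apply,
    ← Equiv.sum_comp (Equiv.mulRight (⟨w, hw⟩ : parabolic R I)) fun u : parabolic R I =>
      weylAct R (u : R.weylGroup) phi]
  refine Finset.sum_congr rfl fun u _ => ?_
  rw [← weylAct_mul]; rfl

theorem parabolicSum_of_invariant {phi : Laurent R}
    (h : ∀ w ∈ parabolic R I, weylAct R w phi = phi) :
    parabolicSum R I phi = (Nat.card (parabolic R I) : ℂ) • phi := by
  let := Fintype.ofFinite (parabolic R I)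
  rw [parabolicSum_apply, Finset.sum_congr rfl fun (w : parabolic R I) _ => h w w.2, Finset.sum_const,
    Finset.card_univ, Nat.card_eq_fintype_card, Nat.cast_smul_eq_nsmul]

theorem innerK_parabolicSum
    (hkW : ∀ (w : R.weylGroup) (i : ι), k (R.weylGroupToPerm w i) = k i)
    (hk0 : ∀ i, 0 ≤ k i) (phi psi : Laurent R)
    (h : ∀ w ∈ parabolic R I, weylAct R w phi = phi) :
    innerK R k dt phi (parabolicSum R I psi) =
      (Nat.card (parabolic R I) : ℂ) * innerK R k dt phi psi := by
  let := Fintype.ofFinite (parabolic R I)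
  rw [parabolicSum_apply, ← innerLin_apply hk0, map_sum]
  have : ∀ w ∈ (Finset.univ : Finset (parabolic R I)),
      innerLin dt hk0 phi (weylAct R (w : R.weylGroup) psi) = innerK R k dt phi psi := by
    intro w _
    rw [innerLin_apply]
    nth_rw 1 [← h w w.2]
    rw [innerK_weylAct dt hkW]
  rw [Finset.sum_congr rfl this, Finset.sum_const, Finset.card_univ, Nat.card_eq_fintype_card,
    nsmul_eq_mul]

theorem finite_orbit (lam : weightLattice R) :
    (MulAction.orbit (parabolic R I) lam).Finite := Set.finite_range _

theorem orbitSum_eq_sum (lam : weightLattice R) :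
    orbitSum R I lam = ∑ mu ∈ (finite_orbit I lam).toFinset, expo mu := by
  rw [orbitSum, finsum_mem_eq_finite_toFinset_sum _ (finite_orbit I lam)]

theorem orbitSum_smul {w : R.weylGroup} (hw : w ∈ parabolic R I) (lam : weightLattice R) :
    orbitSum R I (w • lam) = orbitSum R I lam := by
  have : MulAction.orbit (parabolic R I) (w • lam) = MulAction.orbit (parabolic R I) lam :=
    MulAction.orbit_eq_iff.2 ⟨⟨w, hw⟩, rfl⟩
  rw [orbitSum, this, orbitSum]

theorem weylAct_orbitSum {w : R.weylGroup} (hw : w ∈ parabolic R I) (lam : weightLattice R) :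
    weylAct R w (orbitSum R I lam) = orbitSum R I lam := by
  rw [orbitSum_eq_sum, map_sum]
  refine Finset.sum_equiv (MulAction.toPerm w) (fun mu => ?_) fun mu _ => weylAct_expo w mu
  simp only [Set.Finite.mem_toFinset, MulAction.toPerm_apply]
  constructor
  · intro h
    exact MulAction.mem_orbit_of_mem_orbit (⟨w, hw⟩ : parabolic R I) h
  · intro h
    have := MulAction.mem_orbit_of_mem_orbit (⟨w, hw⟩⁻¹ : parabolic R I) h
    change w⁻¹ • w • mu ∈ _ at this
    rwa [inv_smul_smul] at this

/-- The constant is the order of the stabilizer. It is obtained by summing `m_I(lam)` over `W_I` in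
two ways, as an invariant and term by term. -/
theorem parabolicSum_expo (lam : weightLattice R) :
    ∃ c : ℂ, c ≠ 0 ∧ parabolicSum R I (expo lam) = c • orbitSum R I lam := by
  have h1 := parabolicSum_of_invariant I (phi := orbitSum R I lam)
    fun w hw => weylAct_orbitSum I hw lam
  have h2 : parabolicSum R I (orbitSum R I lam) =
      ((finite_orbit I lam).toFinset.card : ℂ) • parabolicSum R I (expo lam) := by
    rw [orbitSum_eq_sum, map_sum, Nat.cast_smul_eq_nsmul]
    refine Finset.sum_eq_card_nsmul fun mu hmu => ?_
    rw [Set.Finite.mem_toFinset] at hmu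
    obtain ⟨w, rfl⟩ := hmu
    change parabolicSum R I (expo ((w : R.weylGroup) • lam)) = _
    rw [← weylAct_expo, parabolicSum_weylAct I w.2]
  have h3 : ((finite_orbit I lam).toFinset.card : ℂ) ≠ 0 := by
    rw [Nat.cast_ne_zero, Finset.card_ne_zero]
    exact ⟨lam, (Set.Finite.mem_toFinset _).2 (MulAction.mem_orbit_self _)⟩
  have h4 : (Nat.card (parabolic R I) : ℂ) ≠ 0 := Nat.cast_ne_zero.2 Nat.card_pos.ne'
  refine ⟨((finite_orbit I lam).toFinset.card : ℂ)⁻¹ * Nat.card (parabolic R I),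
    mul_ne_zero (inv_ne_zero h3) h4, ?_⟩
  rw [mul_smul, ← h1, h2, inv_smul_smul₀ h3]

/-! #### The Jacobi polynomials attached to a parabolic subgroup -/

variable {I} (hI : I ⊆ D.support)
  (hkW : ∀ (w : R.weylGroup) (i : ι), k (R.weylGroupToPerm w i) = k i) (hk0 : ∀ i, 0 ≤ k i)
include hI hkW hk0

theorem jacobi_eq_parabolicSum {lam : weightLattice R} (hlam : lam ∈ domWeights D I) :
    ∃ c : ℂ, jacobi D I k dt lam = c • parabolicSum R I (nonsymJacobi k dt D lam) := by
  obtain ⟨c, hc, hsum⟩ := parabolicSum_expo I lam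
  refine ⟨c⁻¹, (existsUnique_isJacobi dt D I hk0 lam).unique (isJacobi_jacobi dt D I hk0 lam)
    ⟨?_, ?_⟩⟩
  · have h1 : c⁻¹ • parabolicSum R I (nonsymJacobi k dt D lam) - orbitSum R I lam =
        c⁻¹ • parabolicSum R I (nonsymJacobi k dt D lam - expo lam) := by
      rw [map_sub, hsum, smul_sub, inv_smul_smul₀ hc]
    rw [h1]
    refine Submodule.smul_mem _ _ ?_
    -- Symmetrizing `e^mu` gives a multiple of `m_I(mu')` with `mu'` the `I`-dominant weight of the
    -- orbit, and `mu' ≤ mu < lam`.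
    have h2 : lowerSpan D lam ≤ (Submodule.span ℂ (orbitSum R I '' lowerWeights D I lam)).comap
        (parabolicSum R I) := by
      rw [lowerSpan, Submodule.span_le]
      rintro _ ⟨mu, hmu, rfl⟩
      obtain ⟨d, -, hd⟩ := parabolicSum_expo I mu
      obtain ⟨w, hw, hle, hdom⟩ := exists_domWeights_le D I mu
      rw [SetLike.mem_coe, Submodule.mem_comap, hd, ← orbitSum_smul I hw mu]
      exact Submodule.smul_mem _ _ (Submodule.subset_span ⟨_, ⟨hdom, hle.trans_lt hmu⟩, rfl⟩)
    exact h2 (nonsymJacobi_sub_mem D hk0 lam)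
  · intro mu hmu
    rw [innerK_smul_left]
    obtain ⟨d, hd, hd'⟩ := parabolicSum_expo I mu
    have h3 : orbitSum R I mu = d⁻¹ • parabolicSum R I (expo mu) := by
      rw [hd', inv_smul_smul₀ hd]
    rw [h3, ← innerLin_apply hk0, LinearMap.map_smul, innerLin_apply, innerK_parabolicSum I hkW hk0
      _ _ fun w hw => weylAct_parabolicSum I hw _]
    -- The left side lies in the span of `E_nu` over `W_I lam`, the right side in that of `E_nu`
    -- with `nu ≤ mu`. These label sets are disjoint: `lam` is least in its orbit, so a common label
    -- would give `lam ≤ mu`.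
    have h4 : innerK R k dt (parabolicSum R I (nonsymJacobi k dt D lam)) (expo mu) = 0 := by
      refine innerK_nonsymSpan D hkW hk0 (S := MulAction.orbit (parabolic R I) lam) ?_ ?_
        (expo_mem_nonsymSpan D hk0 mu)
      · rintro _ ⟨w, rfl⟩ hle
        have h5 : WeightLE D lam mu := (weightLE_smul hI hlam w.2).trans hle
        exact hmu.2.2 (hmu.2.1.antisymm h5)
      · let := Fintype.ofFinite (parabolic R I)
        rw [parabolicSum_apply]
        exact sum_mem fun w _ => weylAct_mem_nonsymSpan D hkW hk0 hI w.2
          (Submodule.subset_span ⟨lam, MulAction.mem_orbit_self _, rfl⟩)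
    rw [h4, mul_zero, smul_zero, mul_zero]

theorem weylAct_jacobi {lam : weightLattice R} (hlam : lam ∈ domWeights D I)
    {w : R.weylGroup} (hw : w ∈ parabolic R I) :
    weylAct R w (jacobi D I k dt lam) = jacobi D I k dt lam := by
  obtain ⟨c, hc⟩ := jacobi_eq_parabolicSum (dt := dt) D hI hkW hk0 hlam
  rw [hc, map_smul, weylAct_parabolicSum I hw]

theorem jacobi_mem_nonsymSpan {lam : weightLattice R} (hlam : lam ∈ domWeights D I) :
    jacobi D I k dt lam ∈ nonsymSpan k dt D (MulAction.orbit (parabolic R I) lam) := by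
  obtain ⟨c, hc⟩ := jacobi_eq_parabolicSum (dt := dt) D hI hkW hk0 hlam
  let := Fintype.ofFinite (parabolic R I)
  rw [hc, parabolicSum_apply]
  exact Submodule.smul_mem _ _ (sum_mem fun w _ => weylAct_mem_nonsymSpan D hkW hk0 hI w.2
    (Submodule.subset_span ⟨lam, MulAction.mem_orbit_self _, rfl⟩))

theorem innerK_jacobi {lam mu : weightLattice R} (hlam : lam ∈ domWeights D I)
    (hmu : mu ∈ domWeights D I) (hne : lam ≠ mu) :
    innerK R k dt (jacobi D I k dt lam) (jacobi D I k dt mu) = 0 := by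
  refine innerK_nonsymSpan D hkW hk0 ?_ (jacobi_mem_nonsymSpan D hI hkW hk0 hlam)
    (jacobi_mem_nonsymSpan D hI hkW hk0 hmu)
  rintro _ ⟨w, rfl⟩ ⟨u, hu⟩
  have h1 : ((w : R.weylGroup)⁻¹ * u) • mu = lam := by
    rw [mul_smul, inv_smul_eq_iff]; exact hu
  apply hne
  rw [← h1]
  exact smul_eq_of_mem_domWeights hI hmu (mul_mem (inv_mem w.2) u.2) (h1 ▸ hlam)

omit hkW in
-- The coefficient of `e^lam` is `1`: the orbit of a lower `I`-dominant weight does not contain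
-- `lam`.
theorem jacobi_ne_zero {lam : weightLattice R} (hlam : lam ∈ domWeights D I) :
    jacobi D I k dt lam ≠ 0 := by
  intro h0
  have h1 := (isJacobi_jacobi dt D I hk0 lam).1
  rw [h0, zero_sub, neg_mem_iff] at h1
  have hcoord : ∀ mu, lam ∉ MulAction.orbit (parabolic R I) mu →
      (expBasis R).coord lam (orbitSum R I mu) = 0 := by
    intro mu hmu
    rw [orbitSum_eq_sum, map_sum]
    refine Finset.sum_eq_zero fun nu hnu => ?_
    rw [Set.Finite.mem_toFinset] at hnu
    rw [← expBasis_apply, Module.Basis.coord_apply, Module.Basis.repr_self,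
      Finsupp.single_eq_of_ne]
    rintro rfl
    exact hmu hnu
  have h2 : Submodule.span ℂ (orbitSum R I '' lowerWeights D I lam) ≤
      LinearMap.ker ((expBasis R).coord lam) := by
    rw [Submodule.span_le]
    rintro _ ⟨mu, hmu, rfl⟩
    refine hcoord mu ?_
    rintro ⟨w, hw⟩
    have hw' : (w : R.weylGroup) • mu = lam := hw
    have h3 := smul_eq_of_mem_domWeights hI hmu.1 w.2 (hw' ▸ hlam)
    exact hmu.2.2 (h3.symm.trans hw')
  have h3 := h2 h1
  rw [LinearMap.mem_ker, orbitSum_eq_sum, map_sum, Finset.sum_eq_single lam, ← expBasis_apply,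
    Module.Basis.coord_apply, Module.Basis.repr_self, Finsupp.single_eq_same] at h3
  · exact one_ne_zero h3
  · intro nu _ hnu
    rw [← expBasis_apply, Module.Basis.coord_apply, Module.Basis.repr_self,
      Finsupp.single_eq_of_ne hnu.symm]
  · intro h
    exact absurd ((Set.Finite.mem_toFinset _).2 (MulAction.mem_orbit_self _)) h

omit hI hkW in
theorem orbitSum_mem_span_jacobi {lam : weightLattice R} (hlam : lam ∈ domWeights D I) :
    orbitSum R I lam ∈ Submodule.span ℂ (jacobi D I k dt '' domWeights D I) := by
  induction lam using (wellFounded_weightLT D).induction with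
  | _ lam ih =>
    have h1 := (isJacobi_jacobi dt D I hk0 lam).1
    have h2 : Submodule.span ℂ (orbitSum R I '' lowerWeights D I lam) ≤
        Submodule.span ℂ (jacobi D I k dt '' domWeights D I) := by
      rw [Submodule.span_le]
      rintro _ ⟨mu, hmu, rfl⟩
      exact ih mu hmu.2 hmu.1
    have h3 : jacobi D I k dt lam ∈ Submodule.span ℂ (jacobi D I k dt '' domWeights D I) :=
      Submodule.subset_span ⟨lam, hlam, rfl⟩
    have h4 := sub_mem h3 (h2 h1)
    rwa [sub_sub_cancel] at h4

omit hI hkW in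
-- An invariant is a multiple of its own symmetrization, and the symmetrized monomials are multiples
-- of orbit sums of `I`-dominant weights.
theorem mem_span_jacobi {phi : Laurent R} (h : ∀ w ∈ parabolic R I, weylAct R w phi = phi) :
    phi ∈ Submodule.span ℂ (jacobi D I k dt '' domWeights D I) := by
  have h1 := parabolicSum_of_invariant I h
  have h4 : (Nat.card (parabolic R I) : ℂ) ≠ 0 := Nat.cast_ne_zero.2 Nat.card_pos.ne'
  have h2 : phi = (Nat.card (parabolic R I) : ℂ)⁻¹ • parabolicSum R I phi := by
    rw [h1, inv_smul_smul₀ h4]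
  rw [h2]
  refine Submodule.smul_mem _ _ ?_
  have h3 : (⊤ : Submodule ℂ (Laurent R)) ≤
      (Submodule.span ℂ (jacobi D I k dt '' domWeights D I)).comap (parabolicSum R I) := by
    rw [← (expBasis R).span_eq, Submodule.span_le]
    rintro _ ⟨mu, rfl⟩
    obtain ⟨d, -, hd⟩ := parabolicSum_expo I mu
    obtain ⟨w, hw, -, hdom⟩ := exists_domWeights_le D I mu
    rw [SetLike.mem_coe, Submodule.mem_comap, expBasis_apply, hd, ← orbitSum_smul I hw mu]
    exact Submodule.smul_mem _ _ (orbitSum_mem_span_jacobi D hk0 hdom)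
  exact h3 trivial

end JacobiPolynomials

/-! ### Vector-valued Laurent polynomials -/

section VectorValuedPolynomials

open MeasureTheory

variable {ι M N : Type*} [AddCommGroup M] [Module ℝ M] [NormedAddCommGroup N] [NormedSpace ℝ N]
  {R : RootPairing ι ℝ M N} [Fintype ι] [R.IsRootSystem] [R.IsCrystallographic]

variable {I : Set ι}

/-- The component of a vector-valued Laurent polynomial at a coset. -/
def component (x : R.weylGroup ⧸ parabolic R I) : VV R I →ₗ[ℂ] Laurent R :=
  (TensorProduct.rid ℂ (Laurent R)).toLinearMap ∘ₗ LinearMap.lTensor _ (LinearMap.proj x)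

theorem component_tmul (x : R.weylGroup ⧸ parabolic R I) (phi : Laurent R) (f : CosetFun R I) :
    component x (phi ⊗ₜ[ℂ] f) = f x • phi := by
  simp [component]

theorem component_smul (x : R.weylGroup ⧸ parabolic R I) (chi : Laurent R) (Phi : VV R I) :
    component x (chi • Phi) = chi * component x Phi := by
  induction Phi using TensorProduct.induction_on with
  | zero => simp
  | tmul phi f => simp [component_tmul, TensorProduct.smul_tmul']
  | add a b ha hb => rw [smul_add, map_add, ha, hb, map_add, mul_add]

theorem component_ext {Phi Psi : VV R I}
    (h : ∀ x : R.weylGroup ⧸ parabolic R I, component x Phi = component x Psi) : Phi = Psi := by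
  classical
  let _ := Fintype.ofFinite (R.weylGroup ⧸ parabolic R I)
  have hc : ∀ (x : R.weylGroup ⧸ parabolic R I) (Xi : VV R I),
      TensorProduct.piScalarRight ℂ ℂ (Laurent R) (R.weylGroup ⧸ parabolic R I) Xi x =
        component x Xi := by
    intro x Xi
    induction Xi using TensorProduct.induction_on with
    | zero => simp
    | tmul phi f => simp [component_tmul]
    | add a b ha hb => rw [map_add, map_add, Pi.add_apply, ha, hb]
  refine (TensorProduct.piScalarRight ℂ ℂ (Laurent R)
    (R.weylGroup ⧸ parabolic R I)).injective ?_
  funext x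
  rw [hc, hc, h]

theorem component_vvAct (w : R.weylGroup) (x : R.weylGroup ⧸ parabolic R I) (Phi : VV R I) :
    component x (vvAct R I w Phi) = weylAct R w (component (w⁻¹ • x) Phi) := by
  induction Phi using TensorProduct.induction_on with
  | zero => simp
  | tmul phi f => simp [vvAct, cosetAct, component_tmul, LinearMap.funLeft_apply]
  | add a b ha hb => rw [map_add, map_add, ha, hb, map_add, map_add]

theorem vvEvalAt_apply (t : Torus R) (Phi : VV R I) (x : R.weylGroup ⧸ parabolic R I) :
    vvEvalAt R I t Phi x = evalAt R t (component x Phi) := by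
  induction Phi using TensorProduct.induction_on with
  | zero => simp
  | tmul phi f => simp [vvEvalAt, component_tmul, mul_comm]
  | add a b ha hb => rw [map_add, Pi.add_apply, ha, hb, map_add, map_add]

variable (D : SimpleSystem R) (hI : I ⊆ D.support)

theorem finite_minReps (J : Set ι) : (minReps D J).Finite := Set.toFinite _

theorem mk_eq_mk_one_iff (w : R.weylGroup) :
    (QuotientGroup.mk w : R.weylGroup ⧸ parabolic R I) = QuotientGroup.mk 1 ↔
      w ∈ parabolic R I := by
  rw [eq_comm, QuotientGroup.eq]; simp

theorem component_vvAct_deltaOne (u w : R.weylGroup) (phi : Laurent R) [Decidable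
    ((QuotientGroup.mk w : R.weylGroup ⧸ parabolic R I) = QuotientGroup.mk u)] :
    component (QuotientGroup.mk w : R.weylGroup ⧸ parabolic R I)
      (vvAct R I u (phi ⊗ₜ[ℂ] deltaOne R I)) =
      if (QuotientGroup.mk w : R.weylGroup ⧸ parabolic R I) = QuotientGroup.mk u
        then weylAct R u phi else 0 := by
  have h : (QuotientGroup.mk w : R.weylGroup ⧸ parabolic R I) = QuotientGroup.mk u ↔
      u⁻¹ • (QuotientGroup.mk w : R.weylGroup ⧸ parabolic R I) = QuotientGroup.mk 1 := by
    rw [inv_smul_eq_iff, MulAction.Quotient.smul_mk, smul_eq_mul, mul_one]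
  rw [component_vvAct, component_tmul, deltaOne]
  split_ifs with hw
  · rw [Set.indicator_of_mem (Set.mem_singleton_iff.2 (h.1 hw)), one_smul]
  · rw [Set.indicator_of_notMem fun h' => hw (h.2 (Set.mem_singleton_iff.1 h')), zero_smul, map_zero]

theorem Gam_eq_sum (phi : Laurent R) :
    Gam I D phi = ∑ u ∈ (finite_minReps D I).toFinset,
      vvAct R I u (phi ⊗ₜ[ℂ] deltaOne R I) := by
  rw [Gam, finsum_mem_eq_finite_toFinset_sum _ (finite_minReps D I)]

include hI in
theorem component_Gam_of_mem (phi : Laurent R) {v : R.weylGroup} (hv : v ∈ minReps D I) :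
    component (QuotientGroup.mk v : R.weylGroup ⧸ parabolic R I) (Gam I D phi) =
      weylAct R v phi := by
  classical
  rw [Gam_eq_sum, map_sum, Finset.sum_eq_single v]
  · rw [component_vvAct_deltaOne, if_pos rfl]
  · intro u hu huv
    rw [component_vvAct_deltaOne, if_neg]
    intro h
    exact huv ((minReps_bijOn D hI).injOn ((Set.Finite.mem_toFinset _).1 hu) hv h.symm)
  · intro h
    exact absurd ((Set.Finite.mem_toFinset _).2 hv) h

include hI in
-- Invariance under `W_I` makes the answer independent of the representative of the coset, which
-- frees the later computations from `W^I`.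
theorem component_Gam {phi : Laurent R} (h : ∀ w ∈ parabolic R I, weylAct R w phi = phi)
    (w : R.weylGroup) :
    component (QuotientGroup.mk w : R.weylGroup ⧸ parabolic R I) (Gam I D phi) =
      weylAct R w phi := by
  obtain ⟨v, hv, hvw⟩ := (minReps_bijOn D hI).surjOn (Set.mem_univ
    (QuotientGroup.mk w : R.weylGroup ⧸ parabolic R I))
  have hvw' : (QuotientGroup.mk v : R.weylGroup ⧸ parabolic R I) = QuotientGroup.mk w := hvw
  rw [← hvw', component_Gam_of_mem D hI phi hv]
  have h1 := h _ (QuotientGroup.eq.1 hvw')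
  nth_rw 1 [← h1]
  rw [← weylAct_mul, mul_inv_cancel_left]

include hI in
theorem Gam_mem_vvInvariants {phi : Laurent R} (h : phi ∈ scalarInvariants R I) :
    Gam I D phi ∈ vvInvariants R I := by
  intro w
  refine component_ext fun x => ?_
  obtain ⟨u, rfl⟩ := QuotientGroup.mk_surjective x
  rw [component_vvAct, MulAction.Quotient.smul_mk, component_Gam D hI h, component_Gam D hI h,
    ← weylAct_mul, smul_eq_mul, mul_inv_cancel_left]

theorem component_mem_scalarInvariants {Phi : VV R I} (h : Phi ∈ vvInvariants R I) :
    component (QuotientGroup.mk 1 : R.weylGroup ⧸ parabolic R I) Phi ∈ scalarInvariants R I := by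
  intro w hw
  have h1 : w⁻¹ • (QuotientGroup.mk 1 : R.weylGroup ⧸ parabolic R I) = QuotientGroup.mk 1 := by
    rw [MulAction.Quotient.smul_mk, mk_eq_mk_one_iff, smul_eq_mul, mul_one]
    exact inv_mem hw
  have h2 := component_vvAct w (QuotientGroup.mk 1 : R.weylGroup ⧸ parabolic R I) Phi
  rw [h w, h1] at h2
  exact h2.symm

include hI in
theorem Gam_component {Phi : VV R I} (h : Phi ∈ vvInvariants R I) :
    Gam I D (component (QuotientGroup.mk 1 : R.weylGroup ⧸ parabolic R I) Phi) = Phi := by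
  refine component_ext fun x => ?_
  obtain ⟨u, rfl⟩ := QuotientGroup.mk_surjective x
  rw [component_Gam D hI (component_mem_scalarInvariants h)]
  have h2 := component_vvAct u (QuotientGroup.mk u : R.weylGroup ⧸ parabolic R I) Phi
  rw [h u, MulAction.Quotient.smul_mk, smul_eq_mul, inv_mul_cancel] at h2
  exact h2.symm

/-- The isomorphism `Γ : ℂ[P]^{W_I} ≃ (ℂ[P] ⊗ ℂ[W/W_I])^W`. -/
def gamEquiv : scalarInvariants R I ≃ₗ[laurentInvariants R ⊤] vvInvariants R I where
  toFun phi := ⟨Gam I D phi, Gam_mem_vvInvariants D hI phi.2⟩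
  -- A `W`-invariant vector is determined by its component at `eW_I`, because the one at `uW_I` is
  -- its image under `u`.
  invFun Phi := ⟨component (QuotientGroup.mk 1) (Phi : VV R I), component_mem_scalarInvariants Phi.2⟩
  map_add' phi psi := by
    refine Subtype.ext ?_
    change Gam I D ((phi : Laurent R) + psi) = Gam I D phi + Gam I D psi
    simp only [Gam_eq_sum, TensorProduct.add_tmul, map_add, Finset.sum_add_distrib]
  map_smul' chi phi := by
    refine Subtype.ext (component_ext fun x => ?_)
    obtain ⟨u, rfl⟩ := QuotientGroup.mk_surjective x
    change component _ (Gam I D ((chi : Laurent R) * phi)) =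
      component _ ((chi : Laurent R) • Gam I D (phi : Laurent R))
    rw [component_smul, component_Gam D hI (phi := (chi : Laurent R) * phi) (chi • phi).2,
      component_Gam D hI phi.2, map_mul, chi.2 u trivial]
  left_inv phi := by
    refine Subtype.ext ?_
    change component _ (Gam I D (phi : Laurent R)) = phi
    rw [component_Gam D hI phi.2, weylAct_one]
  right_inv Phi := Subtype.ext (Gam_component D hI Phi.2)

theorem coe_gamEquiv (phi : scalarInvariants R I) :
    (gamEquiv D hI phi : VV R I) = Gam I D (phi : Laurent R) := rfl

/-! #### The inner product -/

variable {k : ι → ℝ} (dt : Measure (Torus R)) [dt.IsAddHaarMeasure]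

theorem vvIntegrand_eq_sum (Phi Psi : VV R I) (t : Torus R) :
    vvIntegrand D I k Phi Psi t = ∑ v ∈ (finite_minReps D I).toFinset,
      integrand R k (component (QuotientGroup.mk v) Phi) (component (QuotientGroup.mk v) Psi) t := by
  rw [vvIntegrand, compSum, finsum_mem_eq_finite_toFinset_sum _ (finite_minReps D I),
    Finset.sum_mul]
  refine Finset.sum_congr rfl fun v _ => ?_
  rw [integrand, Pi.mul_apply, ← vvEvalAt_apply, ← vvEvalAt_apply]
  rfl

theorem integrable_vvIntegrand (hk0 : ∀ i, 0 ≤ k i) (Phi Psi : VV R I) :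
    Integrable (vvIntegrand D I k Phi Psi) dt := by
  rw [show vvIntegrand D I k Phi Psi = _ from funext (vvIntegrand_eq_sum D Phi Psi)]
  exact integrable_finsetSum _ fun v _ => integrable_integrand dt hk0 _ _

theorem vvInner_eq_sum (hk0 : ∀ i, 0 ≤ k i) (Phi Psi : VV R I) :
    vvInner D I k dt Phi Psi = ∑ v ∈ (finite_minReps D I).toFinset,
      innerK R k dt (component (QuotientGroup.mk v) Phi) (component (QuotientGroup.mk v) Psi) := by
  rw [vvInner, show vvIntegrand D I k Phi Psi = _ from funext (vvIntegrand_eq_sum D Phi Psi),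
    integral_finsetSum _ fun v _ => integrable_integrand dt hk0 _ _]
  rfl

include hI in
-- The component at `vW_I` contributes `(vφ, vψ)_k = (φ, ψ)_k` for each `v ∈ W^I`.
theorem vvInner_Gam (hkW : ∀ (w : R.weylGroup) (i : ι), k (R.weylGroupToPerm w i) = k i)
    (hk0 : ∀ i, 0 ≤ k i) (phi psi : Laurent R) :
    vvInner D I k dt (Gam I D phi) (Gam I D psi) =
      (minReps D I).ncard * innerK R k dt phi psi := by
  rw [vvInner_eq_sum D dt hk0, Set.ncard_eq_toFinset_card _ (finite_minReps D I), ← nsmul_eq_mul]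
  refine Finset.sum_eq_card_nsmul fun v hv => ?_
  rw [Set.Finite.mem_toFinset] at hv
  rw [component_Gam_of_mem D hI _ hv, component_Gam_of_mem D hI _ hv, innerK_weylAct dt hkW]

theorem ncard_minReps_pos (J : Set ι) : 0 < (minReps D J).ncard := by
  rw [Set.ncard_pos (finite_minReps D J)]
  obtain ⟨v, hv, -⟩ := exists_minRep D J 1
  exact ⟨v, hv⟩

theorem linearIndependent_jacobi
    (hI : I ⊆ D.support) (hkW : ∀ (w : R.weylGroup) (i : ι), k (R.weylGroupToPerm w i) = k i)
    (hk0 : ∀ i, 0 ≤ k i) :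
    LinearIndependent ℂ fun lam : domWeights D I => jacobi D I k dt (lam : weightLattice R) := by
  rw [linearIndependent_iff']
  intro s c hc lam hlam
  have h1 : innerLin dt hk0 (jacobi D I k dt (lam : weightLattice R))
      (∑ mu ∈ s, c mu • jacobi D I k dt (mu : weightLattice R)) = 0 := by rw [hc, map_zero]
  rw [map_sum, Finset.sum_eq_single lam, LinearMap.map_smul, innerLin_apply, smul_eq_mul,
    mul_eq_zero] at h1
  · exact h1.resolve_right (innerK_self_ne_zero hk0 (jacobi_ne_zero D hI hk0 lam.2))
  · intro mu _ hmu
    rw [LinearMap.map_smul, innerLin_apply, innerK_jacobi D hI hkW hk0 lam.2 mu.2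
      (fun h => hmu (Subtype.ext h.symm)), smul_zero]
  · intro h
    exact absurd hlam h

theorem exists_basis_vvJacobi
    (hI : I ⊆ D.support) (hkW : ∀ (w : R.weylGroup) (i : ι), k (R.weylGroupToPerm w i) = k i)
    (hk0 : ∀ i, 0 ≤ k i) :
    ∃ B : Module.Basis (domWeights D I) ℂ (vvInvariants R I),
      ∀ lam : domWeights D I, (B lam : VV R I) = vvJacobi D I k dt (lam : weightLattice R) := by
  let S : Submodule ℂ (Laurent R) := (scalarInvariants R I).restrictScalars ℂ
  have hS : S = Submodule.span ℂ
      (Set.range fun lam : domWeights D I => jacobi D I k dt (lam : weightLattice R)) := by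
    refine le_antisymm (fun phi hphi => ?_) (Submodule.span_le.2 ?_)
    · rw [← Set.image_eq_range]
      exact mem_span_jacobi D hk0 hphi
    · rintro _ ⟨lam, rfl⟩
      exact fun w hw => weylAct_jacobi D hI hkW hk0 lam.2 hw
  let B := (Module.Basis.span (linearIndependent_jacobi D dt hI hkW hk0)).map
    ((LinearEquiv.ofEq _ _ hS.symm).trans ((gamEquiv D hI).restrictScalars ℂ))
  refine ⟨B, fun lam => ?_⟩
  have h1 : B lam = gamEquiv D hI ⟨jacobi D I k dt (lam : weightLattice R),
      fun w hw => weylAct_jacobi D hI hkW hk0 lam.2 hw⟩ := by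
    rw [Module.Basis.map_apply]
    have h2 := congrArg Subtype.val
      (Module.Basis.span_apply (linearIndependent_jacobi D dt hI hkW hk0) lam)
    exact congrArg (gamEquiv D hI) (Subtype.ext h2)
  rw [h1]
  rfl

end VectorValuedPolynomials

end VVJacobi

end

/-! ### Assembly of the theorem -/

open VVJacobi

theorem mainTheorem6
    {ι M N : Type*} [Fintype ι] [AddCommGroup M] [Module ℝ M]
    [NormedAddCommGroup N] [NormedSpace ℝ N]
    (R : RootPairing ι ℝ M N) [R.IsRootSystem] [R.IsCrystallographic]
    (D : SimpleSystem R) (I : Set ι) (hI : I ⊆ D.support)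
    (k : ι → ℝ) (hk0 : ∀ i, 0 ≤ k i)
    (hkW : ∀ (w : R.weylGroup) (i : ι), k (R.weylGroupToPerm w i) = k i)
    (dt : MeasureTheory.Measure (Torus R)) [dt.IsAddHaarMeasure] :
    -- the integrals that define the inner products converge
    (∀ phi psi : Laurent R, MeasureTheory.Integrable (integrand R k phi psi) dt) ∧
    (∀ Phi Psi : VV R I, MeasureTheory.Integrable (vvIntegrand D I k Phi Psi) dt) ∧
    -- `Γ` is an isomorphism of `ℂ[P]^W`-modules from `ℂ[P]^{W_I}` onto `(ℂ[P] ⊗ ℂ[W/W_I])^W`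
    (∃ G : scalarInvariants R I ≃ₗ[laurentInvariants R ⊤] vvInvariants R I,
      ∀ phi : scalarInvariants R I, (G phi : VV R I) = Gam I D (phi : Laurent R)) ∧
    -- `Γ` respects the inner products up to the factor `|W^I|`
    (∀ phi ∈ scalarInvariants R I, ∀ psi ∈ scalarInvariants R I,
      vvInner D I k dt (Gam I D phi) (Gam I D psi) =
        (minReps D I).ncard * innerK R k dt phi psi) ∧
    -- the Jacobi polynomials `p_I(lam, k)` are well defined and lie in `ℂ[P]^{W_I}`
    (∀ lam ∈ domWeights D I,
      (∃! p : Laurent R, IsJacobi D I k dt lam p) ∧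
        jacobi D I k dt lam ∈ scalarInvariants R I) ∧
    -- the `P_I(lam, k) = Γ(p_I(lam, k))` form an orthogonal basis of `(ℂ[P] ⊗ ℂ[W/W_I])^W`
    (∃ B : Module.Basis (domWeights D I) ℂ (vvInvariants R I),
      ∀ lam : domWeights D I, (B lam : VV R I) = vvJacobi D I k dt (lam : weightLattice R)) ∧
    (∀ lam ∈ domWeights D I, ∀ mu ∈ domWeights D I, lam ≠ mu →
      vvInner D I k dt (vvJacobi D I k dt lam) (vvJacobi D I k dt mu) = 0) ∧
    (∀ lam ∈ domWeights D I,
      0 < (vvInner D I k dt (vvJacobi D I k dt lam) (vvJacobi D I k dt lam)).re) := by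
  refine ⟨integrable_integrand dt hk0, integrable_vvIntegrand D dt hk0,
    ⟨gamEquiv D hI, coe_gamEquiv D hI⟩,
    fun phi _ psi _ => vvInner_Gam D hI dt hkW hk0 phi psi,
    fun lam hlam => ⟨existsUnique_isJacobi dt D I hk0 lam,
      fun w hw => weylAct_jacobi D hI hkW hk0 hlam hw⟩,
    exists_basis_vvJacobi D dt hI hkW hk0, fun lam hlam mu hmu hne => ?_, fun lam hlam => ?_⟩
  · rw [vvJacobi, vvJacobi, vvInner_Gam D hI dt hkW hk0, innerK_jacobi D hI hkW hk0 hlam hmu hne,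
      mul_zero]
  · rw [vvJacobi, vvInner_Gam D hI dt hkW hk0, ← Complex.ofReal_natCast, Complex.re_ofReal_mul]
    exact mul_pos (Nat.cast_pos.2 (ncard_minReps_pos D I))
      (innerK_self_pos hk0 (jacobi_ne_zero D hI hk0 hlam))
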